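/- **Theorem (hardness amplification for weakly verifiable quantum puzzles).** A *weakly verifiable quantum puzzle* is a triple of (uniform) quantum polynomial-time (QPT) algorithms: $\mathsf{CheckGen}(1^\lambda)\to k$ outputs a classical check key $k$; $\mathsf{PuzzleGen}(k)\to\mathsf{puz}$ outputs a (possibly mixed) quantum state; $\mathsf{Ver}(\mathsf{ans},k)\to\top/\bot$ takes a quantum state $\mathsf{ans}$ and $k$, and accepts or rejects. All three also receive $1^\lambda$. For $t\in\mathbb N$ and $\varepsilon\in\mathbb R$, an adversary $\mathcal A$ *$(t,\varepsilon)$-solves* the puzzle at security parameter $\lambda$ if $$\Pr\left[\top\leftarrow\mathsf{Ver}(\mathsf{ans},k)\;:\;k\leftarrow\mathsf{CheckGen}(1^\lambda),\ \mathsf{puz}\leftarrow\mathsf{PuzzleGen}(k),\ \mathsf{ans}\leftarrow\mathcal A(1^\lambda,\mathsf{puz}^{\otimes t})\right]\ \ge\ \varepsilon ,$$ where $\mathsf{puz}^{\otimes t}$ is produced by $t$ independent runs of $\mathsf{PuzzleGen}(k)$ with the same $k$. The *$n$-fold repetition* $(\mathsf{CheckGen}^n,\mathsf{PuzzleGen}^n,\mathsf{Ver}^n)$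 generates $n$ independent keys $k_1,\dots,k_n$ and puzzles $\mathsf{puz}_i\leftarrow\mathsf{PuzzleGen}(k_i)$, and accepts $(\mathsf{ans}_1,\dots,\mathsf{ans}_n)$ (a possibly entangled state) if and only if $\mathsf{Ver}(\mathsf{ans}_i,k_i)=\top$ for all $i$. Let $(\mathsf{CheckGen},\mathsf{PuzzleGen},\mathsf{Ver})$ be a weakly verifiable quantum puzzle, let $n,q,t$ be polynomials with coefficients in $\mathbb N$, and let $\delta:\mathbb N\to(0,1)$ be such that $\delta(\lambda)^{n(\lambda)}$ is at least inverse polynomial, i.e. $\delta(\lambda)^{n(\lambda)}\ge 1/r(\lambda)$ for some polynomial $r$ and all $\lambda$. Let $\mathcal A$ be a QPT adversary. Then there exist a polynomial $p$ and a QPT adversary $\mathcal A'$ such that, with $t'=t\cdot p$, for every $\lambda$ with $n(\lambda)\ge1$ and $q(\lambda)\ge 1$: if $\mathcal A$ $(t(\lambda),\delta(\lambda)^{n(\lambda)})$-solves $(\mathsf{CheckGen}^{n(\lambda)},\mathsf{PuzzleGen}^{n(\lambda)},\mathsf{Ver}^{n(\lambda)})$ at $\lambda$, then $\mathcal A'$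 $\bigl(t'(\lambda),\,\delta(\lambda)(1-\tfrac1{q(\lambda)})\bigr)$-solves $(\mathsf{CheckGen},\mathsf{PuzzleGen},\mathsf{Ver})$ at $\lambda$. In particular, if $\mathcal A$ solves the repetition for all (or for infinitely many) such $\lambda$, then $\mathcal A'$ solves the single puzzle for the same $\lambda$. -/

import Mathlib

namespace QPuzzle

/-! ## Quantum memory

The memory is an unbounded row of qubits, named by natural numbers.  A computational basis state is
the finite set of those qubits that have the value `1`; a pure state is a finitely supported
amplitude function on basis states.  States are kept unnormalised: the squared norm of a state is
the probability of the measurement outcomes that have led to it. -/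

/-- The quantum memory: every qubit with name `≥ next` has not been used yet (it is `|0⟩`). -/
structure QMem where
  next : ℕ
  ψ : Finset ℕ →₀ ℂ

/-- No qubit allocated. -/
noncomputable def QMem.vacuum : QMem := ⟨0, Finsupp.single ∅ 1⟩

/-- Squared norm of the state. -/
noncomputable def QMem.weight (μ : QMem) : ℝ := μ.ψ.sum fun _ a => ‖a‖ ^ 2

/-- Hadamard gate on qubit `i`. -/
noncomputable def hadamard (i : ℕ) : (Finset ℕ →₀ ℂ) →ₗ[ℂ] (Finset ℕ →₀ ℂ) :=
  Finsupp.linearCombination ℂ fun S =>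
    ((Real.sqrt 2 : ℂ)⁻¹) •
      if i ∈ S then Finsupp.single (S.erase i) (1 : ℂ) - Finsupp.single S 1
      else Finsupp.single S 1 + Finsupp.single (insert i S) 1

/-- The `T` gate `diag (1, e^{iπ/4})` on qubit `i`. -/
noncomputable def tGate (i : ℕ) : (Finset ℕ →₀ ℂ) →ₗ[ℂ] (Finset ℕ →₀ ℂ) :=
  Finsupp.linearCombination ℂ fun S =>
    Finsupp.single S (if i ∈ S then Complex.exp (Complex.I * (Real.pi / 4)) else 1)

/-- The controlled-NOT gate with control `i` and target `j` (for `i ≠ j`). -/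
noncomputable def cnot (i j : ℕ) : (Finset ℕ →₀ ℂ) →ₗ[ℂ] (Finset ℕ →₀ ℂ) :=
  Finsupp.linearCombination ℂ fun S =>
    Finsupp.single (if i ≠ j ∧ i ∈ S then symmDiff S {j} else S) 1

/-- Projection to the outcome `b` of a computational basis measurement of qubit `i`. -/
noncomputable def project (i : ℕ) (b : Bool) (ψ : Finset ℕ →₀ ℂ) : Finset ℕ →₀ ℂ :=
  ψ.filter fun S => decide (i ∈ S) = b

/-! ## Programs

A program acts on finitely many stacks (out of stacks named by natural numbers).  A cell of a stack
holds a classical bit or (the name of) a qubit.  Qubits can be moved from stack to stack but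
not duplicated, so at any time each qubit lies in at most one cell. -/

inductive Cell where
  | bit (b : Bool)
  | qubit (i : ℕ)

/-- What a program can see of the top of a stack. -/
inductive Top where
  | empty
  | zero
  | one
  | qubit
  deriving DecidableEq

def topOf : List Cell → Top
  | [] => .empty
  | .bit false :: _ => .zero
  | .bit true :: _ => .one
  | .qubit _ :: _ => .qubit

/-- Elementary instructions. -/
inductive Instr where
  /-- push a classical bit onto stack `x` -/
  | push (x : ℕ) (b : Bool)
  /-- discard the top cell of `x` -/
  | pop (x : ℕ)
  /-- move the top cell of `x` to the top of `y` -/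
  | move (x y : ℕ)
  /-- push a new qubit in state `|0⟩` onto `x` -/
  | new (x : ℕ)
  /-- Hadamard gate on the qubit at the top of `x` -/
  | had (x : ℕ)
  /-- `T` gate on the qubit at the top of `x` -/
  | tgate (x : ℕ)
  /-- controlled-NOT, control at the top of `x`, target at the top of `y` -/
  | cnot (x y : ℕ)
  /-- measure the qubit at the top of `x` and replace it by the classical outcome -/
  | meas (x : ℕ)

inductive Prog where
  | skip
  | instr (a : Instr)
  | seq (p q : Prog)
  /-- `if top x = s then p else q` -/
  | ite (x : ℕ) (s : Top) (p q : Prog)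
  /-- `while top x = s do p` -/
  | loop (x : ℕ) (s : Top) (p : Prog)

abbrev Store := ℕ → List Cell

/-- Effect of an instruction: the list of possible results, two for a measurement and one
otherwise.  An instruction that finds no cell of the required kind does nothing. -/
noncomputable def Instr.apply (σ : Store) (μ : QMem) : Instr → List (Store × QMem)
  | .push x b => [(Function.update σ x (.bit b :: σ x), μ)]
  | .pop x => [(Function.update σ x (σ x).tail, μ)]
  | .move x y =>
      match σ x with
      | c :: w =>
          let σ' := Function.update σ x w
          [(Function.update σ' y (c :: σ' y), μ)]
      | [] => [(σ, μ)]
  | .new x => [(Function.update σ x (.qubit μ.next :: σ x), ⟨μ.next + 1, μ.ψ⟩)]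
  | .had x =>
      match σ x with
      | .qubit i :: _ => [(σ, ⟨μ.next, hadamard i μ.ψ⟩)]
      | _ => [(σ, μ)]
  | .tgate x =>
      match σ x with
      | .qubit i :: _ => [(σ, ⟨μ.next, tGate i μ.ψ⟩)]
      | _ => [(σ, μ)]
  | .cnot x y =>
      match σ x, σ y with
      | .qubit i :: _, .qubit j :: _ => [(σ, ⟨μ.next, QPuzzle.cnot i j μ.ψ⟩)]
      | _, _ => [(σ, μ)]
  | .meas x =>
      match σ x with
      | .qubit i :: w =>
          [(Function.update σ x (.bit false :: w), ⟨μ.next, project i false μ.ψ⟩),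
           (Function.update σ x (.bit true :: w), ⟨μ.next, project i true μ.ψ⟩)]
      | _ => [(σ, μ)]

/-- A configuration of a running program: the statements still to be executed, the stacks, and the
quantum memory.  It has halted when no statement is left. -/
structure Config where
  todo : List Prog
  store : Store
  mem : QMem

/-- One step of computation, with all possible successors. -/
noncomputable def Config.step (c : Config) : List Config :=
  match c.todo with
  | [] => [c]
  | .skip :: K => [⟨K, c.store, c.mem⟩]
  | .instr a :: K => (a.apply c.store c.mem).map fun r => ⟨K, r.1, r.2⟩
  | .seq p q :: K => [⟨p :: q :: K, c.store, c.mem⟩]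
  | .ite x s p q :: K => [⟨(if topOf (c.store x) = s then p else q) :: K, c.store, c.mem⟩]
  | .loop x s p :: K =>
      [⟨if topOf (c.store x) = s then p :: .loop x s p :: K else K, c.store, c.mem⟩]

/-- All configurations after `T` steps, one for each sequence of measurement outcomes. -/
noncomputable def Config.run (c : Config) : ℕ → List Config
  | 0 => [c]
  | T + 1 => (c.run T).flatMap Config.step

/-! ## Quantum polynomial-time algorithms -/

/-- The initial stacks: `1^sec` on stack `0`, the two inputs on stacks `1` and `2`. -/
def inputStore (sec : ℕ) (x y : List Cell) : Store := fun r =>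
  if r = 0 then List.replicate sec (.bit true)
  else if r = 1 then x
  else if r = 2 then y
  else []

def startConfig (p : Prog) (sec : ℕ) (x y : List Cell) (μ : QMem) : Config :=
  ⟨[p], inputStore sec x y, μ⟩

/-- A (uniform) quantum polynomial-time algorithm: one program for all security parameters and
inputs which, whatever the outcomes of its measurements, halts after a number of steps that is
polynomial in the security parameter and the length of the inputs. -/
structure QPTAlg where
  prog : Prog
  time : Polynomial ℕ
  halts : ∀ (sec : ℕ) (x y : List Cell) (μ : QMem),
    ∀ c ∈ (startConfig prog sec x y μ).run (time.eval (sec + x.length + y.length)), c.todo = []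

/-- Quantum procedures with a classically described result: from a quantum memory they
lead to finitely many results, each with an (unnormalised) new quantum memory. -/
abbrev QM := StateT QMem List

/-- Run a QPT algorithm on security parameter `sec` and inputs `x`, `y`, on stacks of its own.  The
output is what it leaves on stack `3`; everything else that it leaves is discarded. -/
noncomputable def QPTAlg.exec (B : QPTAlg) (sec : ℕ) (x y : List Cell) : QM (List Cell) := fun μ =>
  ((startConfig B.prog sec x y μ).run (B.time.eval (sec + x.length + y.length))).map
    fun c => (c.store 3, c.mem)

/-- The probability that a procedure, started from the empty memory, returns `true`. -/
noncomputable def prob (m : QM Bool) : ℝ :=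
  ((m QMem.vacuum).map fun r => if r.1 = true then r.2.weight else 0).sum

/-- The classical bits of an output; qubits that were not measured are ignored. -/
def bitsOf (w : List Cell) : List Bool :=
  w.filterMap fun c => match c with
    | .bit b => some b
    | .qubit _ => none

/-! ## Tuples of messages -/

/-- Self-delimiting form of a message: `1` in front of each cell, and a final `0`. -/
def frame (w : List Cell) : List Cell :=
  (w.flatMap fun c => [.bit true, c]) ++ [.bit false]

/-- A tuple of messages as one message. -/
def encode (ws : List (List Cell)) : List Cell := ws.flatMap frame

/-- Read the first message off a tuple; also returns the rest. -/
def unframe : List Cell → List Cell × List Cell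
  | [] => ([], [])
  | .bit true :: c :: w => (c :: (unframe w).1, (unframe w).2)
  | _ :: w => ([], w)

/-- Read `n` messages off a tuple. -/
def decode : ℕ → List Cell → List (List Cell)
  | 0, _ => []
  | n + 1, w => (unframe w).1 :: decode n (unframe w).2

/-! ## Weakly verifiable quantum puzzles -/

/-- The three procedures of a puzzle, as functions of the security parameter.  Puzzles and answers
are messages that may consist of qubits and classical bits; the check key is classical. -/
structure PuzzleSystem where
  Key : Type
  checkGen : ℕ → QM Key
  puzzleGen : ℕ → Key → QM (List Cell)
  ver : ℕ → List Cell → Key → QM Bool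

/-- `k ← CheckGen(1^sec)`, `puz^{⊗t} ← PuzzleGen(k)^{⊗t}`, `ans ← A(puz^{⊗t})`; the probability that
`Ver(ans, k)` accepts. -/
noncomputable def PuzzleSystem.successProb (P : PuzzleSystem) (A : QPTAlg) (t sec : ℕ) : ℝ :=
  prob do
    let k ← P.checkGen sec
    let puzs ← (List.replicate t k).mapM (P.puzzleGen sec)
    let ans ← A.exec sec (encode puzs) []
    P.ver sec ans k

/-- `A` `(t, ε)`-solves the puzzle, at security parameter `sec`. -/
def PuzzleSystem.SolvesAt (P : PuzzleSystem) (A : QPTAlg) (t : ℕ) (ε : ℝ) (sec : ℕ) : Prop :=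
  ε ≤ P.successProb A t sec

/-- The `n`-fold parallel repetition, where `n` may depend on the security parameter. -/
noncomputable def PuzzleSystem.parallel (P : PuzzleSystem) (n : ℕ → ℕ) : PuzzleSystem where
  Key := List P.Key
  checkGen sec := (List.replicate (n sec) sec).mapM P.checkGen
  puzzleGen sec ks := do
    let puzs ← ks.mapM (P.puzzleGen sec)
    pure (encode puzs)
  ver sec ans ks := do
    let ds ← ((decode (n sec) ans).zip ks).mapM fun r => P.ver sec r.1 r.2
    pure (ds.all id)

/-- A weakly verifiable quantum puzzle: three QPT algorithms. -/
structure WeaklyVerifiablePuzzle where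
  CheckGen : QPTAlg
  PuzzleGen : QPTAlg
  Ver : QPTAlg

/-- The procedures of a puzzle.  Check keys are bit strings.  `Ver` gets the check key on
stack `1` and the answer on stack `2`, and accepts with the bit `1` on top of its output stack. -/
noncomputable def WeaklyVerifiablePuzzle.system (W : WeaklyVerifiablePuzzle) : PuzzleSystem where
  Key := List Bool
  checkGen sec := do
    let out ← W.CheckGen.exec sec [] []
    pure (bitsOf out)
  puzzleGen sec k := W.PuzzleGen.exec sec (k.map Cell.bit) []
  ver sec ans k := do
    let out ← W.Ver.exec sec (k.map Cell.bit) ans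
    pure (decide (topOf out = Top.one))

end QPuzzle

/-! Write n, q, r, δ for the values at the given security parameter. Let S be a list of keys that
are fixed already. `avgProb` is the probability Z_m(S) that the adversary, on puzzles for m fresh
keys followed by those of S, answers the first m correctly. `nextProb` is the probability a_m(k, S)
that, on m fresh keys followed by k and S, it answers the first m + 1 correctly. Then Z_0 = 1,
Z_{m+1}(S) = E_k a_m(k, S) and a_m(k, S) ≤ Z_m(k :: S), and Z_n([]) is the success probability for
the repetition (`parallel_successProb`).

The reduction fixes a random number d < n of keys from the right end. Each is found by rejection:
draw k together with m fresh keys, and keep k if all m + 1 of these positions are answered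
correctly. So k is kept with density a_m(k, S) / Z_{m+1}(S). Then the given puzzles are put in front
of S, with j fresh keys before them, until the first j answers are correct. This can be checked,
because those j keys are known. The answer at the given position is the output, and it is correct
with probability s_j(S) = E_k [a_j(k, S) / Z_j(k :: S)].

Let T_m(S) be the sum of the success probabilities over the m possible positions of the given
puzzles. Then T_0 = 0 and T_{m+1}(S) = s_m(S) + E_k [a_m(k, S) T_m(k :: S)] / Z_{m+1}(S). The claim
is T_m(S) ≥ δ (m + log (Z_m(S) / δ^m)). Indeed, for the density above the mean of 1 / Z_m(k :: S) is
s / Z_{m+1}(S). Jensen's inequality for the logarithm therefore bounds the mean of log Z_m(k :: S)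
below by log (Z_{m+1}(S) / s), and the loss of log (s / δ) is paid for by s / δ ≥ 1 + log (s / δ).
For Z_n([]) ≥ δ^n this gives T_n([]) ≥ n δ, hence δ for a uniformly random position.

Only N tries are made each time, so 1 / Z is replaced by c(Z) = 1 + (1 - Z) + ... + (1 - Z)^(N-1)
(`attempts`), and the product c(Z) Z = 1 by the quantity built on `completion`. The logarithm is
replaced by its affine minorants in 1 / Z, namely 1 + θ - e^θ / u ≤ log u, which can be averaged
without division (`le_totalProb`). As Z_n([]) ≥ 1 / r, the choice N = 8 n r q costs a factor 1 - 1 /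
(2 q) (`le_totalProb_of_avgProb`). Drawing the position with coins costs another such factor
(`le_ex_sampleIndex`).

Quantum memory enters in two ways. A try destroys the t copies that it uses, so N tries need t N
copies; all that is carried from one try to the next is classical, apart from copies not yet used.
Moreover, independent procedures must be reordered, since the given puzzles are prepared long before
the fresh ones. For this, programs are shown to depend neither on the names of their qubits nor on
the remaining memory (`Frame`, `Equi`), so that independent procedures commute (`wp_comm`) and
expectations of classical results multiply as in ordinary probability (`Closed.ex_bind`). This
yields the success probability of a try (`attempt_sim`) and the recursions `ex_selfAttempts_succ`
and `ex_challenge_succ`, which `le_successProb` combines.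

Finally the reduction has to be a program that runs in polynomial time. `Impl` relates programs to
procedures, `Impl.call` turns an algorithm into a subroutine on stacks of its own, and
`exists_solveAlg` collects the bounds. -/

namespace QPuzzle

/-! ## Timed execution of programs -/

theorem QM.bind_apply {α β : Type} (m : QM α) (h : α → QM β) (μ : QMem) :
    (m >>= h) μ = (m μ).flatMap fun r => h r.1 r.2 := rfl

theorem QM.pure_apply {α : Type} (a : α) (μ : QMem) : (pure a : QM α) μ = [(a, μ)] := rfl

theorem QM.map_apply {α β : Type} (m : QM α) (h : α → β) (μ : QMem) :
    (h <$> m) μ = (m μ).map fun r => (h r.1, r.2) := by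
  rw [map_eq_pure_bind, QM.bind_apply, List.map_eq_flatMap]
  rfl

/-- From `c`, every branch of the computation reaches the corresponding leaf in `L` within `T`
steps. -/
inductive Reach : ℕ → Config → List Config → Prop
  | refl (T : ℕ) (c : Config) : Reach T c [c]
  | step {T : ℕ} {c : Config} (S : List (Config × List Config)) (hS : S.map Prod.fst = c.step)
      (h : ∀ s ∈ S, Reach T s.1 s.2) : Reach (T + 1) c (S.flatMap Prod.snd)

theorem Reach.mono {T T' : ℕ} {c : Config} {L : List Config} (h : Reach T c L) (hT : T ≤ T') :
    Reach T' c L := by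
  induction h generalizing T' with
  | refl T c => exact .refl _ _
  | step S hS h ih =>
    obtain ⟨T', rfl⟩ : ∃ k, T' = k + 1 := ⟨T' - 1, by omega⟩
    exact .step S hS fun s hs => ih s hs (by omega)

theorem Config.run_succ (c : Config) (T : ℕ) : c.run (T + 1) = c.step.flatMap fun c' => c'.run T := by
  induction T with
  | zero => simp [Config.run]
  | succ T ih =>
    rw [Config.run, ih, List.flatMap_assoc]
    rfl

theorem Config.step_of_halted {c : Config} (h : c.todo = []) : c.step = [c] := by
  simp [Config.step, h]

theorem Config.run_of_halted {c : Config} (h : c.todo = []) (T : ℕ) : c.run T = [c] := by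
  induction T with
  | zero => rfl
  | succ T ih => simp [Config.run, ih, Config.step_of_halted h]

/-- A halted configuration is its own only successor, so branches that end early wait unchanged
until time `T`, and the leaves are exactly the result of the run. -/
theorem Reach.run_eq {T : ℕ} {c : Config} {L : List Config} (h : Reach T c L)
    (hL : ∀ c' ∈ L, c'.todo = []) : c.run T = L := by
  induction h with
  | refl T c => exact Config.run_of_halted (hL c (by simp)) T
  | @step T c S hS h ih =>
    rw [Config.run_succ, ← hS, List.flatMap_map]
    exact List.flatMap_congr fun s hs => ih s hs fun c hc =>
      hL c (List.mem_flatMap.2 ⟨s, hs, hc⟩)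

/-- All results of a procedure satisfy `P`. -/
def All {α : Type} (m : QM α) (P : α → Prop) : Prop := ∀ μ, ∀ r ∈ m μ, P r.1

theorem All.pure {α : Type} {a : α} {P : α → Prop} (h : P a) : All (pure a : QM α) P := by
  intro μ r hr
  rw [QM.pure_apply, List.mem_singleton] at hr
  subst hr; exact h

theorem All.bind {α β : Type} {m : QM α} {h : α → QM β} {P : α → Prop} {Q : β → Prop}
    (hm : All m P) (hh : ∀ a, P a → All (h a) Q) : All (m >>= h) Q := by
  intro μ r hr
  rw [QM.bind_apply, List.mem_flatMap] at hr
  obtain ⟨s, hs, hr⟩ := hr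
  exact hh _ (hm _ _ hs) _ _ hr

theorem All.mono {α : Type} {m : QM α} {P Q : α → Prop} (hm : All m P) (h : ∀ a, P a → Q a) :
    All m Q := fun μ r hr => h _ (hm μ r hr)

theorem All.trivial {α : Type} (m : QM α) : All m fun _ => True := fun _ _ _ => True.intro

theorem All.foldlM {ι α : Type} {f : α → ι → QM α} {P : List ι → α → Prop}
    (h : ∀ i l a, P (i :: l) a → All (f a i) (P l)) :
    ∀ l a, P l a → All (l.foldlM f a) (P [])
  | [], a, ha => by simpa using All.pure (P := P []) ha
  | i :: l, a, ha => by
    rw [List.foldlM_cons]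
    exact (h i l a ha).bind fun a' ha' => All.foldlM h l a' ha'

theorem All.mapM {ι α : Type} {f : ι → QM α} {P : ι → Prop} {Q : α → Prop}
    (h : ∀ i, P i → All (f i) Q) :
    ∀ l : List ι, (∀ i ∈ l, P i) → All (l.mapM f) fun l' => l'.length = l.length ∧ ∀ a ∈ l', Q a
  | [], _ => by
    rw [List.mapM_nil]; exact .pure (by simp)
  | i :: l, hl => by
    rw [List.mapM_cons]
    refine (h i (hl i (by simp))).bind fun a ha => (All.mapM h l fun j hj => hl j (by simp [hj])).bind
      fun l' hl' => .pure ?_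
    simp only [List.length_cons, hl'.1, List.mem_cons, forall_eq_or_imp, true_and]
    exact ⟨ha, hl'.2⟩

/-- Started with the stacks `σ`, the program `p` halts within `T` steps and acts as `m`, the stacks
in the end being `e a` for the result `a` of `m`. -/
def Impl {α : Type} (p : Prog) (σ : Store) (T : ℕ) (m : QM α) (e : α → Store) : Prop :=
  ∀ (μ : QMem) (K : List Prog) (T' : ℕ) (g : α → QMem → List Config),
    (∀ r ∈ m μ, Reach T' ⟨K, e r.1, r.2⟩ (g r.1 r.2)) →
    Reach (T + T') ⟨p :: K, σ, μ⟩ ((m μ).flatMap fun r => g r.1 r.2)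

/-- Started with the stacks `σ`, the program `p` halts within `T` steps with the stacks `σ'`,
and leaves the quantum memory alone. -/
def Det (p : Prog) (σ : Store) (T : ℕ) (σ' : Store) : Prop :=
  ∀ (μ : QMem) (K : List Prog) (T' : ℕ) (L : List Config),
    Reach T' ⟨K, σ', μ⟩ L → Reach (T + T') ⟨p :: K, σ, μ⟩ L

theorem Reach.of_step {T : ℕ} {c c' : Config} {L : List Config} (hc : c.step = [c'])
    (h : Reach T c' L) : Reach (T + 1) c L := by
  have := Reach.step (c := c) (T := T) [(c', L)] (by simp [hc]) (by simpa using h)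
  simpa using this

section
variable {α β : Type} {p q : Prog} {σ σ' σ'' : Store} {T T' : ℕ} {m : QM α} {e : α → Store}

theorem Impl.mono (h : Impl p σ T m e) (hT : T ≤ T') : Impl p σ T' m e :=
  fun μ K T'' g hg => (h μ K T'' g hg).mono (by omega)

theorem Det.mono (h : Det p σ T σ') (hT : T ≤ T') : Det p σ T' σ' :=
  fun μ K T'' L hL => (h μ K T'' L hL).mono (by omega)

theorem Det.impl {a : α} (h : Det p σ T (e a)) : Impl p σ T (pure a) e :=
  fun μ K T'' g hg => by
    rw [QM.pure_apply] at hg ⊢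
    simpa using h μ K T'' _ (hg (a, μ) (by simp))

theorem Impl.det {a : α} (h : Impl p σ T (pure a) e) : Det p σ T (e a) :=
  fun μ K T'' L hL => by
    have := h μ K T'' (fun _ _ => L) (by
      intro r hr
      rw [QM.pure_apply, List.mem_singleton] at hr
      subst hr; exact hL)
    simpa [QM.pure_apply] using this

theorem Impl.run_eq (h : Impl p σ T m e) (μ : QMem) :
    (Config.mk [p] σ μ).run T = (m μ).map fun r => ⟨[], e r.1, r.2⟩ := by
  have := h μ [] 0 (fun a μ => [⟨[], e a, μ⟩]) fun r _ => .refl 0 _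
  rw [← List.map_eq_flatMap] at this
  refine this.run_eq fun c hc => ?_
  obtain ⟨r, _, rfl⟩ := List.mem_map.1 hc
  rfl

theorem Impl.map {h : α → β} {e' : β → Store} {P : α → Prop} (hm : All m P)
    (hp : Impl p σ T m e) (he : ∀ a, P a → e a = e' (h a)) : Impl p σ T (h <$> m) e' :=
  fun μ K T'' g hg => by
    rw [QM.map_apply] at hg ⊢
    rw [List.flatMap_map]
    refine hp μ K T'' (fun a μ => g (h a) μ) fun r hr => ?_
    rw [he r.1 (hm μ r hr)]
    exact hg (h r.1, r.2) (List.mem_map.2 ⟨r, hr, rfl⟩)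

theorem Impl.congr {e' : α → Store} {P : α → Prop} (hm : All m P) (hp : Impl p σ T m e)
    (he : ∀ a, P a → e a = e' a) (hT : T ≤ T') : Impl p σ T' m e' := by
  have := Impl.map (h := id) hm hp he
  rw [id_map] at this
  exact this.mono hT

theorem Det.congr (h : Det p σ T σ') (hs : σ' = σ'') (hT : T ≤ T') : Det p σ T' σ'' :=
  hs ▸ h.mono hT

/-- `Impl` quantifies over all continuations, so `q` followed by `K` can serve as the continuation
of `p`. The extra step unfolds `.seq`. The predicate `P` passes on what is known of intermediate
results, mostly length bounds, on which the time of `q` depends. -/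
theorem Impl.seq {h : α → QM β} {e' : β → Store} {P : α → Prop} (hm : All m P)
    (hp : Impl p σ T m e) (hq : ∀ a, P a → Impl q (e a) T' (h a) e') :
    Impl (.seq p q) σ (T + T' + 1) (m >>= h) e' := fun μ K T'' g hg => by
  rw [QM.bind_apply, List.flatMap_assoc]
  rw [Nat.add_right_comm]
  refine Reach.of_step (c' := ⟨p :: q :: K, σ, μ⟩) rfl ?_
  rw [Nat.add_assoc]
  refine hp μ (q :: K) _ (fun a μ => (h a μ).flatMap fun r => g r.1 r.2) fun r hr => ?_
  refine hq r.1 (hm μ r hr) r.2 K T'' g fun s hs => hg s ?_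
  rw [QM.bind_apply]
  exact List.mem_flatMap.2 ⟨r, hr, hs⟩

theorem Det.seq_impl (hp : Det p σ T σ') (hq : Impl q σ' T' m e) :
    Impl (.seq p q) σ (T + T' + 1) m e := fun μ K T'' g hg => by
  rw [Nat.add_right_comm]
  refine Reach.of_step (c' := ⟨p :: q :: K, σ, μ⟩) rfl ?_
  rw [Nat.add_assoc]
  exact hp μ _ _ _ (hq μ K T'' g hg)

theorem Det.seq (hp : Det p σ T σ') (hq : Det q σ' T' σ'') :
    Det (.seq p q) σ (T + T' + 1) σ'' := fun μ K T'' L hL => by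
  rw [Nat.add_right_comm]
  refine Reach.of_step (c' := ⟨p :: q :: K, σ, μ⟩) rfl ?_
  rw [Nat.add_assoc]
  exact hp μ _ _ _ (hq μ K T'' L hL)

theorem Det.skip (σ : Store) : Det .skip σ 1 σ := fun μ K T'' L hL => by
  rw [Nat.add_comm]
  exact hL.of_step rfl

theorem Det.push (σ : Store) (x : ℕ) (b : Bool) :
    Det (.instr (.push x b)) σ 1 (Function.update σ x (.bit b :: σ x)) := fun μ K T'' L hL => by
  rw [Nat.add_comm]
  exact hL.of_step rfl

theorem Det.pop (σ : Store) (x : ℕ) :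
    Det (.instr (.pop x)) σ 1 (Function.update σ x (σ x).tail) := fun μ K T'' L hL => by
  rw [Nat.add_comm]
  exact hL.of_step rfl

theorem Det.move {c : Cell} {w : List Cell} {x y : ℕ} (hx : σ x = c :: w) (hxy : x ≠ y) :
    Det (.instr (.move x y)) σ 1 (Function.update (Function.update σ x w) y (c :: σ y)) :=
  fun μ K T'' L hL => by
  rw [Nat.add_comm]
  refine hL.of_step ?_
  simp [Config.step, Instr.apply, hx, Function.update_of_ne hxy.symm]

theorem Det.move_nil {x y : ℕ} (hx : σ x = []) : Det (.instr (.move x y)) σ 1 σ :=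
  fun μ K T'' L hL => by
  rw [Nat.add_comm]
  refine hL.of_step ?_
  simp [Config.step, Instr.apply, hx]

theorem Impl.ite {x : ℕ} {s : Top} (h : Impl (if topOf (σ x) = s then p else q) σ T m e) :
    Impl (.ite x s p q) σ (T + 1) m e := fun μ K T'' g hg => by
  rw [Nat.add_right_comm]
  exact Reach.of_step rfl (h μ K T'' g hg)

theorem Det.ite {x : ℕ} {s : Top} (h : Det (if topOf (σ x) = s then p else q) σ T σ') :
    Det (.ite x s p q) σ (T + 1) σ' := fun μ K T'' g hg => by
  rw [Nat.add_right_comm]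
  exact Reach.of_step rfl (h μ K T'' g hg)

theorem Det.loop_exit {x : ℕ} {s : Top} (hs : topOf (σ x) ≠ s) :
    Det (.loop x s p) σ 1 σ := fun μ K T'' L hL => by
  rw [Nat.add_comm]
  exact hL.of_step (by simp [Config.step, hs])

/-- A loop that works off a list, `e l a` being the stacks when the list is `l` and the state is
`a`. -/
theorem Impl.loop {ι : Type} {x : ℕ} {s : Top} {e : List ι → α → Store} {f : α → ι → QM α}
    {P : List ι → α → Prop} (hnil : ∀ a, P [] a → topOf (e [] a x) ≠ s)
    (hcons : ∀ i l a, P (i :: l) a → topOf (e (i :: l) a x) = s)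
    (hP : ∀ i l a, P (i :: l) a → All (f a i) (P l))
    (hbody : ∀ i l a, P (i :: l) a → Impl p (e (i :: l) a) T (f a i) (e l)) :
    ∀ l a, P l a → Impl (.loop x s p) (e l a) (l.length * (T + 1) + 1) (l.foldlM f a) (e [])
  | [], a, ha => by
    simpa using (Det.loop_exit (hnil a ha)).impl (e := e [])
  | i :: l, a, ha => fun μ K T'' g hg => by
    have ih := Impl.loop hnil hcons hP hbody l
    rw [List.foldlM_cons] at hg ⊢
    rw [QM.bind_apply, List.flatMap_assoc]
    rw [show (i :: l).length * (T + 1) + 1 + T'' = T + (l.length * (T + 1) + 1 + T'') + 1 by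
      simp only [List.length_cons]; ring]
    refine Reach.of_step (c' := ⟨p :: .loop x s p :: K, e (i :: l) a, μ⟩)
      (by simp [Config.step, hcons i l a ha]) ?_
    refine hbody i l a ha μ _ _ (fun a μ => (l.foldlM f a μ).flatMap fun r => g r.1 r.2)
      fun r hr => ?_
    refine ih r.1 (hP i l a ha μ r hr) r.2 K T'' g fun s hs => hg s ?_
    rw [QM.bind_apply]
    exact List.mem_flatMap.2 ⟨r, hr, hs⟩

theorem QM.foldlM_pure {ι : Type} (f : α → ι → α) (l : List ι) (a : α) :
    l.foldlM (fun a i => (pure (f a i) : QM α)) a = pure (l.foldl f a) := by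
  induction l generalizing a with
  | nil => rfl
  | cons i l ih => simp [ih]

theorem Det.loop {ι : Type} {x : ℕ} {s : Top} {e : List ι → α → Store} {f : α → ι → α}
    {P : List ι → α → Prop} (hnil : ∀ a, P [] a → topOf (e [] a x) ≠ s)
    (hcons : ∀ i l a, P (i :: l) a → topOf (e (i :: l) a x) = s)
    (hP : ∀ i l a, P (i :: l) a → P l (f a i))
    (hbody : ∀ i l a, P (i :: l) a → Det p (e (i :: l) a) T (e l (f a i))) (l : List ι) (a : α)
    (ha : P l a) : Det (.loop x s p) (e l a) (l.length * (T + 1) + 1) (e [] (l.foldl f a)) := by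
  have := Impl.loop (f := fun a i => pure (f a i)) hnil hcons
    (fun i l a h => All.pure (hP i l a h)) (fun i l a h => (hbody i l a h).impl) l a ha
  rw [QM.foldlM_pure] at this
  exact this.det

end


/-! ## Basic subroutines

Stack `4` serves as scratch space and stack `5` as a flag; both are empty between subroutines. -/

section
variable {α : Type} {σ σ' : Store} {T : ℕ}

/-- A loop continues while the top equals a prescribed value. Nonemptiness is the negation of such a
test, so it is first recorded as a bit on stack 5. -/
def setFlag (x : ℕ) : Prog := .ite x .empty .skip (.instr (.push 5 true))

/-- Repeat `p` until stack `x` is empty. -/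
def whileNonempty (x : ℕ) (p : Prog) : Prog :=
  .seq (setFlag x) (.loop 5 .one (.seq (.instr (.pop 5)) (.seq p (setFlag x))))

def flagOf : List Cell → List Cell
  | [] => []
  | _ :: _ => [.bit true]

theorem Det.setFlag {x : ℕ} (h : σ 5 = []) :
    Det (setFlag x) σ 2 (Function.update σ 5 (flagOf (σ x))) := by
  refine Det.ite ?_
  rcases hx : σ x with _ | ⟨c, w⟩
  · simpa [topOf, flagOf, ← h] using Det.skip σ
  · have : topOf (c :: w) ≠ .empty := by
      rcases c with (_ | _) | _ <;> simp [topOf]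
    simpa [this, flagOf, h] using Det.push σ 5 true

theorem Impl.whileNonempty {x : ℕ} {p : Prog} {e : List Cell → α → Store} {f : α → Cell → QM α}
    {P : List Cell → α → Prop} (he : ∀ l a, P l a → e l a x = l)
    (hfl : ∀ l a, P l a → e l a 5 = []) (hP : ∀ i l a, P (i :: l) a → All (f a i) (P l))
    (hbody : ∀ i l a, P (i :: l) a → Impl p (e (i :: l) a) T (f a i) (e l)) (l : List Cell) (a : α)
    (ha : P l a) :
    Impl (whileNonempty x p) (e l a) (l.length * (T + 6) + 4) (l.foldlM f a) (e []) := by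
  have h5 : ∀ l a, P l a → Function.update (Function.update (e l a) 5 (flagOf l)) 5 [] = e l a := by
    intro l a h
    rw [Function.update_idem, ← hfl l a h, Function.update_eq_self]
  have hflag : ∀ l a, P l a → Det (QPuzzle.setFlag x) (e l a) 2
      (Function.update (e l a) 5 (flagOf l)) := fun l a h => by
    have := Det.setFlag (x := x) (hfl l a h)
    rwa [he l a h] at this
  have hloop := Impl.loop (x := 5) (s := .one) (P := P)
    (e := fun l a => Function.update (e l a) 5 (flagOf l)) (f := f)
    (p := .seq (.instr (.pop 5)) (.seq p (QPuzzle.setFlag x))) (T := T + 5)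
    (fun a _ => by simp [flagOf, topOf]) (fun i l a _ => by simp [flagOf, topOf]) hP
    (fun i l a h => by
      have h1 := Det.pop (Function.update (e (i :: l) a) 5 (flagOf (i :: l))) 5
      rw [Function.update_self, flagOf, List.tail_cons] at h1
      have h2 := h5 (i :: l) a h
      rw [flagOf] at h2
      rw [h2] at h1
      have h3 := Impl.seq (hP i l a h) (hbody i l a h) (q := QPuzzle.setFlag x) (h := pure)
        (T' := 2) (e' := fun a => Function.update (e l a) 5 (flagOf l))
        fun a ha => (hflag l a ha).impl (e := fun a => Function.update (e l a) 5 (flagOf l))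
      rw [bind_pure] at h3
      exact (h1.seq_impl h3).mono (by omega)) l a ha
  have := (hflag l a ha).seq_impl hloop
  refine Impl.congr (All.foldlM hP l a ha) this (fun a ha => ?_) (by ring_nf; omega)
  change Function.update (e [] a) 5 [] = e [] a
  exact Function.update_eq_self_iff.2 (hfl [] a ha).symm

theorem Det.whileNonempty {x : ℕ} {p : Prog} {e : List Cell → α → Store} {f : α → Cell → α}
    {P : List Cell → α → Prop} (he : ∀ l a, P l a → e l a x = l)
    (hfl : ∀ l a, P l a → e l a 5 = []) (hP : ∀ i l a, P (i :: l) a → P l (f a i))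
    (hbody : ∀ i l a, P (i :: l) a → Det p (e (i :: l) a) T (e l (f a i))) (l : List Cell) (a : α)
    (ha : P l a) :
    Det (whileNonempty x p) (e l a) (l.length * (T + 6) + 4) (e [] (l.foldl f a)) := by
  have := Impl.whileNonempty (f := fun a i => pure (f a i)) he hfl
    (fun i l a h => All.pure (hP i l a h)) (fun i l a h => (hbody i l a h).impl) l a ha
  rw [QM.foldlM_pure] at this
  exact this.det

/-- Empty stack `x`. -/
def clear (x : ℕ) : Prog := whileNonempty x (.instr (.pop x))

theorem Det.clear {x : ℕ} (hx : x ≠ 5) (h5 : σ 5 = []) {M : ℕ} (hM : (σ x).length ≤ M) :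
    Det (clear x) σ (7 * M + 4) (Function.update σ x []) := by
  have := Det.whileNonempty (x := x) (p := .instr (.pop x)) (T := 1) (P := fun _ _ => True)
    (e := fun l (_ : Unit) => Function.update σ x l) (f := fun a _ => a)
    (fun l a _ => by simp) (fun l a _ => by rw [Function.update_of_ne hx.symm, h5])
    (fun _ _ _ _ => trivial)
    (fun i l a _ => by simpa using Det.pop (Function.update σ x (i :: l)) x) (σ x) () trivial
  rw [Function.update_eq_self] at this
  exact this.mono (by omega)

/-- Move the cells of stack `x` one by one to stack `y`. -/
def moveRev (x y : ℕ) : Prog := whileNonempty x (.instr (.move x y))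

theorem Det.moveRev {x y : ℕ} (hx : x ≠ 5) (hy : y ≠ 5) (hxy : x ≠ y) (h5 : σ 5 = []) {M : ℕ}
    (hM : (σ x).length ≤ M) : Det (moveRev x y) σ (7 * M + 4)
      (Function.update (Function.update σ x []) y ((σ x).reverse ++ σ y)) := by
  have := Det.whileNonempty (x := x) (p := .instr (.move x y)) (T := 1) (P := fun _ _ => True)
    (e := fun l (a : List Cell) => Function.update (Function.update σ x l) y a)
    (f := fun a i => i :: a)
    (fun l a _ => by simp [Function.update_of_ne hxy])
    (fun l a _ => by rw [Function.update_of_ne hy.symm, Function.update_of_ne hx.symm, h5])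
    (fun _ _ _ _ => trivial)
    (fun i l a _ => by
      refine Det.congr (Det.move (c := i) (w := l) (by simp [Function.update_of_ne hxy]) hxy) ?_
        le_rfl
      funext r
      by_cases h1 : r = y <;> by_cases h2 : r = x <;> simp_all) (σ x) (σ y) trivial
  rw [Function.update_eq_self, Function.update_eq_self] at this
  have hf : ∀ (l a : List Cell), l.foldl (fun a i => i :: a) a = l.reverse ++ a := by
    intro l
    induction l with
    | nil => simp
    | cons i l ih => intro a; simp [ih]
  rw [hf] at this
  exact this.mono (by omega)

/-- Put the contents of stack `x` on top of stack `y`, in the same order. -/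
def moveOn (x y : ℕ) : Prog := .seq (moveRev x 4) (moveRev 4 y)

theorem Det.moveOn {x y : ℕ} (hx : x ≠ 5) (hx4 : x ≠ 4) (hy : y ≠ 5) (hy4 : y ≠ 4) (hxy : x ≠ y)
    (h4 : σ 4 = []) (h5 : σ 5 = []) {M : ℕ} (hM : (σ x).length ≤ M) :
    Det (moveOn x y) σ (14 * M + 9)
      (Function.update (Function.update σ x []) y (σ x ++ σ y)) := by
  have h1 := Det.moveRev hx (by decide) hx4 h5 hM (y := 4)
  have h2 := Det.moveRev (σ := Function.update (Function.update σ x []) 4 ((σ x).reverse ++ σ 4))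
    (x := 4) (y := y) (M := M) (by decide) hy hy4.symm
    (by simp [h5, Function.update_of_ne hx.symm]) (by simp [h4, hM])
  refine Det.congr (h1.seq h2) ?_ (by omega)
  funext r
  by_cases h1 : r = y <;> by_cases h2 : r = x <;> by_cases h3 : r = 4 <;>
    simp_all [Function.update_apply]

def pushBoth (x y : ℕ) (b : Bool) : Prog := .seq (.instr (.push x b)) (.instr (.push y b))

/-- Copy the classical stack `x` to the top of stack `y`. -/
def copyBits (x y : ℕ) : Prog :=
  .seq (moveRev x 4)
    (whileNonempty 4 (.seq (.ite 4 .one (pushBoth x y true) (pushBoth x y false)) (.instr (.pop 4))))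

/-- Each cell is tested and then pushed anew onto both stacks, so only classical cells survive: a
qubit would be discarded and replaced by zeros. This is why `hb` is required. -/
theorem Det.copyBits {x y : ℕ} (hx : x ≠ 5) (hx4 : x ≠ 4) (hy : y ≠ 5) (hy4 : y ≠ 4) (hxy : x ≠ y)
    (h4 : σ 4 = []) (h5 : σ 5 = []) {M : ℕ} (hM : (σ x).length ≤ M)
    (hb : ∃ l : List Bool, σ x = l.map .bit) :
    Det (copyBits x y) σ (19 * M + 9) (Function.update σ y (σ x ++ σ y)) := by
  have h1 := Det.moveRev hx (by decide) hx4 h5 hM (y := 4)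
  have h2 := Det.whileNonempty (x := 4) (T := 6)
    (p := .seq (.ite 4 .one (pushBoth x y true) (pushBoth x y false)) (.instr (.pop 4)))
    (P := fun l _ => ∀ c ∈ l, ∃ b, c = Cell.bit b)
    (e := fun l (a : List Cell × List Cell) =>
      Function.update (Function.update (Function.update σ 4 l) x a.1) y a.2)
    (f := fun a i => (i :: a.1, i :: a.2))
    (fun l a _ => by simp [Function.update_of_ne hx4.symm, Function.update_of_ne hy4.symm])
    (fun l a _ => by
      rw [Function.update_of_ne hy.symm, Function.update_of_ne hx.symm,
        Function.update_of_ne (by decide), h5])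
    (fun i l a h c hc => h c (by simp [hc]))
    (fun i l a h => by
      obtain ⟨b, rfl⟩ := h i (by simp)
      have key : ∀ b, Det (pushBoth x y b)
          (Function.update (Function.update (Function.update σ 4 (Cell.bit b :: l)) x a.1) y a.2) 3
          (Function.update (Function.update (Function.update σ 4 (Cell.bit b :: l)) x
            (.bit b :: a.1)) y (.bit b :: a.2)) := fun b => by
        refine Det.congr ((Det.push _ x b).seq (Det.push _ y b)) ?_ le_rfl
        funext r
        by_cases h1 : r = y <;> by_cases h2 : r = x <;> simp_all [Function.update_apply]
      have h3 : Det (.ite 4 .one (pushBoth x y true) (pushBoth x y false))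
          (Function.update (Function.update (Function.update σ 4 (Cell.bit b :: l)) x a.1) y a.2) 4
          (Function.update (Function.update (Function.update σ 4 (Cell.bit b :: l)) x
            (.bit b :: a.1)) y (.bit b :: a.2)) := by
        refine Det.ite ?_
        rw [Function.update_of_ne hy4.symm, Function.update_of_ne hx4.symm, Function.update_self]
        cases b
        · exact key false
        · exact key true
      refine Det.congr (h3.seq (Det.pop _ 4)) ?_ le_rfl
      funext r
      by_cases h1 : r = y <;> by_cases h2 : r = x <;> by_cases h3 : r = 4 <;>
        simp_all [Function.update_apply])
    (σ x).reverse ([], σ y) (by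
      obtain ⟨l, hl⟩ := hb
      rw [hl]
      intro c hc
      rw [List.mem_reverse, List.mem_map] at hc
      obtain ⟨b, _, rfl⟩ := hc
      exact ⟨b, rfl⟩)
  have hf : ∀ (l : List Cell) (a : List Cell × List Cell),
      l.foldl (fun a i => (i :: a.1, i :: a.2)) a = (l.reverse ++ a.1, l.reverse ++ a.2) := by
    intro l
    induction l with
    | nil => simp
    | cons i l ih => intro a; simp [ih]
  rw [hf] at h2
  have h3 : Function.update (Function.update σ x []) 4 ((σ x).reverse ++ σ 4) =
      Function.update (Function.update (Function.update σ 4 (σ x).reverse) x []) y (σ y) := by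
    funext r
    by_cases h1 : r = y <;> by_cases h2 : r = x <;> by_cases h3 : r = 4 <;>
      simp_all
  rw [h3] at h1
  refine Det.congr (h1.seq h2) ?_ (by simp; omega)
  funext r
  by_cases h1 : r = y <;> by_cases h2 : r = x <;> by_cases h3 : r = 4 <;>
    simp_all

/-- Append the framed contents of stack `x`, in reverse, on top of stack `y`. -/
def frameOn (x y : ℕ) : Prog :=
  .seq (whileNonempty x (.seq (.instr (.push y true)) (.instr (.move x y)))) (.instr (.push y false))

theorem Det.frameOn {x y : ℕ} (hx : x ≠ 5) (hy : y ≠ 5) (hxy : x ≠ y) (h5 : σ 5 = []) {M : ℕ}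
    (hM : (σ x).length ≤ M) : Det (frameOn x y) σ (9 * M + 6)
      (Function.update (Function.update σ x []) y ((frame (σ x)).reverse ++ σ y)) := by
  have := Det.whileNonempty (x := x) (p := .seq (.instr (.push y true)) (.instr (.move x y)))
    (T := 3) (P := fun _ _ => True)
    (e := fun l (a : List Cell) => Function.update (Function.update σ x l) y a)
    (f := fun a i => i :: .bit true :: a)
    (fun l a _ => by simp [Function.update_of_ne hxy])
    (fun l a _ => by rw [Function.update_of_ne hy.symm, Function.update_of_ne hx.symm, h5])
    (fun _ _ _ _ => trivial)
    (fun i l a _ => by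
      refine Det.congr ((Det.push _ y true).seq (Det.move (c := i) (w := l) (x := x) (y := y)
        (by simp [Function.update_of_ne hxy]) hxy)) ?_ le_rfl
      funext r
      by_cases h1 : r = y <;> by_cases h2 : r = x <;> simp_all)
      (σ x) (σ y) trivial
  rw [Function.update_eq_self, Function.update_eq_self] at this
  have hf : ∀ (l a : List Cell), l.foldl (fun a i => i :: Cell.bit true :: a) a =
      (l.flatMap fun c => [Cell.bit true, c]).reverse ++ a := by
    intro l
    induction l with
    | nil => simp
    | cons i l ih => intro a; simp [ih]
  rw [hf] at this
  refine Det.congr (this.seq (Det.push _ y false)) ?_ (by omega)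
  simp [frame]

/-- Move the first message of the tuple on stack `x` to the empty stack `y`. -/
def unframeTo (x y : ℕ) : Prog :=
  .seq (.loop x .one (.seq (.instr (.pop x)) (.instr (.move x 4))))
    (.seq (.instr (.pop x)) (moveRev 4 y))

theorem length_unframe (w : List Cell) :
    (unframe w).1.length + (unframe w).2.length ≤ w.length := by
  induction w using unframe.induct with
  | case1 => simp [unframe]
  | case2 c w ih => simp only [unframe, List.length_cons]; omega
  | case3 c w h => simp [unframe]

/-- The loop stops in front of the final `0` of the message, or at the end of the stack. In both
cases one more `pop` leaves the rest, which is why the statement is about `v.tail`. The induction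
follows the recursion of `unframe`. -/
theorem Det.unframeLoop {x : ℕ} (hx4 : x ≠ 4) (w : List Cell) : ∀ σ : Store, σ x = w →
    ∃ v, v.tail = (unframe w).2 ∧ Det (.loop x .one (.seq (.instr (.pop x)) (.instr (.move x 4)))) σ
      (4 * w.length + 1)
      (Function.update (Function.update σ x v) 4 ((unframe w).1.reverse ++ σ 4)) := by
  have key : ∀ (σ σ' σ'' : Store) (T : ℕ), topOf (σ x) = .one →
      Det (.seq (.instr (.pop x)) (.instr (.move x 4))) σ 3 σ' →
      Det (.loop x .one (.seq (.instr (.pop x)) (.instr (.move x 4)))) σ' T σ'' →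
      Det (.loop x .one (.seq (.instr (.pop x)) (.instr (.move x 4)))) σ (T + 4) σ'' := by
    intro σ σ' σ'' T h1 h2 h3 μ K T' L hL
    rw [show T + 4 + T' = (3 + (T + T')) + 1 by ring]
    refine Reach.of_step (c' := ⟨_ :: .loop x .one _ :: K, σ, μ⟩)
      (by simp only [Config.step, h1, if_true]) (h2 μ _ _ _ (h3 μ K T' L hL))
  induction w using unframe.induct with
  | case1 =>
    intro σ hσ
    refine ⟨[], rfl, ?_⟩
    refine Det.congr (Det.loop_exit (by simp [hσ, topOf])) ?_ (by omega)
    simp only [unframe, List.reverse_nil, List.nil_append]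
    rw [← hσ]; simp
  | case2 c w ih =>
    intro σ hσ
    obtain ⟨v, hv, h⟩ := ih (Function.update (Function.update σ x w) 4 (c :: σ 4))
      (by simp [Function.update_of_ne hx4])
    refine ⟨v, hv, ?_⟩
    have h2 := (Det.pop σ x).seq (Det.move (c := c) (w := w) (x := x) (y := 4) (by simp [hσ]) hx4)
    rw [Function.update_idem, Function.update_of_ne hx4.symm] at h2
    refine Det.congr (key _ _ _ _ (by simp [hσ, topOf]) h2 h) ?_ (by simp; omega)
    funext r
    by_cases h1 : r = 4 <;> by_cases h2 : r = x <;> simp_all [unframe]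
  | case3 c w h =>
    intro σ hσ
    -- A malformed tuple may end in a single `1`. The loop pops it and then finds nothing to move,
    -- in agreement with the last clause of `unframe`.
    by_cases hc : c = .bit true
    · subst hc
      have hw : w = [] := by
        rcases w with _ | ⟨d, w⟩
        · rfl
        · exact (h d w rfl rfl).elim
      subst hw
      refine ⟨[], rfl, ?_⟩
      have h2 := (Det.pop σ x).seq (Det.move_nil (x := x) (y := 4) (by simp [hσ]))
      refine Det.congr (key _ _ _ _ (by simp [hσ, topOf]) h2
        (Det.loop_exit (by simp [hσ, topOf]))) ?_ (by simp)
      funext r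
      by_cases h1 : r = 4 <;> by_cases h2 : r = x <;> simp_all [Function.update_apply, unframe]
    · refine ⟨c :: w, by simp [unframe], ?_⟩
      have : topOf (c :: w) ≠ .one := by
        rcases c with (_ | _) | _ <;> simp_all [topOf]
      refine Det.congr (Det.loop_exit (by rwa [hσ])) ?_ (by omega)
      funext r
      by_cases h1 : r = 4 <;> by_cases h2 : r = x <;> simp_all [unframe]

theorem Det.unframeTo {x y : ℕ} (hx : x ≠ 5) (hx4 : x ≠ 4) (hy : y ≠ 5) (hy4 : y ≠ 4) (hxy : x ≠ y)
    (h4 : σ 4 = []) (h5 : σ 5 = []) (hy0 : σ y = []) {M : ℕ} (hM : (σ x).length ≤ M) :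
    Det (unframeTo x y) σ (11 * M + 8)
      (Function.update (Function.update σ x (unframe (σ x)).2) y (unframe (σ x)).1) := by
  obtain ⟨v, hv, h1⟩ := Det.unframeLoop hx4 (σ x) σ rfl
  have hl := length_unframe (σ x)
  have h2 := Det.pop (Function.update (Function.update σ x v) 4 ((unframe (σ x)).1.reverse ++ σ 4)) x
  have h3 := Det.moveRev (x := 4) (y := y) (M := M)
    (σ := Function.update (Function.update (Function.update σ x v) 4
      ((unframe (σ x)).1.reverse ++ σ 4)) x v.tail) (by decide) hy hy4.symm
    (by simp [Function.update_of_ne hx.symm, h5])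
    (by simp [Function.update_of_ne hx4.symm, h4]; omega)
  rw [Function.update_of_ne hx4, Function.update_self] at h2
  refine Det.congr (h1.seq (h2.seq h3)) ?_ (by omega)
  funext r
  by_cases h1 : r = y <;> by_cases h2 : r = x <;> by_cases h3 : r = 4 <;>
    simp_all [Function.update_apply]
  rw [if_neg (by omega), List.reverse_reverse]

end


/-! ## Calling an algorithm as a subroutine -/

def Instr.shift (b : ℕ) : Instr → Instr
  | .push x v => .push (x + b) v
  | .pop x => .pop (x + b)
  | .move x y => .move (x + b) (y + b)
  | .new x => .new (x + b)
  | .had x => .had (x + b)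
  | .tgate x => .tgate (x + b)
  | .cnot x y => .cnot (x + b) (y + b)
  | .meas x => .meas (x + b)

/-- The program `p` working on the stacks from `b` on. -/
def Prog.shift (b : ℕ) : Prog → Prog
  | .skip => .skip
  | .instr a => .instr (a.shift b)
  | .seq p q => .seq (p.shift b) (q.shift b)
  | .ite x s p q => .ite (x + b) s (p.shift b) (q.shift b)
  | .loop x s p => .loop (x + b) s (p.shift b)

/-- The stacks of `σ` below `b`, and from `b` on the stacks `s`. -/
def overlay (b : ℕ) (σ s : Store) : Store := fun r => if r < b then σ r else s (r - b)

@[simp] theorem overlay_add (b : ℕ) (σ s : Store) (r : ℕ) : overlay b σ s (r + b) = s r := by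
  simp [overlay]

theorem update_overlay (b : ℕ) (σ s : Store) (r : ℕ) (w : List Cell) :
    Function.update (overlay b σ s) (r + b) w = overlay b σ (Function.update s r w) := by
  funext i
  by_cases hi : i < b
  · rw [Function.update_of_ne (by omega)]
    simp [overlay, hi]
  · obtain ⟨j, rfl⟩ : ∃ j, i = j + b := ⟨i - b, by omega⟩
    rw [overlay_add]
    by_cases hj : j = r
    · subst hj; simp
    · rw [Function.update_of_ne hj, Function.update_of_ne (by omega), overlay_add]

theorem Instr.apply_shift (b : ℕ) (σ s : Store) (μ : QMem) (a : Instr) :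
    (a.shift b).apply (overlay b σ s) μ = (a.apply s μ).map fun r => (overlay b σ r.1, r.2) := by
  cases a with
  | push x v => simp [Instr.shift, Instr.apply, update_overlay]
  | pop x => simp [Instr.shift, Instr.apply, update_overlay]
  | new x => simp [Instr.shift, Instr.apply, update_overlay]
  | move x y =>
    simp only [Instr.shift, Instr.apply, overlay_add]
    rcases h : s x with _ | ⟨c, w⟩ <;> simp [update_overlay]
  | had x =>
    simp only [Instr.shift, Instr.apply, overlay_add]
    rcases h : s x with _ | ⟨_ | _, w⟩ <;> simp
  | tgate x =>
    simp only [Instr.shift, Instr.apply, overlay_add]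
    rcases h : s x with _ | ⟨_ | _, w⟩ <;> simp
  | cnot x y =>
    simp only [Instr.shift, Instr.apply, overlay_add]
    rcases h : s x with _ | ⟨_ | _, w⟩ <;> rcases h' : s y with _ | ⟨_ | _, w'⟩ <;> simp
  | meas x =>
    simp only [Instr.shift, Instr.apply, overlay_add]
    rcases h : s x with _ | ⟨_ | _, w⟩ <;> simp [update_overlay]

/-- The configuration `c` of a subroutine inside of a caller with stacks `σ` and further statements
`K`. -/
def Config.inside (b : ℕ) (σ : Store) (K : List Prog) (c : Config) : Config :=
  ⟨c.todo.map (Prog.shift b) ++ K, overlay b σ c.store, c.mem⟩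

/-- A halted subroutine has to be excluded: the caller then goes on with `K`, while the subroutine
on its own stays where it is. -/
theorem Config.step_inside (b : ℕ) (σ : Store) (K : List Prog) (c : Config) (hc : c.todo ≠ []) :
    (c.inside b σ K).step = c.step.map (Config.inside b σ K) := by
  obtain ⟨todo, s, μ⟩ := c
  rcases todo with _ | ⟨p, L⟩
  · exact (hc rfl).elim
  · cases p with
    | skip => simp [Config.inside, Config.step, Prog.shift]
    | instr a =>
      simp [Config.inside, Config.step, Prog.shift, Instr.apply_shift]
    | seq p q => simp [Config.inside, Config.step, Prog.shift]
    | ite x t p q =>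
      by_cases h : topOf (s x) = t <;> simp [Config.inside, Config.step, Prog.shift, h]
    | loop x t p =>
      by_cases h : topOf (s x) = t <;> simp [Config.inside, Config.step, Prog.shift, h]

/-- Branches of the subroutine may halt at different times, and each of them enters the continuation
at once. The common budget `T + T'` covers them all, because `Reach` bounds the time only from
above. -/
theorem Reach.inside (b : ℕ) (σ : Store) (K : List Prog) (T' : ℕ) (g : Config → List Config)
    (T : ℕ) : ∀ c : Config, (∀ c' ∈ c.run T, c'.todo = []) →
    (∀ c' ∈ c.run T, Reach T' (c'.inside b σ K) (g c')) →
    Reach (T + T') (c.inside b σ K) ((c.run T).flatMap g) := by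
  induction T with
  | zero =>
    intro c _ hg
    simpa [Config.run] using hg c (by simp [Config.run])
  | succ T ih =>
    intro c h hg
    by_cases hc : c.todo = []
    · rw [Config.run_of_halted hc] at hg ⊢
      simpa using (hg c (by simp)).mono (by omega)
    · rw [Config.run_succ] at h hg ⊢
      rw [List.flatMap_assoc, Nat.add_right_comm]
      have := Reach.step (T := T + T') (c := c.inside b σ K)
        (c.step.map fun c' => (c'.inside b σ K, (c'.run T).flatMap g))
        (by rw [Config.step_inside b σ K c hc, List.map_map]; rfl) fun s hs => by
          obtain ⟨c', hc', rfl⟩ := List.mem_map.1 hs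
          exact ih c' (fun c'' h' => h c'' (List.mem_flatMap.2 ⟨c', hc', h'⟩))
            fun c'' h' => hg c'' (List.mem_flatMap.2 ⟨c', hc', h'⟩)
      simpa [List.flatMap_map] using this

/-- All stacks that the instruction uses are below `w`. -/
def Instr.Below (w : ℕ) : Instr → Prop
  | .push x _ | .pop x | .new x | .had x | .tgate x | .meas x => x < w
  | .move x y | .cnot x y => x < w ∧ y < w

/-- All stacks that the program changes are below `w`. -/
def Prog.Below (w : ℕ) : Prog → Prop
  | .skip => True
  | .instr a => a.Below w
  | .seq p q => p.Below w ∧ q.Below w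
  | .ite _ _ p q => p.Below w ∧ q.Below w
  | .loop _ _ p => p.Below w

theorem Prog.Below.mono {w w' : ℕ} (hw : w ≤ w') : ∀ {p : Prog}, p.Below w → p.Below w'
  | .skip, _ => trivial
  | .instr a, h => by
    cases a <;> simp only [Prog.Below, Instr.Below] at h ⊢ <;> omega
  | .seq _ _, h => ⟨h.1.mono hw, h.2.mono hw⟩
  | .ite _ _ _ _, h => ⟨h.1.mono hw, h.2.mono hw⟩
  | .loop _ _ p, h => Prog.Below.mono (p := p) hw h

theorem Prog.exists_below : ∀ p : Prog, ∃ w, p.Below w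
  | .skip => ⟨0, trivial⟩
  | .instr a => by
    cases a with
    | move x y => exact ⟨x + y + 1, by simp only [Prog.Below, Instr.Below]; omega⟩
    | cnot x y => exact ⟨x + y + 1, by simp only [Prog.Below, Instr.Below]; omega⟩
    | push x _ => exact ⟨x + 1, by simp [Prog.Below, Instr.Below]⟩
    | pop x => exact ⟨x + 1, by simp [Prog.Below, Instr.Below]⟩
    | new x => exact ⟨x + 1, by simp [Prog.Below, Instr.Below]⟩
    | had x => exact ⟨x + 1, by simp [Prog.Below, Instr.Below]⟩
    | tgate x => exact ⟨x + 1, by simp [Prog.Below, Instr.Below]⟩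
    | meas x => exact ⟨x + 1, by simp [Prog.Below, Instr.Below]⟩
  | .seq p q => by
    obtain ⟨w, hw⟩ := p.exists_below
    obtain ⟨v, hv⟩ := q.exists_below
    exact ⟨max w v, hw.mono (le_max_left _ _), hv.mono (le_max_right _ _)⟩
  | .ite _ _ p q => by
    obtain ⟨w, hw⟩ := p.exists_below
    obtain ⟨v, hv⟩ := q.exists_below
    exact ⟨max w v, hw.mono (le_max_left _ _), hv.mono (le_max_right _ _)⟩
  | .loop _ _ p => p.exists_below

/-- Since a stack grows by at most one cell per step, the running time bounds the size of every
output. All size bounds of the reduction rest on this. -/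
theorem Instr.length_apply {a : Instr} {σ : Store} {μ : QMem} {r : Store × QMem}
    (hr : r ∈ a.apply σ μ) (x : ℕ) : (r.1 x).length ≤ (σ x).length + 1 := by
  have key : ∀ (σ : Store) (y : ℕ) (w : List Cell), w.length ≤ (σ y).length + 1 →
      (Function.update σ y w x).length ≤ (σ x).length + 1 := by
    intro σ y w hw
    by_cases h : x = y
    · subst h; simpa using hw
    · rw [Function.update_of_ne h]; omega
  cases a with
  | push y v =>
    simp only [Instr.apply, List.mem_singleton] at hr
    subst hr; exact key _ _ _ (by simp)
  | pop y =>
    simp only [Instr.apply, List.mem_singleton] at hr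
    subst hr; exact key _ _ _ (by rw [List.length_tail]; omega)
  | new y =>
    simp only [Instr.apply, List.mem_singleton] at hr
    subst hr; exact key _ _ _ (by simp)
  | move y z =>
    simp only [Instr.apply] at hr
    rcases h : σ y with _ | ⟨c, w⟩ <;> rw [h] at hr <;> simp only [List.mem_singleton] at hr <;>
      subst hr
    · simp
    dsimp only
    · by_cases hx : x = z
      · subst hx
        rw [Function.update_self]
        by_cases hxy : x = y
        · subst hxy; simp [h]
        · rw [Function.update_of_ne hxy]; simp
      · rw [Function.update_of_ne hx]
        exact key _ _ _ (by simp [h]; omega)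
  | had y =>
    simp only [Instr.apply] at hr
    rcases h : σ y with _ | ⟨_ | _, w⟩ <;> rw [h] at hr <;> simp only [List.mem_singleton] at hr <;>
      subst hr <;> simp
  | tgate y =>
    simp only [Instr.apply] at hr
    rcases h : σ y with _ | ⟨_ | _, w⟩ <;> rw [h] at hr <;> simp only [List.mem_singleton] at hr <;>
      subst hr <;> simp
  | cnot y z =>
    simp only [Instr.apply] at hr
    rcases h : σ y with _ | ⟨_ | _, w⟩ <;> rcases h' : σ z with _ | ⟨_ | _, w'⟩ <;>
      rw [h] at hr <;> (try rw [h'] at hr) <;> simp only [List.mem_singleton] at hr <;>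
      subst hr <;> simp
  | meas y =>
    simp only [Instr.apply] at hr
    rcases h : σ y with _ | ⟨_ | _, w⟩ <;> rw [h] at hr <;>
      simp only [List.mem_cons, List.not_mem_nil, or_false] at hr
    · subst hr; simp
    · subst hr; simp
    · rcases hr with rfl | rfl <;> exact key _ _ _ (by simp [h])

theorem Instr.apply_below {a : Instr} {w : ℕ} (ha : a.Below w) {σ : Store} {μ : QMem}
    {r : Store × QMem} (hr : r ∈ a.apply σ μ) {x : ℕ} (hx : w ≤ x) : r.1 x = σ x := by
  have key : ∀ (σ : Store) (y : ℕ) (v : List Cell), y < w → Function.update σ y v x = σ x :=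
    fun σ y v hy => Function.update_of_ne (by omega) _ _
  cases a with
  | push y v =>
    simp only [Instr.apply, List.mem_singleton] at hr
    subst hr; exact key _ _ _ ha
  | pop y =>
    simp only [Instr.apply, List.mem_singleton] at hr
    subst hr; exact key _ _ _ ha
  | new y =>
    simp only [Instr.apply, List.mem_singleton] at hr
    subst hr; exact key _ _ _ ha
  | move y z =>
    simp only [Instr.apply] at hr
    rcases h : σ y with _ | ⟨c, v⟩ <;> rw [h] at hr <;> simp only [List.mem_singleton] at hr <;>
      subst hr
    · rfl
    · dsimp only
      rw [key _ _ _ ha.2, key _ _ _ ha.1]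
  | had y =>
    simp only [Instr.apply] at hr
    rcases h : σ y with _ | ⟨_ | _, w⟩ <;> rw [h] at hr <;> simp only [List.mem_singleton] at hr <;>
      subst hr <;> simp
  | tgate y =>
    simp only [Instr.apply] at hr
    rcases h : σ y with _ | ⟨_ | _, w⟩ <;> rw [h] at hr <;> simp only [List.mem_singleton] at hr <;>
      subst hr <;> simp
  | cnot y z =>
    simp only [Instr.apply] at hr
    rcases h : σ y with _ | ⟨_ | _, w⟩ <;> rcases h' : σ z with _ | ⟨_ | _, w'⟩ <;>
      rw [h] at hr <;> (try rw [h'] at hr) <;> simp only [List.mem_singleton] at hr <;>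
      subst hr <;> simp
  | meas y =>
    simp only [Instr.apply] at hr
    rcases h : σ y with _ | ⟨_ | _, w⟩ <;> rw [h] at hr <;>
      simp only [List.mem_cons, List.not_mem_nil, or_false] at hr
    · subst hr; simp
    · subst hr; simp
    · rcases hr with rfl | rfl <;> exact key _ _ _ ha

theorem Config.length_step {c c' : Config} (h : c' ∈ c.step) (x : ℕ) :
    (c'.store x).length ≤ (c.store x).length + 1 := by
  obtain ⟨todo, s, μ⟩ := c
  rcases todo with _ | ⟨p, L⟩
  · simp only [Config.step, List.mem_singleton] at h
    subst h; simp
  · cases p with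
    | instr a =>
      simp only [Config.step, List.mem_map] at h
      obtain ⟨r, hr, rfl⟩ := h
      exact Instr.length_apply hr x
    | _ =>
      simp only [Config.step, List.mem_singleton] at h
      subst h; simp

theorem Config.length_run {T : ℕ} : ∀ {c c' : Config}, c' ∈ c.run T → ∀ x,
    (c'.store x).length ≤ (c.store x).length + T := by
  induction T with
  | zero =>
    intro c c' h x
    simp only [Config.run, List.mem_singleton] at h
    subst h; simp
  | succ T ih =>
    intro c c' h x
    rw [Config.run_succ, List.mem_flatMap] at h
    obtain ⟨d, hd, h⟩ := h
    have h1 := ih h x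
    have h2 := Config.length_step hd x
    omega

theorem Config.step_below {w : ℕ} {c c' : Config} (hc : ∀ p ∈ c.todo, p.Below w)
    (h : c' ∈ c.step) : (∀ p ∈ c'.todo, p.Below w) ∧ ∀ x, w ≤ x → c'.store x = c.store x := by
  obtain ⟨todo, s, μ⟩ := c
  rcases todo with _ | ⟨p, L⟩
  · simp only [Config.step, List.mem_singleton] at h
    subst h; exact ⟨hc, fun _ _ => rfl⟩
  · have hp : p.Below w := hc p (by simp)
    have hL : ∀ p ∈ L, p.Below w := fun q hq => hc q (by simp [hq])
    cases p with
    | instr a =>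
      simp only [Config.step, List.mem_map] at h
      obtain ⟨r, hr, rfl⟩ := h
      exact ⟨hL, fun x hx => Instr.apply_below hp hr hx⟩
    | skip =>
      simp only [Config.step, List.mem_singleton] at h
      subst h; exact ⟨hL, fun _ _ => rfl⟩
    | seq p q =>
      simp only [Config.step, List.mem_singleton] at h
      subst h
      refine ⟨?_, fun _ _ => rfl⟩
      simp only [List.mem_cons, forall_eq_or_imp]
      exact ⟨hp.1, hp.2, hL⟩
    | ite x t p q =>
      simp only [Config.step, List.mem_singleton] at h
      subst h
      refine ⟨?_, fun _ _ => rfl⟩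
      simp only [List.mem_cons, forall_eq_or_imp]
      refine ⟨?_, hL⟩
      split_ifs
      · exact hp.1
      · exact hp.2
    | loop x t p =>
      simp only [Config.step, List.mem_singleton] at h
      subst h
      refine ⟨?_, fun _ _ => rfl⟩
      dsimp only
      split_ifs
      · simp only [List.mem_cons, forall_eq_or_imp]
        exact ⟨hp, hp, hL⟩
      · exact hL

/-- A program changes only finitely many stacks, so a fixed number of them has to be emptied before
the next call can find its stacks fresh. -/
theorem Config.run_below {w T : ℕ} : ∀ {c c' : Config}, (∀ p ∈ c.todo, p.Below w) →
    c' ∈ c.run T → ∀ x, w ≤ x → c'.store x = c.store x := by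
  induction T with
  | zero =>
    intro c c' _ h x _
    simp only [Config.run, List.mem_singleton] at h
    subst h; rfl
  | succ T ih =>
    intro c c' hc h x hx
    rw [Config.run_succ, List.mem_flatMap] at h
    obtain ⟨d, hd, h⟩ := h
    have h1 := Config.step_below hc hd
    rw [ih h1.1 h x hx, h1.2 x hx]

/-- Empty the `w` stacks from `b` on. -/
def clearFrom (b : ℕ) : ℕ → Prog
  | 0 => .skip
  | w + 1 => .seq (clearFrom b w) (clear (b + w))

theorem Det.clearFrom {b : ℕ} (hb : 5 < b) {σ : Store} (h5 : σ 5 = []) {M : ℕ}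
    (hM : ∀ r, b ≤ r → (σ r).length ≤ M) (w : ℕ) :
    Det (clearFrom b w) σ (w * (7 * M + 5) + 1)
      fun r => if b ≤ r ∧ r < b + w then [] else σ r := by
  induction w with
  | zero =>
    refine Det.congr (Det.skip σ) ?_ (by omega)
    funext r
    rw [if_neg (by omega)]
  | succ w ih =>
    refine Det.congr (ih.seq (Det.clear (x := b + w) (M := M) (by omega) ?_ ?_)) ?_ (by ring_nf; omega)
    · rw [if_neg (by omega), h5]
    · rw [if_neg (by omega)]; exact hM _ (by omega)
    · funext r
      by_cases h : r = b + w
      · subst h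
        rw [Function.update_self, if_pos (by omega)]
      · rw [Function.update_of_ne h]
        by_cases h1 : b ≤ r ∧ r < b + w
        · rw [if_pos h1, if_pos (by omega)]
        · rw [if_neg h1, if_neg (by omega)]

/-- The final stacks of a run of `B`. -/
noncomputable def QPTAlg.stores (B : QPTAlg) (sec : ℕ) (x y : List Cell) : QM Store := fun μ =>
  ((startConfig B.prog sec x y μ).run (B.time.eval (sec + x.length + y.length))).map
    fun c => (c.store, c.mem)

theorem QPTAlg.exec_eq (B : QPTAlg) (sec : ℕ) (x y : List Cell) :
    B.exec sec x y = (fun s => s 3) <$> B.stores sec x y := by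
  funext μ
  rw [QM.map_apply, QPTAlg.stores, List.map_map]
  rfl

theorem length_inputStore (sec : ℕ) (x y : List Cell) (r : ℕ) :
    (inputStore sec x y r).length ≤ sec + x.length + y.length := by
  unfold inputStore
  split_ifs <;> (try simp only [List.length_replicate, List.length_nil]) <;> omega

theorem QPTAlg.all_exec (B : QPTAlg) (sec : ℕ) (x y : List Cell) :
    All (B.exec sec x y) fun out => out.length ≤ B.time.eval (sec + x.length + y.length) := by
  intro μ r hr
  obtain ⟨c, hc, rfl⟩ := List.mem_map.1 hr
  simpa [startConfig, inputStore] using Config.length_run hc 3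

theorem QPTAlg.all_stores (B : QPTAlg) {w : ℕ} (hw : B.prog.Below w) (hw3 : 3 ≤ w) (sec : ℕ)
    (x y : List Cell) :
    All (B.stores sec x y) fun s => (∀ r, w ≤ r → s r = []) ∧
      ∀ r, (s r).length ≤ (sec + x.length + y.length) + B.time.eval (sec + x.length + y.length) := by
  intro μ r hr
  obtain ⟨c, hc, rfl⟩ := List.mem_map.1 hr
  constructor
  · intro r hr
    change c.store r = []
    rw [Config.run_below (w := w) (by simpa [startConfig] using hw) hc r hr]
    simp only [startConfig, inputStore]
    rw [if_neg (by omega), if_neg (by omega), if_neg (by omega)]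
  · intro r
    exact (Config.length_run hc r).trans (Nat.add_le_add_right (length_inputStore sec x y r) _)

theorem Impl.shift (B : QPTAlg) (b sec : ℕ) (x y : List Cell) (σ : Store) :
    Impl (B.prog.shift b) (overlay b σ (inputStore sec x y))
      (B.time.eval (sec + x.length + y.length)) (B.stores sec x y) (overlay b σ) :=
    fun μ K T' g hg => by
  have := Reach.inside b σ K T' (fun c => g c.store c.mem) _ (startConfig B.prog sec x y μ)
    (B.halts sec x y μ) fun c hc => by
      have h := hg (c.store, c.mem) (List.mem_map.2 ⟨c, hc, rfl⟩)
      simpa [Config.inside, B.halts sec x y μ c hc] using h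
  rw [QPTAlg.stores, List.flatMap_map]
  simpa [Config.inside, startConfig] using this

/-- Number of stacks to be cleaned after a run of `p`. -/
noncomputable def Prog.width (p : Prog) : ℕ := p.exists_below.choose + 4

theorem Prog.below_width (p : Prog) : p.Below p.width :=
  p.exists_below.choose_spec.mono (by simp [Prog.width])

/-- Run `B` on the stacks from `30` on, with the inputs moved from stacks `6` and `15`, and move the
output to stack `7`. -/
noncomputable def callProg (B : QPTAlg) : Prog :=
  .seq (copyBits 0 30) (.seq (moveOn 6 31) (.seq (moveOn 15 32) (.seq (B.prog.shift 30)
    (.seq (moveOn 33 7) (clearFrom 30 B.prog.width)))))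

/-- Time bound for `callProg`. -/
noncomputable def callTime (B : QPTAlg) (M : ℕ) : ℕ :=
  120 * M + 60 + B.prog.width * (28 * M + 5)

/-- Once the inputs are in place, the stacks from 30 on are a start store for `B`, seen through
`overlay`, and `Impl.shift` applies. The cleaning at the end restores `h30`, so that calls can be
repeated inside of loops. -/
theorem Impl.call (B : QPTAlg) {σ : Store} {sec M : ℕ} (h0 : σ 0 = List.replicate sec (.bit true))
    (h4 : σ 4 = []) (h5 : σ 5 = []) (h7 : σ 7 = []) (h30 : ∀ r, 30 ≤ r → σ r = []) (hsec : sec ≤ M)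
    (h6 : (σ 6).length ≤ M) (h15 : (σ 15).length ≤ M)
    (hM : B.time.eval (sec + (σ 6).length + (σ 15).length) ≤ M) :
    Impl (callProg B) σ (callTime B M) (B.exec sec (σ 6) (σ 15)) fun out =>
      Function.update (Function.update (Function.update σ 6 []) 15 []) 7 out := by
  have h1 := Det.copyBits (σ := σ) (x := 0) (y := 30) (M := M) (by decide) (by decide) (by decide)
    (by decide) (by decide) h4 h5 (by simpa [h0] using hsec)
    ⟨List.replicate sec true, by simp [h0]⟩
  have h2 := Det.moveOn (σ := Function.update σ 30 (σ 0 ++ σ 30)) (x := 6) (y := 31) (M := M)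
    (by decide) (by decide) (by decide) (by decide) (by decide) (by simp [h4]) (by simp [h5])
    (by simpa using h6)
  have h3 := Det.moveOn (σ := Function.update (Function.update (Function.update σ 30 (σ 0 ++ σ 30))
      6 []) 31 (σ 6)) (x := 15) (y := 32) (M := M)
    (by decide) (by decide) (by decide) (by decide) (by decide) (by simp [h4]) (by simp [h5])
    (by simpa using h15)
  have e2 : Function.update (Function.update (Function.update σ 30 (σ 0 ++ σ 30)) 6 []) 31
      (Function.update σ 30 (σ 0 ++ σ 30) 6 ++ Function.update σ 30 (σ 0 ++ σ 30) 31) =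
      Function.update (Function.update (Function.update σ 30 (σ 0 ++ σ 30)) 6 []) 31 (σ 6) := by
    simp [h30]
  rw [e2] at h2
  set σ' := Function.update (Function.update σ 6 []) 15 [] with hσ'
  have e3 : Function.update (Function.update (Function.update (Function.update (Function.update σ 30
      (σ 0 ++ σ 30)) 6 []) 31 (σ 6)) 15 []) 32
      (Function.update (Function.update (Function.update σ 30 (σ 0 ++ σ 30)) 6 []) 31 (σ 6) 15 ++
        Function.update (Function.update (Function.update σ 30 (σ 0 ++ σ 30)) 6 []) 31 (σ 6) 32) =
      overlay 30 σ' (inputStore sec (σ 6) (σ 15)) := by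
    funext r
    by_cases hr : r < 30
    · simp only [overlay, hr, if_true, hσ', Function.update_apply]
      rw [if_neg (by omega), if_neg (by omega : ¬ r = 31), if_neg (by omega : ¬ r = 30)]
    · obtain ⟨j, rfl⟩ : ∃ j, r = j + 30 := ⟨r - 30, by omega⟩
      rw [overlay_add]
      simp only [inputStore, Function.update_apply]
      by_cases j0 : j = 0
      · subst j0; simp [h0, h30]
      by_cases j1 : j = 1
      · subst j1; simp
      by_cases j2 : j = 2
      · subst j2; simp [h30]
      rw [if_neg (by omega), if_neg (by omega), if_neg (by omega), if_neg (by omega),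
        if_neg (by omega), if_neg j0, if_neg j1, if_neg j2, h30 _ (by omega)]
  rw [e3] at h3
  have h4' := Impl.shift B 30 sec (σ 6) (σ 15) σ'
  have hall := B.all_stores B.prog.below_width (by simp [Prog.width]) sec (σ 6) (σ 15)
  -- The security parameter, both inputs and the running time are at most `M` each, which gives `4 *
  -- M` for every stack.
  have hlen : ∀ s : Store, (∀ r, (s r).length ≤ (sec + (σ 6).length + (σ 15).length) +
      B.time.eval (sec + (σ 6).length + (σ 15).length)) → ∀ r, (s r).length ≤ 4 * M :=
    fun s hs r => (hs r).trans (by linarith)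
  have h5' := Impl.seq (q := .seq (moveOn 33 7) (clearFrom 30 B.prog.width)) (h := fun s => pure (s 3))
    (e' := fun out => Function.update σ' 7 out)
    (T' := 14 * (4 * M) + 9 + (B.prog.width * (7 * (4 * M) + 5) + 1) + 1) hall h4' fun s hs => by
      refine Det.impl (e := fun out => Function.update σ' 7 out) ?_
      refine Det.congr (Det.seq (Det.moveOn (x := 33) (y := 7) (M := 4 * M) (by decide) (by decide)
        (by decide) (by decide) (by decide) (by simp [overlay, hσ', h4]) (by simp [overlay, hσ', h5])
        (by simpa [overlay] using hlen s hs.2 3)) (Det.clearFrom (by decide) (M := 4 * M)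
          (by simp [overlay, hσ', h5]) (fun r hr => ?_) _)) ?_ le_rfl
      · rw [Function.update_of_ne (by omega)]
        by_cases h : r = 33
        · subst h; simp
        · rw [Function.update_of_ne h, overlay, if_neg (by omega)]
          exact hlen s hs.2 _
      · funext r
        by_cases hr : 30 ≤ r
        · have e : Function.update σ' 7 (s 3) r = [] := by
            rw [Function.update_of_ne (by omega), hσ', Function.update_of_ne (by omega),
              Function.update_of_ne (by omega), h30 r hr]
          refine Eq.trans ?_ e.symm
          by_cases hw : r < 30 + B.prog.width
          · rw [if_pos ⟨hr, hw⟩]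
          -- As the width is at least 4, stack 33, from which the output was moved, lies in the
          -- cleaned range and is not the stack `r` considered here.
          · have hw4 : 4 ≤ B.prog.width := by simp [Prog.width]
            rw [if_neg (by omega), Function.update_of_ne (by omega), Function.update_of_ne (by omega),
              overlay, if_neg (by omega), hs.1 _ (by omega)]
        · rw [if_neg (by omega)]
          by_cases h : r = 7
          · subst h; simp [overlay, hσ', h7]
          · rw [Function.update_of_ne h, Function.update_of_ne h, Function.update_of_ne (by omega),
              overlay, if_pos (by omega)]
  have := h1.seq_impl (h2.seq_impl (h3.seq_impl h5'))
  rw [QPTAlg.exec_eq, map_eq_pure_bind]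
  refine this.mono ?_
  simp only [callTime]
  ring_nf
  omega


/-! ## Further subroutines -/

/-- The number `k` in unary. -/
def ones (k : ℕ) : List Cell := List.replicate k (.bit true)

@[simp] theorem length_ones (k : ℕ) : (ones k).length = k := by simp [ones]

theorem ones_succ (k : ℕ) : ones (k + 1) = .bit true :: ones k := rfl

theorem ones_append (j k : ℕ) : ones j ++ ones k = ones (j + k) := by simp [ones]

theorem ones_bits (k : ℕ) : ∃ l : List Bool, ones k = l.map .bit :=
  ⟨List.replicate k true, by simp [ones]⟩

theorem reverse_ones (k : ℕ) : (ones k).reverse = ones k := by simp [ones]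

/-- Repeat `p` as often as the counter `x` says. -/
def forLoop (x : ℕ) (p : Prog) : Prog := .loop x .one (.seq (.instr (.pop x)) p)

theorem Impl.forLoop {α : Type} {x : ℕ} {p : Prog} {e : α → Store} {f : α → QM α} {T : ℕ}
    {P : ℕ → α → Prop} (hP : ∀ k a, P (k + 1) a → All (f a) (P k))
    (hbody : ∀ k a, P (k + 1) a → Impl p (Function.update (e a) x (ones k)) T (f a)
      fun a => Function.update (e a) x (ones k))
    (k : ℕ) (a : α) (ha : P k a) :
    Impl (forLoop x p) (Function.update (e a) x (ones k)) (k * (T + 3) + 1)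
      ((List.replicate k ()).foldlM (fun a _ => f a) a) (fun a => Function.update (e a) x []) := by
  have := Impl.loop (x := x) (s := .one) (p := .seq (.instr (.pop x)) p) (T := T + 2)
    (e := fun (l : List Unit) a => Function.update (e a) x (ones l.length))
    (f := fun a _ => f a) (P := fun l a => P l.length a) (fun a _ => by simp [ones, topOf])
    (fun i l a _ => by simp [ones, topOf, List.replicate_succ]) (fun i l a h => hP _ _ h)
    (fun i l a h => by
      have h1 := Det.pop (Function.update (e a) x (ones (i :: l).length)) x
      rw [Function.update_idem, Function.update_self, List.length_cons, ones_succ,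
        List.tail_cons] at h1
      exact (h1.seq_impl (hbody _ _ h)).mono (by omega)) (List.replicate k ()) a (by simpa using ha)
  simpa [QPuzzle.forLoop, ones] using this

theorem Det.forLoop {α : Type} {x : ℕ} {p : Prog} {e : α → Store} {f : α → α} {T : ℕ}
    {P : ℕ → α → Prop} (hP : ∀ k a, P (k + 1) a → P k (f a))
    (hbody : ∀ k a, P (k + 1) a → Det p (Function.update (e a) x (ones k)) T
      (Function.update (e (f a)) x (ones k))) (k : ℕ) (a : α) (ha : P k a) :
    Det (forLoop x p) (Function.update (e a) x (ones k)) (k * (T + 3) + 1)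
      (Function.update (e (f^[k] a)) x []) := by
  have := Impl.forLoop (f := fun a => pure (f a)) (fun k a h => All.pure (hP k a h))
    (fun k a h => (hbody k a h).impl (e := fun a => Function.update (e a) x (ones k))) k a ha
  rw [QM.foldlM_pure, List.foldl_const, List.length_replicate] at this
  exact this.det (e := fun a => Function.update (e a) x [])

def pushOnes (x : ℕ) : ℕ → Prog
  | 0 => .skip
  | k + 1 => .seq (pushOnes x k) (.instr (.push x true))

theorem Det.pushOnes (σ : Store) (x k : ℕ) :
    Det (pushOnes x k) σ (2 * k + 1) (Function.update σ x (ones k ++ σ x)) := by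
  induction k with
  | zero => exact Det.congr (Det.skip σ) (by simp [ones]) (by omega)
  | succ k ih =>
    refine Det.congr (ih.seq (Det.push _ x true)) ?_ (by omega)
    simp [ones_succ]

/-- Induction on the exponent. To multiply by the security parameter, the value found so far becomes
a loop counter on stack 13, and `1^sec` is copied from stack 0 once per round. -/
theorem exists_monomialProg (k a x : ℕ) (hx : 5 < x) (hx13 : x ≠ 13) :
    ∃ (p : Prog) (T : Polynomial ℕ), ∀ (σ : Store) (sec : ℕ), σ 0 = ones sec → σ 4 = [] →
      σ 5 = [] → σ 13 = [] → σ x = [] →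
      Det p σ (T.eval sec) (Function.update σ x (ones ((Polynomial.monomial k a).eval sec))) := by
  induction k with
  | zero =>
    refine ⟨pushOnes x a, .C (2 * a + 1), fun σ sec _ _ _ _ h => ?_⟩
    refine Det.congr (Det.pushOnes σ x a) ?_ (by simp)
    simp [h]
  | succ k ih =>
    obtain ⟨p, T, hp⟩ := ih
    refine ⟨.seq p (.seq (moveRev x 13) (forLoop 13 (copyBits 0 x))),
      T + 7 * Polynomial.monomial k a + 5 + Polynomial.monomial k a * (19 * .X + 12) + 2,
      fun σ sec h0 h4 h5 h13 h => ?_⟩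
    have h1 := hp σ sec h0 h4 h5 h13 h
    set v := Polynomial.eval sec (Polynomial.monomial k a) with hv
    have h2 := Det.moveRev (σ := Function.update σ x (ones v)) (x := x) (y := 13) (M := v)
      (by omega) (by decide) (by omega) (by rw [Function.update_of_ne (by omega), h5]) (by simp)
    rw [Function.update_idem, Function.update_self, reverse_ones,
      Function.update_of_ne (by omega), h13, List.append_nil] at h2
    have h3 := Det.forLoop (x := 13) (p := copyBits 0 x) (T := 19 * sec + 9)
      (e := fun w => Function.update σ x w) (f := fun w => ones sec ++ w)
      (P := fun _ _ => True) (fun _ _ _ => trivial) (fun k w _ => by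
        refine Det.congr (Det.copyBits (x := 0) (y := x) (M := sec) (by decide) (by decide)
          (by omega) (by omega) (by omega) ?_ ?_ ?_ ?_) ?_ le_rfl
        · rw [Function.update_of_ne (by decide), Function.update_of_ne (by omega), h4]
        · rw [Function.update_of_ne (by decide), Function.update_of_ne (by omega), h5]
        · rw [Function.update_of_ne (by decide), Function.update_of_ne (by omega), h0]; simp
        · rw [Function.update_of_ne (by decide), Function.update_of_ne (by omega), h0]
          exact ones_bits _
        · rw [Function.update_of_ne (by decide), Function.update_of_ne (by omega), h0,
            Function.update_of_ne (by omega), Function.update_self,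
            Function.update_comm (by omega), Function.update_idem]) v [] trivial
    have hit : ∀ v, (fun w => ones sec ++ w)^[v] [] = ones (v * sec) := by
      intro v
      induction v with
      | zero => simp [ones]
      | succ v ih =>
        rw [Function.iterate_succ_apply', ih, ones_append]
        congr 1; ring
    rw [hit] at h3
    refine Det.congr (h1.seq (h2.seq h3)) ?_ ?_
    · have e : Function.update (Function.update σ x (ones (v * sec))) 13 [] =
          Function.update σ x (ones (v * sec)) := by
        rw [Function.update_eq_self_iff, Function.update_of_ne (by omega), h13]
      rw [e, hv]
      congr 2
      simp only [Polynomial.eval_monomial]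
      ring
    · simp only [Polynomial.eval_add, Polynomial.eval_mul, Polynomial.eval_ofNat,
        Polynomial.eval_X, ← hv]
      ring_nf
      omega

/-- A program that computes a polynomial of the security parameter in unary. -/
theorem exists_polyProg (P : Polynomial ℕ) (x : ℕ) (hx : 13 < x) :
    ∃ (p : Prog) (T : Polynomial ℕ), ∀ (σ : Store) (sec : ℕ), σ 0 = ones sec → σ 4 = [] →
      σ 5 = [] → σ 10 = [] → σ 13 = [] →
      Det p σ (T.eval sec) (Function.update σ x (ones (P.eval sec) ++ σ x)) := by
  induction P using Polynomial.induction_on' with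
  | monomial k a =>
    obtain ⟨p, T, hp⟩ := exists_monomialProg k a 10 (by decide) (by decide)
    refine ⟨.seq p (moveOn 10 x), T + 14 * Polynomial.monomial k a + 10,
      fun σ sec h0 h4 h5 h10 h13 => ?_⟩
    refine Det.congr ((hp σ sec h0 h4 h5 h13 h10).seq (Det.moveOn (x := 10) (y := x)
      (M := (Polynomial.monomial k a).eval sec) (by decide) (by decide) (by omega) (by omega)
      (by omega) (by simpa using h4) (by simpa using h5) (by simp))) ?_ ?_
    · rw [Function.update_idem, Function.update_self, Function.update_of_ne (by omega)]
      congr 1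
      rw [Function.update_eq_self_iff, h10]
    · simp only [Polynomial.eval_add, Polynomial.eval_mul, Polynomial.eval_ofNat]
      omega
  | add P Q hP hQ =>
    obtain ⟨p, T, hp⟩ := hP
    obtain ⟨q, S, hq⟩ := hQ
    refine ⟨.seq q p, S + T + 1, fun σ sec h0 h4 h5 h10 h13 => ?_⟩
    refine Det.congr ((hq σ sec h0 h4 h5 h10 h13).seq (hp _ sec ?_ ?_ ?_ ?_ ?_)) ?_ (by simp)
    · rwa [Function.update_of_ne (by omega)]
    · rwa [Function.update_of_ne (by omega)]
    · rwa [Function.update_of_ne (by omega)]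
    · rwa [Function.update_of_ne (by omega)]
    · rwa [Function.update_of_ne (by omega)]
    · rw [Function.update_idem, Function.update_self, Polynomial.eval_add, ← List.append_assoc,
        ones_append]

/-! ### Lists of keys -/

/-- A check key as an entry of a list of keys. -/
def keyCells (k : List Bool) : List Cell := .bit true :: frame (k.map .bit)

/-- A list of check keys on a stack. -/
def keysCells (ks : List (List Bool)) : List Cell := ks.flatMap keyCells

theorem length_frame (w : List Cell) : (frame w).length = 2 * w.length + 1 := by
  simp only [frame, List.length_append, List.length_flatMap, List.length_cons, List.length_nil]
  simp [mul_comm]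

theorem frame_map_bit (l : List Bool) : ∃ l' : List Bool, frame (l.map .bit) = l'.map .bit := by
  refine ⟨(l.flatMap fun b => [true, b]) ++ [false], ?_⟩
  simp [frame, List.flatMap_map, List.map_flatMap]

theorem keysCells_bits (ks : List (List Bool)) : ∃ l : List Bool, keysCells ks = l.map .bit := by
  induction ks with
  | nil => exact ⟨[], rfl⟩
  | cons k ks ih =>
    obtain ⟨l, hl⟩ := ih
    obtain ⟨l', hl'⟩ := frame_map_bit k
    refine ⟨true :: l' ++ l, ?_⟩
    simp [keysCells, keyCells, hl'] at hl ⊢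
    exact hl

theorem length_keyCells (k : List Bool) : (keyCells k).length = 2 * k.length + 2 := by
  simp [keyCells, length_frame]

theorem length_keysCells {ks : List (List Bool)} {κ : ℕ} (h : ∀ k ∈ ks, k.length ≤ κ) :
    (keysCells ks).length ≤ ks.length * (2 * κ + 2) := by
  induction ks with
  | nil => simp [keysCells]
  | cons k ks ih =>
    have h1 := ih fun k' hk' => h k' (by simp [hk'])
    have h2 := h k (by simp)
    simp only [keysCells, List.flatMap_cons, List.length_append, length_keyCells,
      List.length_cons] at h1 ⊢
    linarith

theorem unframe_frame (w v : List Cell) : unframe (frame w ++ v) = (w, v) := by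
  induction w with
  | nil => simp [frame, unframe]
  | cons c w ih =>
    have : frame (c :: w) ++ v = .bit true :: c :: (frame w ++ v) := by simp [frame]
    rw [this, unframe, ih]

theorem bitsOf_length_le (w : List Cell) : (bitsOf w).length ≤ w.length :=
  List.length_filterMap_le _ _

/-- Turn the contents of stack `x` into an entry of the list of keys on stack `y`. -/
def pushKey (x y : ℕ) : Prog :=
  .seq (moveRev x 4) (.seq (.instr (.push y false))
    (.seq (whileNonempty 4 (.ite 4 .qubit (.instr (.pop 4))
      (.seq (.instr (.move 4 y)) (.instr (.push y true))))) (.instr (.push y true))))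

/-- The output of `CheckGen` may contain unmeasured qubits. They are popped, as `bitsOf` prescribes.
Stack 4 holds the cells in reverse, so the frame is pushed back to front, with its final `0` first.
-/
theorem Det.pushKey {σ : Store} {x y : ℕ} (hx : x ≠ 5) (hx4 : x ≠ 4) (hy : y ≠ 5) (hy4 : y ≠ 4)
    (hxy : x ≠ y) (h4 : σ 4 = []) (h5 : σ 5 = []) {M : ℕ} (hM : (σ x).length ≤ M) :
    Det (pushKey x y) σ (17 * M + 13)
      (Function.update (Function.update σ x []) y (keyCells (bitsOf (σ x)) ++ σ y)) := by
  have h1 := Det.moveRev hx (by decide) hx4 h5 hM (y := 4)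
  rw [h4, List.append_nil] at h1
  set τ := Function.update σ x [] with hτ
  have h2 := Det.push (Function.update τ 4 (σ x).reverse) y false
  have t4 : ∀ w : List Cell, Function.update (Function.update τ 4 []) y w = Function.update τ y w := by
    intro w
    congr 1
    rw [Function.update_eq_self_iff, hτ, Function.update_of_ne hx4.symm, h4]
  have h3 := Det.whileNonempty (x := 4) (T := 4)
    (p := .ite 4 .qubit (.instr (.pop 4)) (.seq (.instr (.move 4 y)) (.instr (.push y true))))
    (P := fun _ _ => True)
    (e := fun l (a : List Cell) => Function.update (Function.update τ 4 l) y a)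
    (f := fun a i => match i with | .bit b => .bit true :: .bit b :: a | .qubit _ => a)
    (fun l a _ => by simp [Function.update_of_ne hy4.symm])
    (fun l a _ => by rw [Function.update_of_ne hy.symm, Function.update_of_ne (by decide), hτ,
      Function.update_of_ne hx.symm, h5])
    (fun _ _ _ _ => trivial)
    (fun i l a _ => by
      refine Det.ite ?_
      rw [Function.update_of_ne hy4.symm, Function.update_self]
      rcases i with b | i
      · rw [if_neg (by cases b <;> simp [topOf])]
        refine Det.congr ((Det.move (c := .bit b) (w := l) (by simp [Function.update_of_ne hy4.symm])
          hy4.symm).seq (Det.push _ y true)) ?_ le_rfl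
        simp only [Function.update_idem, Function.update_self]
        rw [Function.update_comm hy4.symm, Function.update_idem, Function.update_comm hy4,
          Function.update_idem]
      · rw [if_pos (by simp [topOf])]
        refine Det.congr (Det.pop _ 4) ?_ (by omega)
        rw [Function.update_of_ne hy4.symm, Function.update_self, Function.update_comm hy4.symm,
          Function.update_idem, Function.update_comm hy4.symm, List.tail_cons])
    (σ x).reverse (.bit false :: σ y) trivial
  have hf : ∀ (l a : List Cell), l.reverse.foldl (fun a i => match i with
      | .bit b => Cell.bit true :: .bit b :: a | .qubit _ => a) a =
      (((bitsOf l).map Cell.bit).flatMap fun c => [.bit true, c]) ++ a := by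
    intro l
    induction l with
    | nil => intro a; rfl
    | cons i l ih =>
      intro a
      rw [List.reverse_cons, List.foldl_append, ih]
      rcases i with b | i <;> simp [bitsOf]
  rw [hf, t4, List.length_reverse] at h3
  rw [Function.update_of_ne hy4, hτ, Function.update_of_ne hxy.symm, ← hτ] at h2
  refine Det.congr (h1.seq (h2.seq (h3.seq (Det.push _ y true)))) ?_ (by omega)
  rw [Function.update_idem, Function.update_self, hτ]
  simp [keyCells, frame]

/-- A fair coin. -/
noncomputable def coinAlg : QPTAlg where
  prog := .seq (.instr (.new 3)) (.seq (.instr (.had 3)) (.instr (.meas 3)))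
  time := .C 5
  halts := by
    intro sec x y μ c hc
    rw [Polynomial.eval_C] at hc
    simp only [startConfig, Config.run, Config.step, Instr.apply, inputStore, List.flatMap_cons,
      List.flatMap_nil, List.append_nil, List.map_cons, List.map_nil, Function.update_self,
      List.mem_cons, List.not_mem_nil, or_false] at hc
    rcases hc with rfl | rfl <;> rfl

theorem coinAlg_exec (sec : ℕ) (μ : QMem) : coinAlg.exec sec [] [] μ =
    [([.bit false], ⟨μ.next + 1, project μ.next false (hadamard μ.next μ.ψ)⟩),
      ([.bit true], ⟨μ.next + 1, project μ.next true (hadamard μ.next μ.ψ)⟩)] := by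
  simp only [QPTAlg.exec, coinAlg, Polynomial.eval_C]
  simp [startConfig, Config.run, Config.step, Instr.apply, inputStore]


/-! ## Registers -/

/-- The stacks with the given contents from stack `0` on. -/
def stackList (l : List (List Cell)) : Store := fun r => l.getD r []

theorem update_stackList {l : List (List Cell)} {r : ℕ} (hr : r < l.length) (w : List Cell) :
    Function.update (stackList l) r w = stackList (l.set r w) := by
  funext i
  by_cases h : i = r
  · subst h
    simp [stackList, List.getD_eq_getElem?_getD, hr]
  · rw [Function.update_of_ne h]
    simp [stackList, List.getD_eq_getElem?_getD, List.getElem?_set_ne (Ne.symm h)]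

/-- The stacks of the reduction, without the scratch stacks `4` and `5`. -/
structure Regs where
  sec : List Cell
  X : List Cell
  Y : List Cell
  OUT : List Cell
  A1 : List Cell
  O : List Cell
  P : List Cell
  S : List Cell
  Q : List Cell
  R1 : List Cell
  R2 : List Cell
  C : List Cell
  ANS : List Cell
  A2 : List Cell
  OK : List Cell
  BLK : List Cell
  J : List Cell
  KJ : List Cell
  DONE : List Cell
  C1 : List Cell
  C2 : List Cell
  U : List Cell
  V : List Cell

namespace Regs

variable (ρ : Regs) (w : List Cell)

def store : Store := stackList [ρ.sec, ρ.X, ρ.Y, ρ.OUT, [], [], ρ.A1, ρ.O, ρ.P, ρ.S, ρ.Q, ρ.R1, ρ.R2, ρ.C, ρ.ANS, ρ.A2, ρ.OK, ρ.BLK, ρ.J, ρ.KJ, ρ.DONE, ρ.C1, ρ.C2, ρ.U, ρ.V]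

@[simp] theorem store_sec : ρ.store 0 = ρ.sec := rfl
@[simp] theorem store_X : ρ.store 1 = ρ.X := rfl
@[simp] theorem store_Y : ρ.store 2 = ρ.Y := rfl
@[simp] theorem store_OUT : ρ.store 3 = ρ.OUT := rfl
@[simp] theorem store_A1 : ρ.store 6 = ρ.A1 := rfl
@[simp] theorem store_O : ρ.store 7 = ρ.O := rfl
@[simp] theorem store_P : ρ.store 8 = ρ.P := rfl
@[simp] theorem store_S : ρ.store 9 = ρ.S := rfl
@[simp] theorem store_Q : ρ.store 10 = ρ.Q := rfl
@[simp] theorem store_R1 : ρ.store 11 = ρ.R1 := rfl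
@[simp] theorem store_R2 : ρ.store 12 = ρ.R2 := rfl
@[simp] theorem store_C : ρ.store 13 = ρ.C := rfl
@[simp] theorem store_ANS : ρ.store 14 = ρ.ANS := rfl
@[simp] theorem store_A2 : ρ.store 15 = ρ.A2 := rfl
@[simp] theorem store_OK : ρ.store 16 = ρ.OK := rfl
@[simp] theorem store_BLK : ρ.store 17 = ρ.BLK := rfl
@[simp] theorem store_J : ρ.store 18 = ρ.J := rfl
@[simp] theorem store_KJ : ρ.store 19 = ρ.KJ := rfl
@[simp] theorem store_DONE : ρ.store 20 = ρ.DONE := rfl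
@[simp] theorem store_C1 : ρ.store 21 = ρ.C1 := rfl
@[simp] theorem store_C2 : ρ.store 22 = ρ.C2 := rfl
@[simp] theorem store_U : ρ.store 23 = ρ.U := rfl
@[simp] theorem store_V : ρ.store 24 = ρ.V := rfl
@[simp] theorem store_scratch : ρ.store 4 = [] := rfl
@[simp] theorem store_flag : ρ.store 5 = [] := rfl

theorem store_high {r : ℕ} (hr : 25 ≤ r) : ρ.store r = [] := by
  obtain ⟨k, rfl⟩ := Nat.exists_eq_add_of_le' hr
  rfl

@[simp] theorem update_X : Function.update ρ.store 1 w = { ρ with X := w }.store :=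
  update_stackList (by simp) w
@[simp] theorem update_OUT : Function.update ρ.store 3 w = { ρ with OUT := w }.store :=
  update_stackList (by simp) w
@[simp] theorem update_A1 : Function.update ρ.store 6 w = { ρ with A1 := w }.store :=
  update_stackList (by simp) w
@[simp] theorem update_O : Function.update ρ.store 7 w = { ρ with O := w }.store :=
  update_stackList (by simp) w
@[simp] theorem update_P : Function.update ρ.store 8 w = { ρ with P := w }.store :=
  update_stackList (by simp) w
@[simp] theorem update_S : Function.update ρ.store 9 w = { ρ with S := w }.store :=
  update_stackList (by simp) w
@[simp] theorem update_Q : Function.update ρ.store 10 w = { ρ with Q := w }.store :=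
  update_stackList (by simp) w
@[simp] theorem update_R1 : Function.update ρ.store 11 w = { ρ with R1 := w }.store :=
  update_stackList (by simp) w
@[simp] theorem update_R2 : Function.update ρ.store 12 w = { ρ with R2 := w }.store :=
  update_stackList (by simp) w
@[simp] theorem update_C : Function.update ρ.store 13 w = { ρ with C := w }.store :=
  update_stackList (by simp) w
@[simp] theorem update_ANS : Function.update ρ.store 14 w = { ρ with ANS := w }.store :=
  update_stackList (by simp) w
@[simp] theorem update_A2 : Function.update ρ.store 15 w = { ρ with A2 := w }.store :=
  update_stackList (by simp) w
@[simp] theorem update_OK : Function.update ρ.store 16 w = { ρ with OK := w }.store :=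
  update_stackList (by simp) w
@[simp] theorem update_BLK : Function.update ρ.store 17 w = { ρ with BLK := w }.store :=
  update_stackList (by simp) w
@[simp] theorem update_J : Function.update ρ.store 18 w = { ρ with J := w }.store :=
  update_stackList (by simp) w
@[simp] theorem update_KJ : Function.update ρ.store 19 w = { ρ with KJ := w }.store :=
  update_stackList (by simp) w
@[simp] theorem update_DONE : Function.update ρ.store 20 w = { ρ with DONE := w }.store :=
  update_stackList (by simp) w
@[simp] theorem update_C1 : Function.update ρ.store 21 w = { ρ with C1 := w }.store :=
  update_stackList (by simp) w
@[simp] theorem update_C2 : Function.update ρ.store 22 w = { ρ with C2 := w }.store :=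
  update_stackList (by simp) w
@[simp] theorem update_U : Function.update ρ.store 23 w = { ρ with U := w }.store :=
  update_stackList (by simp) w
@[simp] theorem update_V : Function.update ρ.store 24 w = { ρ with V := w }.store :=
  update_stackList (by simp) w

end Regs


/-! ## The reduction, as a procedure -/

section
variable (W : WeaklyVerifiablePuzzle) (A : QPTAlg) (sec : ℕ)

/-- `CheckGen`. -/
noncomputable def WeaklyVerifiablePuzzle.newKey : QM (List Bool) := do
  let out ← W.CheckGen.exec sec [] []
  pure (bitsOf out)

/-- `PuzzleGen`. -/
noncomputable def WeaklyVerifiablePuzzle.newPuzzle (k : List Bool) : QM (List Cell) :=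
  W.PuzzleGen.exec sec (k.map Cell.bit) []

/-- `Ver`. -/
noncomputable def WeaklyVerifiablePuzzle.accept (ans : List Cell) (k : List Bool) : QM Bool := do
  let out ← W.Ver.exec sec (k.map Cell.bit) ans
  pure (decide (topOf out = Top.one))

/-- Independent check keys. -/
noncomputable def sampleKeys (j : ℕ) : QM (List (List Bool)) :=
  (List.replicate j ()).foldlM (fun P _ => do
    let k ← W.newKey sec
    pure (k :: P)) []

/-- Extend the input for the adversary by a tuple of puzzles: new ones for the keys `P` and `S`, and
between them the first puzzle of the given tuple. -/
noncomputable def tupleStep (P S : List (List Bool)) (a : List Cell × List Cell) :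
    QM (List Cell × List Cell) := do
  let p₁ ← P.mapM (W.newPuzzle sec)
  let p₂ ← S.mapM (W.newPuzzle sec)
  pure (a.1 ++ frame (encode (p₁ ++ (unframe a.2).1 :: p₂)), (unframe a.2).2)

/-- Verify the first of the remaining answers. -/
noncomputable def verStep (a : Bool × List Cell) (k : List Bool) : QM (Bool × List Cell) := do
  let d ← W.accept sec (unframe a.2).1 k
  pure (a.1 && d, (unframe a.2).2)

/-- Run the adversary on puzzles for `j` new keys, on `t` given puzzles, and on puzzles for the keys
`S`; verify its first `j` answers.  Returns the verdict, the remaining answers and the unused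
puzzles. -/
noncomputable def attempt (t j : ℕ) (S : List (List Bool)) (B : List Cell) :
    QM (Bool × List Cell × List Cell) := do
  let P ← sampleKeys W sec j
  let a ← (List.replicate t ()).foldlM (fun a _ => tupleStep W sec P S a) ([], B)
  let ans ← A.exec sec a.1 []
  let v ← P.foldlM (verStep W sec) (true, ans)
  pure (v.1, v.2, a.2)

/-- Puzzles for a known key. -/
noncomputable def selfBlock (t : ℕ) (k : List Bool) : QM (List Cell) :=
  (List.replicate t ()).foldlM (fun B _ => do
    let p ← [k].mapM (W.newPuzzle sec)
    pure (B ++ encode p)) []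

/-- Attempt to extend the list `s.2` of keys by a new key. -/
noncomputable def selfAttempt (t j : ℕ) (s : Bool × List (List Bool)) :
    QM (Bool × List (List Bool)) :=
  if s.1 then pure s else do
    let k ← W.newKey sec
    let B ← selfBlock W sec t k
    let a ← attempt W A sec t j s.2 B
    let v ← [k].foldlM (verStep W sec) (a.1, a.2.1)
    pure (if v.1 then (true, k :: s.2) else s)

/-- After the first success the flag makes the remaining rounds idle. If every round fails, the list
comes back without a new key; the analysis gives such branches up. -/
noncomputable def phase (N t j : ℕ) (S : List (List Bool)) : QM (List (List Bool)) := do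
  let s ← (List.replicate N ()).foldlM (fun s _ => selfAttempt W A sec t j s) (false, S)
  pure s.2

/-- The first component is the number of keys in front of the one that is sought. It decreases
whether or not a key has been found. -/
noncomputable def phases (N t v : ℕ) (a : ℕ × List (List Bool)) : QM (ℕ × List (List Bool)) :=
  (List.replicate v ()).foldlM (fun a _ => do
    let S ← phase W A sec N t a.1 a.2
    pure (a.1 - 1, S)) a

/-- Attempt to find an answer to the given puzzles. -/
noncomputable def realAttempt (t j : ℕ) (S : List (List Bool)) (a : Bool × List Cell × List Cell) :
    QM (Bool × List Cell × List Cell) :=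
  if a.1 then pure a else do
    let r ← attempt W A sec t j S a.2.1
    pure (r.1, r.2.2, if r.1 then (unframe r.2.1).1 else a.2.2)

noncomputable def coin : QM Bool := do
  let w ← coinAlg.exec sec [] []
  pure (decide (topOf w = .one))

/-- The tosses are the binary digits of a number below `2 ^ m`, reduced modulo `n' + 1` after every
toss to keep the unary representation short. -/
noncomputable def sampleIndex (n' m : ℕ) : QM ℕ :=
  (List.replicate m ()).foldlM (fun x _ => do
    let c ← coin sec
    pure ((2 * x + c.toNat) % (n' + 1))) 0

/-- The reduction, on the puzzles `X`. -/
noncomputable def solve (n' N t m : ℕ) (X : List Cell) : QM (List Cell) := do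
  let x ← sampleIndex sec n' m
  -- The count `n'` is lowered `n' - x` times, so `x` fresh keys remain in front of the given
  -- puzzles.
  let a ← phases W A sec N t (n' - x) (n', [])
  let b ← (List.replicate N ()).foldlM (fun b _ => realAttempt W A sec t a.1 a.2 b) (false, X, [])
  pure b.2.2

end

/-! ## The reduction, as a program -/

theorem eval_mono (P : Polynomial ℕ) {a b : ℕ} (h : a ≤ b) : P.eval a ≤ P.eval b := by
  rw [Polynomial.eval_eq_sum, Polynomial.eval_eq_sum]
  exact Finset.sum_le_sum fun i _ => Nat.mul_le_mul_left _ (Nat.pow_le_pow_left h i)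

/-- Bounds for the sizes of all data of the reduction: of keys by `κ`, of puzzles by `π`, of the given
tuple of puzzles by `β`, of tuples by `L`, of answers by `α`, and of everything by `M`. -/
structure Sizes (W : WeaklyVerifiablePuzzle) (A : QPTAlg) (sec n t κ π β L α M : ℕ) : Prop where
  sec_le : sec ≤ M
  checkGen : W.CheckGen.time.eval sec ≤ κ
  key_le : κ ≤ M
  keys_le : (n + 1) * (2 * κ + 2) ≤ M
  puzzleGen : W.PuzzleGen.time.eval (sec + κ) ≤ π
  puzzle_le : π ≤ M
  n_le : n ≤ M
  t_le : t ≤ M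
  block : t * (2 * π + 1) ≤ β
  block_le : β ≤ M
  tuple : 2 * n * (2 * π + 1) + (2 * β + 1) ≤ L
  tuple_le : L ≤ M
  input_le : t * (2 * L + 1) ≤ M
  adversary : A.time.eval (sec + t * (2 * L + 1)) ≤ α
  answer_le : α ≤ M
  ver : W.Ver.time.eval (sec + κ + α) ≤ M

theorem foldlM_snoc {ι α : Type} (g : ι → QM α) (l : List ι) (a : List α) :
    l.foldlM (fun ps i => do let p ← g i; pure (ps ++ [p])) a = (fun ps => a ++ ps) <$> l.mapM g := by
  induction l generalizing a with
  | nil => simp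
  | cons i l ih =>
    rw [List.foldlM_cons, List.mapM_cons]
    simp only [bind_assoc, pure_bind, ih]
    simp

theorem encode_append (l l' : List (List Cell)) : encode (l ++ l') = encode l ++ encode l' := by
  simp [encode]

theorem encode_singleton (w : List Cell) : encode [w] = frame w := by simp [encode]

theorem length_encode {ws : List (List Cell)} {π : ℕ} (h : ∀ w ∈ ws, w.length ≤ π) :
    (encode ws).length ≤ ws.length * (2 * π + 1) := by
  induction ws with
  | nil => simp [encode]
  | cons w ws ih =>
    have h1 := ih fun w' hw' => h w' (by simp [hw'])
    have h2 := h w (by simp)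
    simp only [encode, List.flatMap_cons, List.length_append, length_frame, List.length_cons] at h1 ⊢
    linarith

/-- The mark `1` in front of every key is the loop condition: a list of keys is used up exactly when
the top of its stack is not `1`. -/
theorem topOf_keysCells_nil : topOf (keysCells []) ≠ .one := by simp [keysCells, topOf]

theorem topOf_keysCells_cons (k : List Bool) (l : List (List Bool)) :
    topOf (keysCells (k :: l)) = .one := by simp [keysCells, keyCells, topOf]

theorem keysCells_cons (k : List Bool) (l : List (List Bool)) :
    keysCells (k :: l) = .bit true :: (frame (k.map .bit) ++ keysCells l) := by
  simp [keysCells, keyCells]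

/-! ### Programs that generate puzzles -/

section
variable {W : WeaklyVerifiablePuzzle} {A : QPTAlg} {sec n t κ π β L α M : ℕ}

/-- Generate puzzles for the list of keys on stack `src`, and append them to stack `11`. -/
noncomputable def genAll (W : WeaklyVerifiablePuzzle) (src : ℕ) : Prog :=
  .seq (copyBits src 10) (.loop 10 .one (.seq (.seq (.instr (.pop 10)) (unframeTo 10 6))
    (.seq (callProg W.PuzzleGen) (frameOn 7 11))))

noncomputable def genAllTime (W : WeaklyVerifiablePuzzle) (M : ℕ) : ℕ :=
  19 * M + 11 + M * (callTime W.PuzzleGen M + 20 * M + 20)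

theorem Sizes.puzzleGen_le (h : Sizes W A sec n t κ π β L α M) {k : List Bool} (hk : k.length ≤ κ) :
    W.PuzzleGen.time.eval (sec + k.length) ≤ π := (eval_mono _ (by omega)).trans h.puzzleGen

theorem Sizes.all_puzzleGen (h : Sizes W A sec n t κ π β L α M) {k : List Bool}
    (hk : k.length ≤ κ) : All (W.newPuzzle sec k) fun p => p.length ≤ π :=
  (W.PuzzleGen.all_exec sec (k.map Cell.bit) []).mono fun p hp => by
    simp only [List.length_map, List.length_nil, add_zero] at hp
    exact hp.trans (h.puzzleGen_le hk)

theorem length_le_keysCells (l : List (List Bool)) : l.length ≤ (keysCells l).length := by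
  induction l with
  | nil => simp
  | cons k l ih => rw [keysCells_cons]; simp; omega

/-- The keys are consumed from a copy on stack 10, so that the list on `src` can be used again.
Cells are pushed one at a time, hence stack 11 holds the puzzles in reverse; the caller turns them
round once at the end. -/
theorem genAll_impl (h : Sizes W A sec n t κ π β L α M) {ρ : Regs} {src : ℕ}
    {ks : List (List Bool)} (hsrc : src = 8 ∨ src = 9 ∨ src = 19)
    (hs : ρ.store src = keysCells ks) (h0 : ρ.sec = ones sec) (hA1 : ρ.A1 = []) (hO : ρ.O = [])
    (hQ : ρ.Q = []) (hA2 : ρ.A2 = []) (hk : ∀ k ∈ ks, k.length ≤ κ) (hl : (keysCells ks).length ≤ M) :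
    Impl (genAll W src) ρ.store (genAllTime W M) (ks.mapM (W.newPuzzle sec))
      fun ps => { ρ with R1 := (encode ps).reverse ++ ρ.R1 }.store := by
  have h1 := Det.copyBits (σ := ρ.store) (x := src) (y := 10) (M := M) (by omega) (by omega)
    (by decide) (by decide) (by omega) rfl rfl (by rwa [hs]) (by rw [hs]; exact keysCells_bits ks)
  rw [hs] at h1
  clear hs
  rcases ρ with ⟨_, X, Y, OUT, _, _, P, S, _, R1, R2, C, ANS, _, OK, BLK, J, KJ, DONE, C1, C2, U, V⟩
  dsimp only at h0 hA1 hO hQ hA2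
  subst h0 hA1 hO hQ hA2
  simp only [Regs.store_Q, List.append_nil, Regs.update_Q] at h1
  let e (l : List (List Bool)) (ps : List (List Cell)) : Store :=
    (Regs.mk (ones sec) X Y OUT [] [] P S (keysCells l) ((encode ps).reverse ++ R1) R2 C ANS [] OK
      BLK J KJ DONE C1 C2 U V).store
  have h2 := Impl.loop (x := 10) (s := .one)
    (p := .seq (.seq (.instr (.pop 10)) (unframeTo 10 6)) (.seq (callProg W.PuzzleGen) (frameOn 7 11)))
    (T := callTime W.PuzzleGen M + 20 * M + 18) (e := e)
    (f := fun ps k => do let p ← W.newPuzzle sec k; pure (ps ++ [p]))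
    (P := fun l _ => (∀ k ∈ l, k.length ≤ κ) ∧ (keysCells l).length ≤ M)
    (fun a _ => topOf_keysCells_nil) (fun i l a _ => topOf_keysCells_cons i l)
    (fun i l a hh => (All.trivial _).bind fun p _ => .pure ⟨fun k hk => hh.1 k (by simp [hk]), by
      have := hh.2; rw [keysCells_cons] at this; simp at this; omega⟩)
    (fun k l ps hh => by
      have hlen := hh.2
      rw [keysCells_cons] at hlen
      simp only [List.length_cons, List.length_append] at hlen
      have hk := hh.1 k (by simp)
      have g1 := Det.pop (e (k :: l) ps) 10
      simp only [e, Regs.store_Q, keysCells_cons, List.tail_cons, Regs.update_Q] at g1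
      have g2 := g1.seq (Det.unframeTo (x := 10) (y := 6) (M := M) (by decide) (by decide) (by decide)
        (by decide) (by decide) rfl rfl rfl (by simp; omega))
      simp only [Regs.store_Q, unframe_frame, Regs.update_Q, Regs.update_A1] at g2
      have g3 := g2.seq_impl (Impl.seq (p := callProg W.PuzzleGen) (q := frameOn 7 11)
        (T' := 9 * M + 6) (h := fun p => pure (ps ++ [p])) (e' := e l)
        (h.all_puzzleGen hk)
        (Impl.call W.PuzzleGen (M := M) (sec := sec) rfl rfl rfl rfl
          (fun r hr => Regs.store_high _ (by omega)) h.sec_le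
          (by simpa using hk.trans h.key_le) (by simp)
          (by simpa using (h.puzzleGen_le hk).trans h.puzzle_le)) fun p hp => by
            refine Det.impl ?_
            refine Det.congr (Det.frameOn (x := 7) (y := 11) (M := M) (by decide) (by decide)
              (by decide) rfl (by simpa using hp.trans h.puzzle_le)) ?_ le_rfl
            simp [e, encode_append, encode_singleton])
      simp only [e, keysCells_cons]
      refine Impl.mono g3 ?_
      omega) ks [] ⟨hk, hl⟩
  have h3 := h1.seq_impl h2
  rw [foldlM_snoc] at h3
  simp only [List.nil_append, id_map'] at h3
  refine Impl.congr (All.trivial _) h3 (fun ps _ => ?_) ?_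
  · simp [e, keysCells]
  · have : ks.length * (callTime W.PuzzleGen M + 20 * M + 18 + 1) ≤
        M * (callTime W.PuzzleGen M + 20 * M + 20) :=
      Nat.mul_le_mul ((length_le_keysCells ks).trans hl) (by omega)
    simp only [genAllTime]
    omega

end


/-! ### Composition rules with a prescribed time bound -/

theorem Det.seq_impl_le {α : Type} {p q : Prog} {σ σ' : Store} {T T' U : ℕ} {m : QM α}
    {e : α → Store} (hp : Det p σ T σ') (hq : Impl q σ' T' m e) (hT : T + T' + 1 ≤ U) :
    Impl (.seq p q) σ U m e := (hp.seq_impl hq).mono hT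

theorem Impl.seq_le {α β : Type} {p q : Prog} {σ : Store} {T T' U : ℕ} {m : QM α} {e : α → Store}
    {h : α → QM β} {e' : β → Store} {P : α → Prop} (hm : All m P) (hp : Impl p σ T m e)
    (hq : ∀ a, P a → Impl q (e a) T' (h a) e') (hT : T + T' + 1 ≤ U) :
    Impl (.seq p q) σ U (m >>= h) e' := (Impl.seq hm hp hq).mono hT

theorem Impl.ite_pos {α : Type} {p q : Prog} {σ : Store} {T x : ℕ} {s : Top} {m : QM α}
    {e : α → Store} (hs : topOf (σ x) = s) (h : Impl p σ T m e) :
    Impl (.ite x s p q) σ (T + 1) m e := Impl.ite (by rwa [if_pos hs])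

theorem Impl.ite_neg {α : Type} {p q : Prog} {σ : Store} {T x : ℕ} {s : Top} {m : QM α}
    {e : α → Store} (hs : topOf (σ x) ≠ s) (h : Impl q σ T m e) :
    Impl (.ite x s p q) σ (T + 1) m e := Impl.ite (by rwa [if_neg hs])

theorem Det.ite_pos {p q : Prog} {σ σ' : Store} {T x : ℕ} {s : Top} (hs : topOf (σ x) = s)
    (h : Det p σ T σ') : Det (.ite x s p q) σ (T + 1) σ' := Det.ite (by rwa [if_pos hs])

theorem Det.ite_neg {p q : Prog} {σ σ' : Store} {T x : ℕ} {s : Top} (hs : topOf (σ x) ≠ s)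
    (h : Det q σ T σ') : Det (.ite x s p q) σ (T + 1) σ' := Det.ite (by rwa [if_neg hs])

theorem Impl.callRegs (B : QPTAlg) {ρ : Regs} {sec M : ℕ} (h0 : ρ.sec = ones sec) (hO : ρ.O = [])
    (hsec : sec ≤ M) (hA1 : ρ.A1.length ≤ M) (hA2 : ρ.A2.length ≤ M)
    (hM : B.time.eval (sec + ρ.A1.length + ρ.A2.length) ≤ M) :
    Impl (callProg B) ρ.store (callTime B M) (B.exec sec ρ.A1 ρ.A2)
      fun out => { ρ with A1 := [], A2 := [], O := out }.store := by
  have := Impl.call B (σ := ρ.store) (M := M) (sec := sec) (by simp [h0, ones]) rfl rfl (by simp [hO])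
    (fun r hr => Regs.store_high _ (by omega)) hsec (by simpa) (by simpa) (by simpa)
  simpa using this

/-! ### Programs that sample keys and assemble the input of the adversary -/

section
variable {W : WeaklyVerifiablePuzzle} {A : QPTAlg} {sec n t κ π β L α M : ℕ}

theorem Sizes.all_newKey (h : Sizes W A sec n t κ π β L α M) :
    All (W.newKey sec) fun k => k.length ≤ κ :=
  (W.CheckGen.all_exec sec [] []).bind fun out hout => .pure
    ((bitsOf_length_le out).trans (hout.trans h.checkGen))

theorem Sizes.all_sampleKeys (h : Sizes W A sec n t κ π β L α M) (j : ℕ) :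
    All (sampleKeys W sec j) fun P => P.length = j ∧ ∀ k ∈ P, k.length ≤ κ := by
  refine (All.foldlM (P := fun l P => P.length + l.length = j ∧ ∀ k ∈ P, k.length ≤ κ)
    (fun _ l P hP => h.all_newKey.bind fun k hk => .pure ?_) _ _ (by simp)).mono fun P hP => by
      simpa using hP
  simp only [List.length_cons, List.mem_cons] at hP ⊢
  exact ⟨by omega, fun k' hk' => hk'.elim (fun e => e ▸ hk) (hP.2 k')⟩

theorem Sizes.keysCells_le (h : Sizes W A sec n t κ π β L α M) {ks : List (List Bool)}
    (hl : ks.length ≤ n + 1) (hk : ∀ k ∈ ks, k.length ≤ κ) : (keysCells ks).length ≤ M :=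
  (length_keysCells hk).trans ((Nat.mul_le_mul_right _ hl).trans h.keys_le)

/-- Sample a key, and push it onto stack `x`. -/
noncomputable def keyProg (W : WeaklyVerifiablePuzzle) (x : ℕ) : Prog :=
  .seq (callProg W.CheckGen) (pushKey 7 x)

noncomputable def keyTime (W : WeaklyVerifiablePuzzle) (M : ℕ) : ℕ :=
  callTime W.CheckGen M + 17 * M + 14

theorem keyProg_impl (h : Sizes W A sec n t κ π β L α M) {ρ : Regs} (h0 : ρ.sec = ones sec)
    (hA1 : ρ.A1 = []) (hO : ρ.O = []) (hA2 : ρ.A2 = []) {x : ℕ} (hx : x = 8 ∨ x = 19) :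
    Impl (keyProg W x) ρ.store (keyTime W M) (W.newKey sec)
      fun k => Function.update ρ.store x (keyCells k ++ ρ.store x) := by
  rcases ρ with ⟨_, X, Y, OUT, _, _, P, S, Q, R1, R2, C, ANS, _, OK, BLK, J, KJ, DONE, C1, C2, U, V⟩
  dsimp only at h0 hA1 hO hA2
  subst h0 hA1 hO hA2
  refine Impl.seq_le (T' := 17 * M + 13) (W.CheckGen.all_exec sec [] [])
    (Impl.callRegs W.CheckGen (M := M) rfl rfl h.sec_le (by simp) (by simp)
      (by simpa using h.checkGen.trans h.key_le)) (fun out hout => ?_) (by simp only [keyTime]; omega)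
  refine Det.impl (Det.congr (Det.pushKey (M := M) (by decide) (by decide) (by omega) (by omega)
    (by omega) rfl rfl (by simpa using hout.trans (h.checkGen.trans h.key_le))) ?_ le_rfl)
  rcases hx with rfl | rfl <;> simp

/-- Sample keys for the tuples, as many as stack `18` says. -/
noncomputable def sampleKeysProg (W : WeaklyVerifiablePuzzle) : Prog :=
  .seq (copyBits 18 22) (forLoop 22 (keyProg W 8))

noncomputable def sampleKeysTime (W : WeaklyVerifiablePuzzle) (M : ℕ) : ℕ :=
  19 * M + 11 + M * (keyTime W M + 3)

theorem sampleKeysProg_impl (h : Sizes W A sec n t κ π β L α M) {ρ : Regs} {j : ℕ}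
    (h0 : ρ.sec = ones sec) (hA1 : ρ.A1 = []) (hO : ρ.O = []) (hA2 : ρ.A2 = []) (hP : ρ.P = [])
    (hC2 : ρ.C2 = []) (hJ : ρ.J = ones j) (hj : j ≤ M) :
    Impl (sampleKeysProg W) ρ.store (sampleKeysTime W M) (sampleKeys W sec j)
      fun P => { ρ with P := keysCells P }.store := by
  rcases ρ with ⟨_, X, Y, OUT, _, _, _, S, Q, R1, R2, C, ANS, _, OK, BLK, _, KJ, DONE, C1, _, U, V⟩
  dsimp only at h0 hA1 hO hA2 hP hC2 hJ
  subst h0 hA1 hO hA2 hP hC2 hJ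
  have h1 := Det.copyBits (σ := (Regs.mk (ones sec) X Y OUT [] [] [] S Q R1 R2 C ANS [] OK BLK (ones j)
    KJ DONE C1 [] U V).store) (x := 18) (y := 22) (M := M) (by decide) (by decide)
    (by decide) (by decide) (by decide) rfl rfl (by simpa [ones] using hj) (by simpa using ones_bits j)
  simp only [Regs.store_C2, Regs.store_J, List.append_nil, Regs.update_C2] at h1
  have h2 := Impl.forLoop (x := 22) (p := keyProg W 8) (T := keyTime W M) (α := List (List Bool))
    (e := fun P => (Regs.mk (ones sec) X Y OUT [] [] (keysCells P) S Q R1 R2 C ANS [] OK BLK (ones j)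
      KJ DONE C1 [] U V).store) (P := fun _ _ => True)
    (f := fun P => do let k ← W.newKey sec; pure (k :: P)) (fun _ _ _ => All.trivial _)
    (fun k P _ => by
      simp only [Regs.update_C2]
      refine Impl.map (h := fun k => k :: P) (All.trivial _)
        (keyProg_impl h rfl rfl rfl rfl (.inl rfl)) fun k _ => ?_
      simp [keysCells]) j [] True.intro
  simp only [Regs.update_C2] at h2
  refine Det.seq_impl_le h1 h2 ?_
  have : j * (keyTime W M + 3) ≤ M * (keyTime W M + 3) := Nat.mul_le_mul_right _ hj
  simp only [sampleKeysTime]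
  omega

/-- Append a tuple to stack `12`. -/
noncomputable def tupleProg (W : WeaklyVerifiablePuzzle) : Prog :=
  .seq (genAll W 8) (.seq (.seq (unframeTo 17 7) (frameOn 7 11)) (.seq (genAll W 9)
    (.seq (moveRev 11 13) (frameOn 13 12))))

noncomputable def tupleTime (W : WeaklyVerifiablePuzzle) (M : ℕ) : ℕ :=
  2 * genAllTime W M + 40 * M + 40

theorem Sizes.all_puzzles (h : Sizes W A sec n t κ π β L α M) {ks : List (List Bool)}
    (hl : ks.length ≤ n) (hk : ∀ k ∈ ks, k.length ≤ κ) :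
    All (ks.mapM (W.newPuzzle sec)) fun ps => (encode ps).length ≤ n * (2 * π + 1) :=
  (All.mapM (P := fun k => k.length ≤ κ) (Q := fun p => p.length ≤ π)
    (fun _ hk => h.all_puzzleGen hk) ks hk).mono fun _ hps =>
    (length_encode hps.2).trans (Nat.mul_le_mul_right _ (hps.1.trans_le hl))

theorem Sizes.tuple_length (h : Sizes W A sec n t κ π β L α M) {p₁ p₂ : List (List Cell)}
    {B : List Cell} (h₁ : (encode p₁).length ≤ n * (2 * π + 1))
    (h₂ : (encode p₂).length ≤ n * (2 * π + 1)) (hB : B.length ≤ β) :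
    (encode (p₁ ++ (unframe B).1 :: p₂)).length ≤ L := by
  have h3 := length_unframe B
  have h4 := h.tuple
  rw [encode_append, show encode ((unframe B).1 :: p₂) = frame (unframe B).1 ++ encode p₂ from rfl]
  simp only [List.length_append, length_frame]
  rw [mul_assoc, two_mul] at h4
  omega

theorem Sizes.all_tupleStep (h : Sizes W A sec n t κ π β L α M) {Ps Ss : List (List Bool)}
    (hP : Ps.length ≤ n) (hS : Ss.length ≤ n) (hkP : ∀ k ∈ Ps, k.length ≤ κ)
    (hkS : ∀ k ∈ Ss, k.length ≤ κ) {a : List Cell × List Cell} (ha : a.2.length ≤ β) :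
    All (tupleStep W sec Ps Ss a) fun a' => a'.1.length ≤ a.1.length + (2 * L + 1) ∧
      a'.2.length ≤ β :=
  (h.all_puzzles hP hkP).bind fun p₁ h₁ => (h.all_puzzles hS hkS).bind fun p₂ h₂ => .pure <| by
    have := h.tuple_length h₁ h₂ ha
    have h3 := length_unframe a.2
    simp only [List.length_append, length_frame]
    omega

/-- The puzzles for `Ps`, the given puzzle and the puzzles for `Ss` pile up in reverse on stack 11.
Moving them to stack 13 restores the order, and framing them onto stack 12 reverses again, now
together with the earlier tuples. -/
theorem tupleProg_impl (h : Sizes W A sec n t κ π β L α M) {ρ : Regs} {Ps Ss : List (List Bool)}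
    {a : List Cell × List Cell}
    (h0 : ρ.sec = ones sec) (hA1 : ρ.A1 = []) (hO : ρ.O = []) (hQ : ρ.Q = []) (hA2 : ρ.A2 = [])
    (hR1 : ρ.R1 = []) (hR2 : ρ.R2 = a.1.reverse) (hC : ρ.C = []) (hBLK : ρ.BLK = a.2)
    (hP : ρ.P = keysCells Ps) (hS : ρ.S = keysCells Ss) (hlP : Ps.length ≤ n) (hlS : Ss.length ≤ n)
    (hkP : ∀ k ∈ Ps, k.length ≤ κ) (hkS : ∀ k ∈ Ss, k.length ≤ κ) (ha : a.2.length ≤ β) :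
    Impl (tupleProg W) ρ.store (tupleTime W M) (tupleStep W sec Ps Ss a)
      fun a' => { ρ with R2 := a'.1.reverse, BLK := a'.2 }.store := by
  rcases ρ with ⟨_, X, Y, OUT, _, _, _, _, _, _, _, _, ANS, _, OK, _, J, KJ, DONE, C1, C2, U, V⟩
  dsimp only at h0 hA1 hO hQ hA2 hR1 hR2 hC hP hS hBLK
  subst h0 hA1 hO hQ hA2 hR1 hR2 hC hP hS hBLK
  have h3 := length_unframe a.2
  have hn := h.tuple
  have hL := h.tuple_le
  refine Impl.seq_le (T' := genAllTime W M + 40 * M + 39) (h.all_puzzles hlP hkP)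
    (genAll_impl h (.inl rfl) rfl rfl rfl rfl rfl rfl hkP (h.keysCells_le (by omega) hkP))
    (fun p₁ hp₁ => ?_) (by simp only [tupleTime]; omega)
  have g1 := Det.seq
    (Det.unframeTo (σ := (Regs.mk (ones sec) X Y OUT [] [] (keysCells Ps) (keysCells Ss) []
      ((encode p₁).reverse ++ []) a.1.reverse [] ANS [] OK a.2 J KJ DONE C1 C2 U V).store) (x := 17)
      (y := 7) (M := M) (by decide) (by decide) (by decide) (by decide) (by decide) rfl rfl rfl
      (by simpa using ha.trans h.block_le))
    (Det.frameOn (x := 7) (y := 11) (M := M) (by decide) (by decide) (by decide) rfl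
      (by have := h.block_le; simp; omega))
  simp only [Regs.update_BLK, Regs.update_O, Regs.update_R1, Regs.store_BLK, Regs.store_O,
    Regs.store_R1] at g1
  refine Det.seq_impl_le g1 (Impl.seq_le (T' := 20 * M + 20) (h.all_puzzles hlS hkS)
    (genAll_impl h (.inr (.inl rfl)) rfl rfl rfl rfl rfl rfl hkS (h.keysCells_le (by omega) hkS))
    (fun p₂ hp₂ => ?_) le_rfl) (by omega)
  have hlen := h.tuple_length hp₁ hp₂ ha
  refine Det.impl (Det.congr (Det.seq (Det.moveRev (x := 11) (y := 13) (M := M) (by decide)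
    (by decide) (by decide) rfl ?_) (Det.frameOn (x := 13) (y := 12) (M := M) (by decide)
    (by decide) (by decide) rfl ?_)) ?_ (by omega))
  · rw [encode_append, show encode ((unframe a.2).1 :: p₂) = frame (unframe a.2).1 ++ encode p₂
      from rfl] at hlen
    simp at hlen ⊢
    omega
  · rw [encode_append, show encode ((unframe a.2).1 :: p₂) = frame (unframe a.2).1 ++ encode p₂
      from rfl] at hlen
    simp at hlen ⊢
    omega
  · rw [encode_append, show encode ((unframe a.2).1 :: p₂) = frame (unframe a.2).1 ++ encode p₂
      from rfl]
    simp
end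
-- Programs that verify answers and run the adversary once
section
variable {W : WeaklyVerifiablePuzzle} {A : QPTAlg} {sec n t κ π β L α M : ℕ}

/-- Verify the first answers on stack `14` with the keys on stack `src`; the verdict is kept on stack
`16`. -/
noncomputable def verAll (W : WeaklyVerifiablePuzzle) (src : ℕ) : Prog :=
  .seq (copyBits src 10) (.loop 10 .one (.seq (.seq (.seq (.instr (.pop 10)) (unframeTo 10 6))
    (unframeTo 14 15)) (.seq (callProg W.Ver) (.seq (.ite 7 .one .skip (.seq (.instr (.pop 16))
      (.instr (.push 16 false)))) (clear 7)))))

noncomputable def verTime (W : WeaklyVerifiablePuzzle) (M : ℕ) : ℕ :=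
  19 * M + 11 + M * (callTime W.Ver M + 29 * M + 40)

theorem verStep_eq (v : Bool × List Cell) (k : List Bool) : verStep W sec v k =
    W.Ver.exec sec (k.map .bit) (unframe v.2).1 >>= fun out =>
      pure (v.1 && decide (topOf out = .one), (unframe v.2).2) := by
  simp [verStep, WeaklyVerifiablePuzzle.accept]

theorem all_verStep (v : Bool × List Cell) (k : List Bool) :
    All (verStep W sec v k) fun v' => v'.2.length ≤ v.2.length :=
  (All.trivial _).bind fun _ _ => .pure (by have := length_unframe v.2; dsimp only; omega)

theorem all_verSteps (l : List (List Bool)) (v : Bool × List Cell) :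
    All (l.foldlM (verStep W sec) v) fun v' => v'.2.length ≤ v.2.length :=
  All.foldlM (P := fun _ v' => v'.2.length ≤ v.2.length)
    (fun k _ v' hv' => (all_verStep v' k).mono fun _ h => h.trans hv') _ _ le_rfl

/-- The bit on stack 16 is overwritten by `0` at a rejection and left alone otherwise, so it becomes
the conjunction of all verdicts. The loop does not stop at a rejection, so stack 14 is left with
exactly the answers that are not yet examined. -/
theorem verAll_impl (h : Sizes W A sec n t κ π β L α M) {ρ : Regs} {src : ℕ}
    {ks : List (List Bool)} {v : Bool × List Cell} (hsrc : src = 8 ∨ src = 19)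
    (hs : ρ.store src = keysCells ks) (h0 : ρ.sec = ones sec) (hA1 : ρ.A1 = []) (hO : ρ.O = [])
    (hQ : ρ.Q = []) (hA2 : ρ.A2 = []) (hOK : ρ.OK = [.bit v.1]) (hANS : ρ.ANS = v.2)
    (hk : ∀ k ∈ ks, k.length ≤ κ) (hl : (keysCells ks).length ≤ M) (hv : v.2.length ≤ α) :
    Impl (verAll W src) ρ.store (verTime W M) (ks.foldlM (verStep W sec) v)
      fun v' => { ρ with OK := [.bit v'.1], ANS := v'.2 }.store := by
  have h1 := Det.copyBits (σ := ρ.store) (x := src) (y := 10) (M := M) (by omega) (by omega)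
    (by decide) (by decide) (by omega) rfl rfl (by rwa [hs]) (by rw [hs]; exact keysCells_bits ks)
  rw [hs] at h1
  clear hs
  rcases ρ with ⟨_, X, Y, OUT, _, _, P, S, _, R1, R2, C, _, _, _, BLK, J, KJ, DONE, C1, C2, U, V⟩
  dsimp only at h0 hA1 hO hQ hA2 hOK hANS
  subst h0 hA1 hO hQ hA2 hOK hANS
  simp only [Regs.store_Q, List.append_nil, Regs.update_Q] at h1
  have hα := h.answer_le
  let e (l : List (List Bool)) (v : Bool × List Cell) : Store :=
    (Regs.mk (ones sec) X Y OUT [] [] P S (keysCells l) R1 R2 C v.2 [] [.bit v.1]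
      BLK J KJ DONE C1 C2 U V).store
  have h2 := Impl.loop (x := 10) (s := .one) (p := .seq (.seq (.seq (.instr (.pop 10))
      (unframeTo 10 6)) (unframeTo 14 15)) (.seq (callProg W.Ver) (.seq (.ite 7 .one .skip
      (.seq (.instr (.pop 16)) (.instr (.push 16 false)))) (clear 7))))
    (T := callTime W.Ver M + 29 * M + 39) (e := e) (f := verStep W sec)
    (P := fun l v => (∀ k ∈ l, k.length ≤ κ) ∧ (keysCells l).length ≤ M ∧ v.2.length ≤ α)
    (fun a _ => topOf_keysCells_nil) (fun i l a _ => topOf_keysCells_cons i l)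
    (fun i l a hh => (all_verStep a i).mono fun p hp => ⟨fun k hk => hh.1 k (by simp [hk]), by
      have := hh.2.1; rw [keysCells_cons] at this; simp at this; omega, hp.trans hh.2.2⟩)
    (fun k l v hh => by
      obtain ⟨hh1, hlen, hv⟩ := hh
      have hu := length_unframe v.2
      rw [keysCells_cons] at hlen
      simp only [List.length_cons, List.length_append] at hlen
      have hk := hh1 k (by simp)
      have g1 := Det.pop (e (k :: l) v) 10
      simp only [e, Regs.store_Q, keysCells_cons, List.tail_cons, Regs.update_Q] at g1
      have g2 := (g1.seq (Det.unframeTo (x := 10) (y := 6) (M := M) (by decide) (by decide)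
        (by decide) (by decide) (by decide) rfl rfl rfl (by simp; omega))).seq
        (Det.unframeTo (x := 14) (y := 15) (M := M) (by decide) (by decide)
        (by decide) (by decide) (by decide) rfl rfl rfl (by simp; omega))
      simp only [Regs.store_Q, unframe_frame, Regs.update_Q, Regs.update_A1, Regs.store_ANS,
        Regs.update_ANS, Regs.update_A2] at g2
      have htime : W.Ver.time.eval (sec + k.length + (unframe v.2).1.length) ≤ M :=
        (eval_mono _ (by omega)).trans h.ver
      simp only [e, keysCells_cons]
      rw [verStep_eq]
      refine Det.seq_impl_le g2 (Impl.seq_le (T' := 7 * M + 10)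
        (W.Ver.all_exec sec (k.map .bit) (unframe v.2).1)
        (Impl.callRegs W.Ver (M := M) rfl rfl h.sec_le (by simpa using hk.trans h.key_le)
        (by dsimp only; omega) (by simpa using htime)) (fun out hout => ?_) le_rfl) (by omega)
      simp only [List.length_map] at hout
      have g3 : Det (.ite 7 .one .skip (.seq (.instr (.pop 16)) (.instr (.push 16 false))))
          (Regs.mk (ones sec) X Y OUT [] out P S (keysCells l) R1 R2 C (unframe v.2).2 [] [.bit v.1]
          BLK J KJ DONE C1 C2 U V).store 4
          (Regs.mk (ones sec) X Y OUT [] out P S (keysCells l) R1 R2 C (unframe v.2).2 []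
            [.bit (v.1 && decide (topOf out = .one))] BLK J KJ DONE C1 C2 U V).store := by
        by_cases ho : topOf out = .one
        · refine Det.congr (Det.ite_pos ho (Det.skip _)) ?_ (by omega)
          simp [ho]
        · refine Det.congr (Det.ite_neg ho (Det.seq (Det.pop _ 16) (Det.push _ 16 false))) ?_ le_rfl
          simp [ho]
      refine Det.impl (Det.congr (g3.seq (Det.clear (x := 7) (M := M) (by decide) rfl
        (by simpa using hout.trans htime))) ?_ (by omega))
      simp) ks v ⟨hk, hl, hv⟩
  have h3 := h1.seq_impl h2
  refine Impl.congr (All.trivial _) h3 (fun v _ => ?_) ?_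
  · simp [e, keysCells]
  · have : ks.length * (callTime W.Ver M + 29 * M + 39 + 1) ≤
        M * (callTime W.Ver M + 29 * M + 40) :=
      Nat.mul_le_mul ((length_le_keysCells ks).trans hl) (by omega)
    simp only [verTime]
    omega

/-- `p` appends `1^k` to stack `x`, when the security parameter is `sec`. -/
def Pushes (p : Prog) (sec T x k : ℕ) : Prop :=
  ∀ σ : Store, σ 0 = ones sec → σ 4 = [] → σ 5 = [] → σ 10 = [] → σ 13 = [] →
    Det p σ T (Function.update σ x (ones k ++ σ x))

noncomputable def attemptProg (W : WeaklyVerifiablePuzzle) (A : QPTAlg) (pt : Prog) : Prog :=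
  .seq (sampleKeysProg W) (.seq pt (.seq (forLoop 22 (tupleProg W)) (.seq (moveRev 12 6)
    (.seq (callProg A) (.seq (.seq (moveOn 7 14) (.instr (.push 16 true)))
      (.seq (verAll W 8) (clear 8)))))))

noncomputable def attemptTime (W : WeaklyVerifiablePuzzle) (A : QPTAlg) (M : ℕ) : ℕ :=
  sampleKeysTime W M + M + M * (tupleTime W M + 3) + callTime A M + verTime W M + 40 * M + 40

theorem Sizes.all_tuples (h : Sizes W A sec n t κ π β L α M) {Ps Ss : List (List Bool)}
    (hP : Ps.length ≤ n) (hS : Ss.length ≤ n) (hkP : ∀ k ∈ Ps, k.length ≤ κ)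
    (hkS : ∀ k ∈ Ss, k.length ≤ κ) {B : List Cell} (hB : B.length ≤ β) :
    All ((List.replicate t ()).foldlM (fun a _ => tupleStep W sec Ps Ss a) ([], B)) fun a =>
      a.1.length ≤ t * (2 * L + 1) ∧ a.2.length ≤ β := by
  refine (All.foldlM (P := fun l a => a.1.length + l.length * (2 * L + 1) ≤ t * (2 * L + 1) ∧
    a.2.length ≤ β) (fun _ l a ha => (h.all_tupleStep hP hS hkP hkS ha.2).mono fun a' ha' =>
      ⟨?_, ha'.2⟩) _ _ (by simpa using hB)).mono fun a ha => by simpa using ha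
  have := ha.1
  simp only [List.length_cons] at this
  rw [Nat.add_mul] at this
  omega

theorem Sizes.all_adversary (h : Sizes W A sec n t κ π β L α M) {x : List Cell}
    (hx : x.length ≤ t * (2 * L + 1)) :
    A.time.eval (sec + x.length) ≤ α ∧ All (A.exec sec x []) fun ans => ans.length ≤ α := by
  have : A.time.eval (sec + x.length) ≤ α := (eval_mono _ (by omega)).trans h.adversary
  exact ⟨this, (A.all_exec sec x []).mono fun ans hans => hans.trans (by simpa using this)⟩

theorem Sizes.all_attempt (h : Sizes W A sec n t κ π β L α M) {j : ℕ} (hj : j ≤ n)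
    {Ss : List (List Bool)} (hS : Ss.length ≤ n) (hkS : ∀ k ∈ Ss, k.length ≤ κ) {B : List Cell}
    (hB : B.length ≤ β) : All (attempt W A sec t j Ss B) fun r =>
      r.2.1.length ≤ α ∧ r.2.2.length ≤ β :=
  (h.all_sampleKeys j).bind fun _ hP =>
    (h.all_tuples (hP.1.trans_le hj) hS hP.2 hkS hB).bind fun _ ha =>
      (h.all_adversary ha.1).2.bind fun _ hans => (all_verSteps _ _).bind fun _ hv =>
        .pure ⟨hv.trans hans, ha.2⟩

theorem attemptProg_impl (h : Sizes W A sec n t κ π β L α M) {pt : Prog}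
    (hpt : Pushes pt sec M 22 t) {ρ : Regs} {j : ℕ} (hj : j ≤ n) {Ss : List (List Bool)}
    {B : List Cell} (h0 : ρ.sec = ones sec) (hA1 : ρ.A1 = []) (hO : ρ.O = [])
    (hQ : ρ.Q = []) (hA2 : ρ.A2 = []) (hP : ρ.P = []) (hS : ρ.S = keysCells Ss)
    (hR1 : ρ.R1 = []) (hR2 : ρ.R2 = []) (hC : ρ.C = []) (hOK : ρ.OK = []) (hANS : ρ.ANS = [])
    (hBLK : ρ.BLK = B) (hJ : ρ.J = ones j) (hC2 : ρ.C2 = [])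
    (hlS : Ss.length ≤ n) (hkS : ∀ k ∈ Ss, k.length ≤ κ) (hB : B.length ≤ β) :
    Impl (attemptProg W A pt) ρ.store (attemptTime W A M) (attempt W A sec t j Ss B)
      fun r => { ρ with OK := [.bit r.1], ANS := r.2.1, BLK := r.2.2 }.store := by
  rcases ρ with ⟨_, X, Y, OUT, _, _, _, _, _, _, _, _, _, _, _, B, _, KJ, DONE, C1, _, U, V⟩
  dsimp only at h0 hA1 hO hQ hA2 hP hS hR1 hR2 hC hOK hANS hBLK hJ hC2
  subst h0 hA1 hO hQ hA2 hP hS hR1 hR2 hC hOK hANS hBLK hJ hC2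
  have ht : t * (tupleTime W M + 3) ≤ M * (tupleTime W M + 3) := Nat.mul_le_mul_right _ h.t_le
  refine Impl.seq_le (T' := M + M * (tupleTime W M + 3) + callTime A M + verTime W M + 40 * M + 39)
    (h.all_sampleKeys j)
    (sampleKeysProg_impl h rfl rfl rfl rfl rfl rfl rfl (hj.trans h.n_le)) (fun Ps hPs => ?_)
    (by simp only [attemptTime]; omega)
  obtain ⟨hlP, hkP⟩ := hPs
  have hlP' : Ps.length ≤ n := hlP.trans_le hj
  dsimp only
  have g1 := hpt (Regs.mk (ones sec) X Y OUT [] [] (keysCells Ps) (keysCells Ss) [] [] [] [] [] [] []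
    B (ones j) KJ DONE C1 [] U V).store rfl rfl rfl rfl rfl
  simp only [Regs.store_C2, List.append_nil, Regs.update_C2] at g1
  have g2 := Impl.forLoop (x := 22) (p := tupleProg W) (T := tupleTime W M)
    (α := List Cell × List Cell)
    (e := fun a => (Regs.mk (ones sec) X Y OUT [] [] (keysCells Ps) (keysCells Ss) [] [] a.1.reverse
      [] [] [] [] a.2 (ones j) KJ DONE C1 [] U V).store) (P := fun _ a => a.2.length ≤ β)
    (f := tupleStep W sec Ps Ss)
    (fun _ a ha => (h.all_tupleStep hlP' hlS hkP hkS ha).mono fun _ h => h.2)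
    (fun k a ha => by
      simp only [Regs.update_C2]
      exact tupleProg_impl h rfl rfl rfl rfl rfl rfl rfl rfl rfl rfl rfl hlP' hlS hkP hkS ha)
    t ([], B) hB
  simp only [Regs.update_C2, List.reverse_nil] at g2
  refine Det.seq_impl_le g1 (Impl.seq_le (T' := callTime A M + verTime W M + 40 * M + 30)
    (h.all_tuples hlP' hlS hkP hkS hB) g2 (fun a ha => ?_) le_rfl) (by omega)
  have haM := ha.1.trans h.input_le
  have g3 := Det.moveRev (σ := (Regs.mk (ones sec) X Y OUT [] [] (keysCells Ps) (keysCells Ss) [] []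
      a.1.reverse [] [] [] [] a.2 (ones j) KJ DONE C1 [] U V).store) (x := 12) (y := 6) (M := M)
      (by decide) (by decide) (by decide) rfl (by simpa using haM)
  simp only [Regs.update_R2, Regs.update_A1, Regs.store_R2, Regs.store_A1, List.reverse_reverse,
    List.append_nil] at g3
  refine Det.seq_impl_le g3 (Impl.seq_le (T' := verTime W M + 30 * M + 20)
    (h.all_adversary ha.1).2 (Impl.callRegs A (M := M) rfl rfl h.sec_le haM (by simp)
      (by simpa using (h.all_adversary ha.1).1.trans h.answer_le)) (fun ans hans => ?_) le_rfl)
    (by omega)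
  have g4 := (Det.moveOn (σ := (Regs.mk (ones sec) X Y OUT [] ans (keysCells Ps) (keysCells Ss) []
      [] [] [] [] [] [] a.2 (ones j) KJ DONE C1 [] U V).store) (x := 7) (y := 14) (M := M)
      (by decide) (by decide) (by decide) (by decide) (by decide) rfl rfl
      (by simpa using hans.trans h.answer_le)).seq (Det.push _ 16 true)
  simp only [Regs.update_O, Regs.update_ANS, Regs.store_O, Regs.store_ANS, Regs.update_OK,
    Regs.store_OK, List.append_nil] at g4
  refine Det.seq_impl_le g4 (Impl.seq_le (T' := 7 * M + 4) (All.trivial _)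
    (verAll_impl h (v := (true, ans)) (.inl rfl) rfl rfl rfl rfl rfl rfl rfl rfl hkP
      (h.keysCells_le (by omega) hkP) hans) (fun v _ => ?_) le_rfl) (by omega)
  refine Det.impl (Det.congr (Det.clear (x := 8) (M := M) (by decide) rfl
    (by simpa using h.keysCells_le (by omega) hkP)) ?_ le_rfl)
  simp

end
-- Programs that extend the list of keys and treat the given puzzles
section
variable {W : WeaklyVerifiablePuzzle} {A : QPTAlg} {sec n t κ π β L α M : ℕ}

def flagCells (b : Bool) : List Cell := if b then [.bit true] else []

/-- The registers between two attempts. -/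
abbrev idleRegs (sec : ℕ) (X Y OUT S BLK J DONE C1 U V : List Cell) : Regs :=
  ⟨ones sec, X, Y, OUT, [], [], [], S, [], [], [], [], [], [], [], BLK, J, [], DONE, C1, [], U, V⟩

noncomputable def selfAttemptProg (W : WeaklyVerifiablePuzzle) (A : QPTAlg) (pt : Prog) : Prog :=
  .ite 20 .one .skip (.seq (keyProg W 19) (.seq pt (.seq (forLoop 22 (genAll W 19))
    (.seq (moveRev 11 17) (.seq (attemptProg W A pt) (.seq (verAll W 19)
      (.seq (.ite 16 .one (.seq (moveOn 19 9) (.instr (.push 20 true))) .skip)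
        (.seq (clear 19) (.seq (clear 14) (.seq (.instr (.pop 16)) (clear 17)))))))))))

noncomputable def selfAttemptTime (W : WeaklyVerifiablePuzzle) (A : QPTAlg) (M : ℕ) : ℕ :=
  keyTime W M + M * (genAllTime W M + 3) + attemptTime W A M + verTime W M + 80 * M + 80

theorem Sizes.all_selfBlock (h : Sizes W A sec n t κ π β L α M) {k : List Bool} (hk : k.length ≤ κ) :
    All (selfBlock W sec t k) fun B => B.length ≤ β := by
  refine (All.foldlM (P := fun l B => B.length + l.length * (2 * π + 1) ≤ t * (2 * π + 1))
    (fun _ l B hB => (All.mapM (P := fun k => k.length ≤ κ) (Q := fun p => p.length ≤ π)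
      (fun _ hk => h.all_puzzleGen hk) [k] (by simpa using hk)).bind fun ps hps =>
      .pure ?_) _ _ (by simp)).mono fun B hB => (by simpa using hB : B.length ≤ _).trans h.block
  have := length_encode hps.2
  rw [hps.1] at this
  simp only [List.length_cons, List.length_nil, Nat.add_mul, List.length_append] at hB this ⊢
  omega

/-- The summand for the flag says that one more key may be added only as long as the flag is not
set. A phase therefore lengthens the list by at most one key, however many rounds it has. -/
theorem Sizes.all_selfAttempt (h : Sizes W A sec n t κ π β L α M) {l j : ℕ}
    {s : Bool × List (List Bool)} (hs : s.2.length + (if s.1 then 0 else 1) ≤ l)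
    (hk : ∀ k ∈ s.2, k.length ≤ κ) :
    All (selfAttempt W A sec t j s) fun s' => s'.2.length + (if s'.1 then 0 else 1) ≤ l ∧
      ∀ k ∈ s'.2, k.length ≤ κ := by
  unfold selfAttempt
  split_ifs with h1
  · exact .pure ⟨hs, hk⟩
  · refine h.all_newKey.bind fun k hk' => (All.trivial _).bind fun B _ => (All.trivial _).bind
      fun a _ => (All.trivial _).bind fun v _ => .pure ?_
    rcases v with ⟨_ | _, w⟩
    · exact ⟨hs, hk⟩
    · refine ⟨by simpa [h1] using hs, fun k₁ hk₁ => ?_⟩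
      rcases List.mem_cons.1 hk₁ with rfl | h3
      exacts [hk', hk _ h3]

theorem selfAttemptProg_impl (h : Sizes W A sec n t κ π β L α M) {pt : Prog}
    (hpt : Pushes pt sec M 22 t) {j : ℕ} (hj : j ≤ n) {s : Bool × List (List Bool)}
    (hs : s.2.length ≤ n) (hk : ∀ k ∈ s.2, k.length ≤ κ) (X Y OUT C1 U V : List Cell) :
    Impl (selfAttemptProg W A pt)
      (idleRegs sec X Y OUT (keysCells s.2) [] (ones j) (flagCells s.1) C1 U V).store
      (selfAttemptTime W A M) (selfAttempt W A sec t j s) fun s' =>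
      (idleRegs sec X Y OUT (keysCells s'.2) [] (ones j) (flagCells s'.1) C1 U V).store := by
  rcases s with ⟨_ | _, Ss⟩
  swap
  · simp only [selfAttempt, if_true]
    refine Impl.mono (T := 2) (Impl.ite_pos (by rfl) (Det.impl ?_)) ?_
    · exact Det.skip _
    simp only [selfAttemptTime]
    omega
  dsimp only at hs hk
  simp only [selfAttempt, Bool.false_eq_true, if_false, flagCells]
  have hgen : t * (genAllTime W M + 3) ≤ M * (genAllTime W M + 3) := Nat.mul_le_mul_right _ h.t_le
  refine (Impl.ite_neg (T := selfAttemptTime W A M - 1) (by simp [topOf]) ?_).mono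
    (by simp only [selfAttemptTime]; omega)
  refine Impl.seq_le (T' := M * (genAllTime W M + 3) + attemptTime W A M + verTime W M + 80 * M + 77)
    h.all_newKey (keyProg_impl h rfl rfl rfl rfl (.inr rfl)) (fun k hk' => ?_)
    (by simp only [selfAttemptTime]; omega)
  have hkk : ∀ k' ∈ [k], k'.length ≤ κ := by simpa using hk'
  have hkM : (keysCells [k]).length ≤ M := h.keysCells_le (by simp) hkk
  have hkey : keyCells k = keysCells [k] := by simp [keysCells]
  simp only [Regs.store_KJ, List.append_nil, Regs.update_KJ, hkey]
  have g1 := hpt (Regs.mk (ones sec) X Y OUT [] [] [] (keysCells Ss) [] [] [] [] [] [] [] [] (ones j)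
    (keysCells [k]) [] C1 [] U V).store rfl rfl rfl rfl rfl
  simp only [Regs.store_C2, List.append_nil, Regs.update_C2] at g1
  have g2 := Impl.forLoop (x := 22) (p := genAll W 19) (T := genAllTime W M) (α := List Cell)
    (e := fun B => (Regs.mk (ones sec) X Y OUT [] [] [] (keysCells Ss) [] B.reverse [] [] [] [] []
      [] (ones j) (keysCells [k]) [] C1 [] U V).store) (P := fun _ _ => True)
    (f := fun B => do let p ← [k].mapM (W.newPuzzle sec); pure (B ++ encode p))
    (fun _ _ _ => All.trivial _) (fun i B _ => by
      simp only [Regs.update_C2]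
      refine Impl.map (h := fun p => B ++ encode p) (All.trivial _)
        (genAll_impl h (.inr (.inr rfl)) rfl rfl rfl rfl rfl rfl hkk hkM) fun p _ => ?_
      simp) t [] True.intro
  simp only [Regs.update_C2, List.reverse_nil] at g2
  refine Det.seq_impl_le g1 (Impl.seq_le (T' := attemptTime W A M + verTime W M + 70 * M + 70)
    (h.all_selfBlock hk') g2 (fun B hB => ?_) le_rfl) (by omega)
  have g3 := Det.moveRev (σ := (Regs.mk (ones sec) X Y OUT [] [] [] (keysCells Ss) [] B.reverse [] []
      [] [] [] [] (ones j) (keysCells [k]) [] C1 [] U V).store) (x := 11) (y := 17) (M := M)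
      (by decide) (by decide) (by decide) rfl (by simpa using hB.trans h.block_le)
  simp only [Regs.update_R1, Regs.update_BLK, Regs.store_R1, Regs.store_BLK, List.reverse_reverse,
    List.append_nil] at g3
  refine Det.seq_impl_le g3 (Impl.seq_le (T' := verTime W M + 60 * M + 60)
    (h.all_attempt hj hs hk hB)
    (attemptProg_impl h hpt hj rfl rfl rfl rfl rfl rfl rfl rfl rfl rfl rfl rfl rfl rfl rfl hs hk hB)
    (fun a ha => ?_) le_rfl) (by omega)
  refine Impl.seq_le (T' := 60 * M + 50) (all_verSteps [k] (a.1, a.2.1))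
    (verAll_impl h (v := (a.1, a.2.1)) (.inr rfl) rfl rfl rfl rfl rfl rfl rfl rfl hkk hkM ha.1)
    (fun v hv => ?_) (by omega)
  have hα := h.answer_le
  have hβ := h.block_le
  rcases v with ⟨_ | _, w⟩ <;> dsimp only at hv
  · refine Det.impl (Det.congr (Det.seq (Det.ite_neg (by simp [topOf]) (Det.skip _)) (Det.seq
      (Det.clear (x := 19) (M := M) (by decide) rfl ?_) (Det.seq (Det.clear (x := 14) (M := M)
      (by decide) rfl ?_) (Det.seq (Det.pop _ 16) (Det.clear (x := 17) (M := M) (by decide) rfl ?_)))))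
      ?_ (by omega))
    · simpa using hkM
    · simp; omega
    · simp; omega
    · simp
  · refine Det.impl (Det.congr (Det.seq (Det.ite_pos rfl (Det.seq (Det.moveOn (x := 19) (y := 9)
      (M := M) (by decide) (by decide) (by decide) (by decide) (by decide) rfl rfl ?_)
      (Det.push _ 20 true))) (Det.seq
      (Det.clear (x := 19) (M := M) (by decide) rfl ?_) (Det.seq (Det.clear (x := 14) (M := M)
      (by decide) rfl ?_) (Det.seq (Det.pop _ 16) (Det.clear (x := 17) (M := M) (by decide) rfl ?_)))))
      ?_ (by omega))
    · simpa using hkM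
    · simp
    · simp; omega
    · simp; omega
    · simp [keysCells]

noncomputable def phaseProg (W : WeaklyVerifiablePuzzle) (A : QPTAlg) (pt pN : Prog) : Prog :=
  .seq pN (.seq (forLoop 21 (selfAttemptProg W A pt)) (clear 20))

noncomputable def phaseTime (W : WeaklyVerifiablePuzzle) (A : QPTAlg) (M : ℕ) : ℕ :=
  8 * M + 20 + M * (selfAttemptTime W A M + 3)

theorem Sizes.all_selfAttempts (h : Sizes W A sec n t κ π β L α M) {j N : ℕ} {Ss : List (List Bool)}
    (hk : ∀ k ∈ Ss, k.length ≤ κ) :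
    All ((List.replicate N ()).foldlM (fun s _ => selfAttempt W A sec t j s) (false, Ss)) fun s =>
      s.2.length + (if s.1 then 0 else 1) ≤ Ss.length + 1 ∧ ∀ k ∈ s.2, k.length ≤ κ :=
  All.foldlM (α := Bool × List (List Bool)) (P := fun _ s => s.2.length + (if s.1 then 0 else 1) ≤ Ss.length + 1 ∧
    ∀ k ∈ s.2, k.length ≤ κ) (fun _ _ _ hs => h.all_selfAttempt hs.1 hs.2) _ _ ⟨by simp, hk⟩

theorem Sizes.all_phase (h : Sizes W A sec n t κ π β L α M) {j N : ℕ} {Ss : List (List Bool)}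
    (hk : ∀ k ∈ Ss, k.length ≤ κ) :
    All (phase W A sec N t j Ss) fun S => S.length ≤ Ss.length + 1 ∧ ∀ k ∈ S, k.length ≤ κ :=
  (h.all_selfAttempts hk).bind fun _ hs => .pure ⟨le_of_add_le_left hs.1, hs.2⟩

theorem phaseProg_impl (h : Sizes W A sec n t κ π β L α M) {pt pN : Prog}
    (hpt : Pushes pt sec M 22 t) {N : ℕ} (hpN : Pushes pN sec M 21 N) (hN : N ≤ M) {j : ℕ}
    (hj : j ≤ n) {Ss : List (List Bool)}
    (hs : Ss.length + 1 ≤ n) (hk : ∀ k ∈ Ss, k.length ≤ κ) (X Y OUT U V : List Cell) :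
    Impl (phaseProg W A pt pN)
      (idleRegs sec X Y OUT (keysCells Ss) [] (ones j) [] [] U V).store
      (phaseTime W A M) (phase W A sec N t j Ss) fun S =>
      (idleRegs sec X Y OUT (keysCells S) [] (ones j) [] [] U V).store := by
  have g1 := hpN (idleRegs sec X Y OUT (keysCells Ss) [] (ones j) [] [] U V).store rfl rfl rfl rfl rfl
  simp only [Regs.store_C1, List.append_nil, Regs.update_C1] at g1
  have g2 := Impl.forLoop (x := 21) (p := selfAttemptProg W A pt) (T := selfAttemptTime W A M)
    (α := Bool × List (List Bool))
    (e := fun s => (idleRegs sec X Y OUT (keysCells s.2) [] (ones j) (flagCells s.1) [] U V).store)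
    (P := fun _ s => s.2.length + (if s.1 then 0 else 1) ≤ n ∧ ∀ k ∈ s.2, k.length ≤ κ)
    (f := selfAttempt W A sec t j) (fun _ _ hs => h.all_selfAttempt hs.1 hs.2) (fun i s hs => by
      simp only [Regs.update_C1]
      exact selfAttemptProg_impl h hpt hj (le_of_add_le_left hs.1) hs.2 X Y OUT _ U V)
    N (false, Ss) ⟨hs, hk⟩
  simp only [Regs.update_C1] at g2
  have : N * (selfAttemptTime W A M + 3) ≤ M * (selfAttemptTime W A M + 3) :=
    Nat.mul_le_mul_right _ hN
  refine Det.seq_impl_le g1 (Impl.seq_le (T' := 7 * M + 11) (All.trivial _) g2 (fun s _ => ?_) le_rfl)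
    (by simp only [phaseTime]; omega)
  refine Det.impl (Det.congr (Det.clear (x := 20) (M := M + 1) (by decide) rfl ?_) ?_ (by omega))
  · simp only [flagCells, Regs.store_DONE]; split_ifs <;> simp
  · simp

noncomputable def phasesProg (W : WeaklyVerifiablePuzzle) (A : QPTAlg) (pt pN : Prog) : Prog :=
  forLoop 24 (.seq (phaseProg W A pt pN) (.instr (.pop 18)))

noncomputable def phasesTime (W : WeaklyVerifiablePuzzle) (A : QPTAlg) (M : ℕ) : ℕ :=
  M * (phaseTime W A M + 5) + 1

/-- A phase lengthens the list by at most one and lowers the count by one. Their sum stays at most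
`n`, which bounds the number of puzzles in each tuple. -/
theorem Sizes.all_phases (h : Sizes W A sec n t κ π β L α M) {N v : ℕ} {a : ℕ × List (List Bool)}
    (ha : a.1 + a.2.length ≤ n) (hv : v ≤ a.1) (hk : ∀ k ∈ a.2, k.length ≤ κ) :
    All (phases W A sec N t v a) fun a' => a'.1 + a'.2.length ≤ n ∧ ∀ k ∈ a'.2, k.length ≤ κ := by
  refine (All.foldlM (P := fun l a => a.1 + a.2.length ≤ n ∧ l.length ≤ a.1 ∧
    ∀ k ∈ a.2, k.length ≤ κ) (fun _ l a ha => (h.all_phase ha.2.2).bind fun S hS => .pure ?_) _ _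
    ⟨ha, by simpa using hv, hk⟩).mono fun a ha => ⟨ha.1, ha.2.2⟩
  simp only [List.length_cons] at ha ⊢
  exact ⟨by omega, by omega, hS.2⟩

theorem phasesProg_impl (h : Sizes W A sec n t κ π β L α M) {pt pN : Prog}
    (hpt : Pushes pt sec M 22 t) {N : ℕ} (hpN : Pushes pN sec M 21 N) (hN : N ≤ M) {v : ℕ}
    {a : ℕ × List (List Bool)} (ha : a.1 + a.2.length ≤ n) (hv : v ≤ a.1)
    (hk : ∀ k ∈ a.2, k.length ≤ κ) (X Y OUT U : List Cell) :
    Impl (phasesProg W A pt pN)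
      (idleRegs sec X Y OUT (keysCells a.2) [] (ones a.1) [] [] U (ones v)).store
      (phasesTime W A M) (phases W A sec N t v a) fun a =>
      (idleRegs sec X Y OUT (keysCells a.2) [] (ones a.1) [] [] U []).store := by
  have g := Impl.forLoop (x := 24) (p := .seq (phaseProg W A pt pN) (.instr (.pop 18)))
    (T := phaseTime W A M + 2) (α := ℕ × List (List Bool))
    (e := fun a => (idleRegs sec X Y OUT (keysCells a.2) [] (ones a.1) [] [] U []).store)
    (P := fun k a => a.1 + a.2.length ≤ n ∧ k ≤ a.1 ∧ ∀ k ∈ a.2, k.length ≤ κ)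
    (f := fun a => do let S ← phase W A sec N t a.1 a.2; pure (a.1 - 1, S))
    (fun k a ha => (h.all_phase ha.2.2).bind fun S hS => .pure
      ⟨by dsimp only; omega, by dsimp only; omega, hS.2⟩) (fun k a ha => by
      simp only [Regs.update_V]
      refine Impl.seq_le (T' := 1) (All.trivial _)
        (phaseProg_impl h hpt hpN hN (by omega) (by omega) ha.2.2 X Y OUT U _) (fun S _ => ?_) le_rfl
      refine Det.impl (Det.congr (Det.pop _ 18) ?_ le_rfl)
      simp [ones]) v a ⟨ha, hv, hk⟩
  simp only [Regs.update_V] at g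
  have hn := h.n_le
  have : v * (phaseTime W A M + 5) ≤ M * (phaseTime W A M + 5) := Nat.mul_le_mul_right _ (by omega)
  rw [show phaseTime W A M + 2 + 3 = phaseTime W A M + 5 from rfl] at g
  exact g.mono (by simp only [phasesTime]; omega)

noncomputable def realAttemptProg (W : WeaklyVerifiablePuzzle) (A : QPTAlg) (pt : Prog) : Prog :=
  .ite 20 .one .skip (.seq (attemptProg W A pt) (.seq (.ite 16 .one (.seq (unframeTo 14 3)
    (.instr (.push 20 true))) .skip) (.seq (clear 14) (.instr (.pop 16)))))

noncomputable def realAttemptTime (W : WeaklyVerifiablePuzzle) (A : QPTAlg) (M : ℕ) : ℕ :=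
  attemptTime W A M + 20 * M + 30

/-- The output stack is empty as long as nothing has succeeded. This is carried along because
`unframeTo` can only write to an empty stack. -/
theorem Sizes.all_realAttempt (h : Sizes W A sec n t κ π β L α M) {j : ℕ} (hj : j ≤ n)
    {Ss : List (List Bool)} (hs : Ss.length ≤ n) (hk : ∀ k ∈ Ss, k.length ≤ κ)
    {a : Bool × List Cell × List Cell} (hB : a.2.1.length ≤ β) (ha : a.1 = false → a.2.2 = []) :
    All (realAttempt W A sec t j Ss a) fun a => a.2.1.length ≤ β ∧ (a.1 = false → a.2.2 = []) := by
  unfold realAttempt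
  split_ifs with h1
  · exact .pure ⟨hB, ha⟩
  · exact (h.all_attempt hj hs hk hB).bind fun r hr => .pure
      ⟨hr.2, fun h2 => by simp at h1; simp only at h2; simp [h2, ha h1]⟩

theorem realAttemptProg_impl (h : Sizes W A sec n t κ π β L α M) {pt : Prog}
    (hpt : Pushes pt sec M 22 t) {j : ℕ} (hj : j ≤ n) {Ss : List (List Bool)} (hs : Ss.length ≤ n)
    (hk : ∀ k ∈ Ss, k.length ≤ κ) {a : Bool × List Cell × List Cell} (hB : a.2.1.length ≤ β)
    (ha : a.1 = false → a.2.2 = []) (X Y C1 U V : List Cell) :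
    Impl (realAttemptProg W A pt)
      (idleRegs sec X Y a.2.2 (keysCells Ss) a.2.1 (ones j) (flagCells a.1) C1 U V).store
      (realAttemptTime W A M) (realAttempt W A sec t j Ss a) fun a =>
      (idleRegs sec X Y a.2.2 (keysCells Ss) a.2.1 (ones j) (flagCells a.1) C1 U V).store := by
  rcases a with ⟨_ | _, B, out⟩
  swap
  · simp only [realAttempt, if_true]
    refine Impl.mono (T := 2) (Impl.ite_pos (by rfl) (Det.impl ?_)) ?_
    · exact Det.skip _
    simp only [realAttemptTime]
    omega
  obtain rfl : out = [] := ha rfl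
  simp only [realAttempt, Bool.false_eq_true, if_false, flagCells]
  refine (Impl.ite_neg (T := realAttemptTime W A M - 1) (by simp [topOf]) ?_).mono
    (by simp only [realAttemptTime]; omega)
  refine Impl.seq_le (T' := 20 * M + 20) (h.all_attempt hj hs hk hB)
    (attemptProg_impl h hpt hj rfl rfl rfl rfl rfl rfl rfl rfl rfl rfl rfl rfl rfl rfl rfl hs hk hB)
    (fun r hr => ?_) (by simp only [realAttemptTime]; omega)
  have hα := h.answer_le
  rcases r with ⟨_ | _, w, B'⟩ <;> dsimp only at hr
  · refine Det.impl (Det.congr (Det.seq (Det.ite_neg (by simp [topOf]) (Det.skip _)) (Det.seq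
      (Det.clear (x := 14) (M := M) (by decide) rfl ?_) (Det.pop _ 16))) ?_ (by omega))
    · simp; omega
    · simp
  · have hu := length_unframe w
    refine Det.impl (Det.congr (Det.seq (Det.ite_pos rfl (Det.seq (Det.unframeTo (x := 14) (y := 3)
      (M := M) (by decide) (by decide) (by decide) (by decide) (by decide) rfl rfl rfl ?_)
      (Det.push _ 20 true))) (Det.seq
      (Det.clear (x := 14) (M := M) (by decide) rfl ?_) (Det.pop _ 16))) ?_ (by omega))
    · simp; omega
    · simp; omega
    · simp

end
-- Programs for the random position and for the whole reduction
section
variable {W : WeaklyVerifiablePuzzle} {A : QPTAlg} {sec n t κ π β L α M : ℕ}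

/-- Increment the number on stack `23` modulo the sum of the stacks `23` and `24`, plus one. -/
def incProg : Prog := .ite 24 .one (.instr (.move 24 23)) (.loop 23 .one (.instr (.move 23 24)))

/-- The stacks 23 and 24 hold `x` and `n' - x`, so the modulus is stored implicitly. Moving one mark
adds one. If stack 24 is empty then `x = n'`, and moving all marks back yields `0`. -/
theorem incProg_det {ρ : Regs} {n' x : ℕ} (hx : x ≤ n') (hU : ρ.U = ones x)
    (hV : ρ.V = ones (n' - x)) (hn : n' ≤ M) : Det incProg ρ.store (2 * M + 5)
      { ρ with U := ones ((x + 1) % (n' + 1)), V := ones (n' - (x + 1) % (n' + 1)) }.store := by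
  rcases ρ with ⟨sec, X, Y, OUT, A1, O, P, S, Q, R1, R2, C, ANS, A2, OK, BLK, J, KJ, DONE, C1, C2, _, _⟩
  dsimp only at hU hV
  subst hU hV
  obtain h | h := Nat.lt_or_ge x n'
  · obtain ⟨y, hy⟩ : ∃ y, n' - x = y + 1 := ⟨n' - x - 1, by omega⟩
    refine Det.congr (Det.ite_pos (by simp [hy, ones_succ, topOf]) (Det.move (c := .bit true)
      (w := ones y) (by simp [hy, ones_succ]) (by decide))) ?_ (by omega)
    rw [Nat.mod_eq_of_lt (by omega), show n' - (x + 1) = y by omega]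
    simp [ones_succ]
  · obtain rfl : x = n' := by omega
    have := Det.loop (x := 23) (s := .one) (p := .instr (.move 23 24)) (T := 1) (α := ℕ) (ι := Unit)
      (e := fun l y => (Regs.mk sec X Y OUT A1 O P S Q R1 R2 C ANS A2 OK BLK J KJ DONE C1 C2
        (ones l.length) (ones y)).store) (f := fun y _ => y + 1) (P := fun _ _ => True)
      (fun _ _ => by simp [ones, topOf]) (fun i l a _ => by simp [ones_succ, topOf])
      (fun _ _ _ _ => True.intro) (fun i l a _ => by
        refine Det.congr (Det.move (c := .bit true) (w := ones l.length) (by simp [ones_succ])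
          (by decide)) ?_ le_rfl
        simp [ones_succ]) (List.replicate x ()) 0 True.intro
    have hf : ∀ k, (List.replicate k ()).foldl (fun y _ => y + 1) 0 = k := by
      intro k
      induction k with
      | zero => rfl
      | succ k ih => rw [List.replicate_succ', List.foldl_append, ih]; rfl
    rw [hf] at this
    simp only [List.length_replicate, List.length_nil] at this
    rw [Nat.sub_self, Nat.mod_self, Nat.sub_zero]
    exact Det.congr (Det.ite_neg (by simp [topOf, ones]) this) rfl (by omega)

theorem incLoop_det {ρ : Regs} {n' x k : ℕ} (hx : x ≤ n') (hQ : ρ.Q = ones k) (hU : ρ.U = ones x)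
    (hV : ρ.V = ones (n' - x)) (hn : n' ≤ M) :
    Det (forLoop 10 incProg) ρ.store (k * (2 * M + 8) + 1)
      { ρ with Q := [], U := ones ((x + k) % (n' + 1)), V := ones (n' - (x + k) % (n' + 1)) }.store := by
  rcases ρ with ⟨sec, X, Y, OUT, A1, O, P, S, _, R1, R2, C, ANS, A2, OK, BLK, J, KJ, DONE, C1, C2, _, _⟩
  dsimp only at hQ hU hV
  subst hQ hU hV
  have := Det.forLoop (x := 10) (p := incProg) (T := 2 * M + 5) (α := ℕ)
    (e := fun x => (Regs.mk sec X Y OUT A1 O P S [] R1 R2 C ANS A2 OK BLK J KJ DONE C1 C2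
      (ones x) (ones (n' - x))).store) (f := fun x => (x + 1) % (n' + 1)) (P := fun _ x => x ≤ n')
    (fun _ x _ => Nat.le_of_lt_succ (Nat.mod_lt _ n'.succ_pos)) (fun k x hx => by
      simp only [Regs.update_Q]
      exact incProg_det hx rfl rfl hn) k x hx
  have hf : (fun x => (x + 1) % (n' + 1))^[k] x = (x + k) % (n' + 1) := by
    clear this
    induction k with
    | zero => simp [Nat.mod_eq_of_lt (Nat.lt_succ_of_le hx)]
    | succ k ih => rw [Function.iterate_succ_apply', ih, Nat.mod_add_mod, Nat.add_assoc]
  rw [hf] at this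
  simpa using this

/-- Choose a position by coin tosses; it is left on stack `23`, in unary. -/
noncomputable def indexProg (pn pm : Prog) : Prog :=
  .seq (.seq pn (.seq (.instr (.pop 24)) pm)) (forLoop 21 (.seq (.seq (copyBits 23 10)
    (forLoop 10 incProg)) (.seq (callProg coinAlg) (.seq (.ite 7 .one incProg .skip) (clear 7)))))

noncomputable def indexTime (M : ℕ) : ℕ :=
  2 * M + 6 + M * (callTime coinAlg M + 19 * M + M * (2 * M + 8) + 80 + 2 * M)

theorem all_sampleIndex (n' m : ℕ) : All (sampleIndex sec n' m) fun x => x ≤ n' :=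
  All.foldlM (P := fun _ x => x ≤ n') (fun _ _ _ _ => (All.trivial _).bind fun _ _ => .pure
    (Nat.le_of_lt_succ (Nat.mod_lt _ n'.succ_pos))) _ _ (Nat.zero_le _)

/-- Doubling modulo `n' + 1` means incrementing `x` times, with a copy of `x` on stack 10 as
counter. A toss that shows `1` adds one more increment. -/
theorem indexProg_impl {pn pm : Prog} {n₀ n' m : ℕ} (hn₀ : n' = n₀ - 1)
    (hpn : Pushes pn sec M 24 n₀) (hpm : Pushes pm sec M 21 m) (hn : n' ≤ M) (hm : m ≤ M)
    (hsec : sec ≤ M) (hM : 5 ≤ M) (X Y OUT S BLK J DONE : List Cell) :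
    Impl (indexProg pn pm) (idleRegs sec X Y OUT S BLK J DONE [] [] []).store (indexTime M)
      (sampleIndex sec n' m)
      fun x => (idleRegs sec X Y OUT S BLK J DONE [] (ones x) (ones (n' - x))).store := by
  have g1 := (hpn (idleRegs sec X Y OUT S BLK J DONE [] [] []).store rfl rfl rfl rfl rfl).seq
    ((Det.pop _ 24).seq (hpm _ rfl rfl rfl rfl rfl))
  simp only [Regs.store_V, Regs.store_C1, List.append_nil, Regs.update_V, Regs.update_C1,
    show (ones n₀).tail = ones n' by simp [ones, hn₀]] at g1
  have g2 := Impl.forLoop (x := 21) (p := .seq (.seq (copyBits 23 10) (forLoop 10 incProg))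
      (.seq (callProg coinAlg) (.seq (.ite 7 .one incProg .skip) (clear 7))))
    (T := callTime coinAlg M + 19 * M + M * (2 * M + 8) + 77 + 2 * M) (α := ℕ)
    (e := fun x => (idleRegs sec X Y OUT S BLK J DONE [] (ones x) (ones (n' - x))).store)
    (P := fun _ x => x ≤ n') (f := fun x => do
      let c ← coin sec
      pure ((2 * x + c.toNat) % (n' + 1))) (fun _ _ _ => (All.trivial _).bind fun _ _ => .pure
      (Nat.le_of_lt_succ (Nat.mod_lt _ n'.succ_pos))) (fun k x hx => by
      have e1 := (Det.copyBits (σ := (idleRegs sec X Y OUT S BLK J DONE (ones k) (ones x)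
          (ones (n' - x))).store) (x := 23) (y := 10) (M := M) (by decide) (by decide) (by decide)
          (by decide) (by decide) rfl rfl (by simp [ones]; omega) (by simpa using ones_bits x))
      simp only [Regs.store_U, Regs.store_Q, Regs.update_Q, List.append_nil] at e1
      have e2 := e1.seq (incLoop_det hx rfl rfl rfl hn)
      have hx2 : (x + x) % (n' + 1) ≤ n' := Nat.le_of_lt_succ (Nat.mod_lt _ n'.succ_pos)
      have hxM : x * (2 * M + 8) ≤ M * (2 * M + 8) := Nat.mul_le_mul_right _ (by omega)
      simp only [Regs.update_C1, coin, bind_assoc, pure_bind]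
      have hcoin : coinAlg.time.eval sec = 5 := by simp [coinAlg]
      refine Det.seq_impl_le e2 (Impl.seq_le (T' := 2 * M + 60) (coinAlg.all_exec sec [] [])
        (Impl.callRegs coinAlg (M := M) rfl rfl hsec (by simp) (by simp)
        (by simp [hcoin]; omega)) (fun out hout => ?_) le_rfl) (by omega)
      simp only [List.length_nil, Nat.add_zero, hcoin] at hout
      have hmod : ((x + x) % (n' + 1) + 1) % (n' + 1) = (2 * x + 1) % (n' + 1) := by
        rw [Nat.mod_add_mod, two_mul]
      by_cases ho : topOf out = .one
      · refine Det.impl (Det.congr (Det.seq (Det.ite_pos ho (incProg_det hx2 rfl rfl hn))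
          (Det.clear (x := 7) (M := 5) (by decide) rfl ?_)) ?_ (by omega))
        · simpa using hout
        · simp [ho, hmod]
      · refine Det.impl (Det.congr (Det.seq (Det.ite_neg ho (Det.skip _))
          (Det.clear (x := 7) (M := 5) (by decide) rfl ?_)) ?_ (by omega))
        · simpa using hout
        · simp [ho, two_mul])
    m 0 (Nat.zero_le _)
  simp only [Regs.update_C1, Nat.sub_zero] at g2
  have : m * (callTime coinAlg M + 19 * M + M * (2 * M + 8) + 77 + 2 * M + 3) ≤
      M * (callTime coinAlg M + 19 * M + M * (2 * M + 8) + 80 + 2 * M) :=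
    Nat.mul_le_mul hm (by omega)
  exact Det.seq_impl_le g1 g2 (by simp only [indexTime]; omega)

/-- The reduction. -/
noncomputable def solveProg (W : WeaklyVerifiablePuzzle) (A : QPTAlg) (pn pm pt pN : Prog) : Prog :=
  .seq (indexProg pn pm) (.seq (.seq (copyBits 23 18) (copyBits 24 18)) (.seq (phasesProg W A pt pN)
    (.seq (.seq (moveOn 1 17) pN) (forLoop 21 (realAttemptProg W A pt)))))

noncomputable def solveTime (W : WeaklyVerifiablePuzzle) (A : QPTAlg) (M : ℕ) : ℕ :=
  indexTime M + phasesTime W A M + M * (realAttemptTime W A M + 3) + 60 * M + 50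

/-- The list of remaining statements is part of the equation, so that both halting and the output
can be read off from it. -/
theorem solveProg_run {n₀ n' m N : ℕ} (hn₀ : n' = n₀ - 1) (h : Sizes W A sec (n' + 1) t κ π β L α M) {pn pm pt pN : Prog}
    (hpn : Pushes pn sec M 24 n₀) (hpm : Pushes pm sec M 21 m) (hpt : Pushes pt sec M 22 t)
    (hpN : Pushes pN sec M 21 N) (hm : m ≤ M) (hN : N ≤ M) (hM : 5 ≤ M) {X : List Cell}
    (hX : X.length ≤ β) (Y : List Cell) (μ : QMem) :
    ((startConfig (solveProg W A pn pm pt pN) sec X Y μ).run (solveTime W A M)).map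
        (fun c => (c.todo, c.store 3, c.mem)) =
      (solve W A sec n' N t m X μ).map fun r => ([], r.1, r.2) := by
  have hstart : inputStore sec X Y = (idleRegs sec X Y [] [] [] [] [] [] [] []).store := by
    funext r
    rcases r with _ | _ | _ | r
    · rfl
    · rfl
    · rfl
    · rw [inputStore, if_neg (by omega), if_neg (by omega), if_neg (by omega)]
      by_cases hr : r + 3 < 25
      · have hr' : r < 22 := by omega
        interval_cases r <;> rfl
      · exact (Regs.store_high _ (by omega)).symm
  have hN' : N * (realAttemptTime W A M + 3) ≤ M * (realAttemptTime W A M + 3) :=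
    Nat.mul_le_mul_right _ hN
  have hn := h.n_le
  -- The procedure returns the whole final store here, because the loop counters and leftover data
  -- are needed to describe it; only stack 3 matters afterwards.
  have key : Impl (solveProg W A pn pm pt pN) (inputStore sec X Y) (solveTime W A M) (do
      let x ← sampleIndex sec n' m
      let a ← phases W A sec N t (n' - x) (n', [])
      let b ← (List.replicate N ()).foldlM (fun b _ => realAttempt W A sec t a.1 a.2 b) (false, X, [])
      pure (idleRegs sec [] Y b.2.2 (keysCells a.2) b.2.1 (ones a.1) (flagCells b.1) []
        (ones x) []).store) (fun s => s) := by
    rw [hstart]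
    refine Impl.seq_le (T' := phasesTime W A M + M * (realAttemptTime W A M + 3) + 60 * M + 49)
      (all_sampleIndex n' m) (indexProg_impl hn₀ hpn hpm (by omega) hm h.sec_le hM X Y [] [] [] [] [])
      (fun x hx => ?_) (by simp only [solveTime]; omega)
    have g1 := (Det.copyBits (σ := (idleRegs sec X Y [] [] [] [] [] [] (ones x)
          (ones (n' - x))).store) (x := 23) (y := 18) (M := M) (by decide) (by decide) (by decide)
          (by decide) (by decide) rfl rfl (by simp [ones]; omega) (by simpa using ones_bits x)).seq
          (Det.copyBits (x := 24) (y := 18) (M := M) (by decide) (by decide) (by decide)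
          (by decide) (by decide) rfl rfl (by simp [ones]; omega) (by simpa using ones_bits (n' - x)))
    simp only [Regs.store_U, Regs.store_V, Regs.store_J, Regs.update_J, List.append_nil, ones_append,
      Nat.sub_add_cancel hx] at g1
    refine Det.seq_impl_le g1 (Impl.seq_le (T' := M * (realAttemptTime W A M + 3) + 20 * M + 15)
      (h.all_phases (v := n' - x) (a := (n', [])) (by simp) (Nat.sub_le _ _) (by simp))
      (phasesProg_impl h hpt hpN hN (a := (n', [])) (by simp) (Nat.sub_le _ _) (by simp) X Y []
        (ones x)) (fun a ha => ?_) le_rfl) (by omega)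
    have g2 := (Det.moveOn (σ := (idleRegs sec X Y [] (keysCells a.2) [] (ones a.1) [] []
      (ones x) []).store) (x := 1) (y := 17) (M := M) (by decide) (by decide) (by decide)
      (by decide) (by decide) rfl rfl (by simpa using hX.trans h.block_le)).seq
      (hpN _ rfl rfl rfl rfl rfl)
    simp only [Regs.store_X, Regs.store_BLK, Regs.store_C1, Regs.update_X, Regs.update_BLK,
      Regs.update_C1, List.append_nil] at g2
    have g3 := Impl.forLoop (x := 21) (p := realAttemptProg W A pt) (T := realAttemptTime W A M)
      (α := Bool × List Cell × List Cell)
      (e := fun b => (idleRegs sec [] Y b.2.2 (keysCells a.2) b.2.1 (ones a.1) (flagCells b.1) []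
        (ones x) []).store)
      (P := fun _ b => b.2.1.length ≤ β ∧ (b.1 = false → b.2.2 = []))
      (f := realAttempt W A sec t a.1 a.2)
      (fun _ b hb => h.all_realAttempt (by omega) (by omega) ha.2 hb.1 hb.2) (fun i b hb => by
        simp only [Regs.update_C1]
        exact realAttemptProg_impl h hpt (by omega) (by omega) ha.2 hb.1 hb.2 _ _ _ _ _)
      N (false, X, []) ⟨hX, fun _ => rfl⟩
    simp only [Regs.update_C1] at g3
    have g4 := Impl.map (e' := fun s => s) (h := fun b : Bool × List Cell × List Cell =>
      (idleRegs sec [] Y b.2.2 (keysCells a.2) b.2.1 (ones a.1) (flagCells b.1) [] (ones x) []).store)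
      (All.trivial _) g3 fun _ _ => rfl
    exact Det.seq_impl_le g2 g4 (by omega)
  rw [startConfig, key.run_eq]
  simp only [solve, QM.bind_apply, QM.pure_apply, List.map_flatMap, List.map_cons, List.map_nil]
  rfl

end

/-- `f` is a polynomial function. -/
def IsPoly (f : ℕ → ℕ) : Prop := ∃ P : Polynomial ℕ, ∀ x, P.eval x = f x

theorem IsPoly.const (a : ℕ) : IsPoly fun _ => a := ⟨.C a, fun x => by simp⟩

theorem IsPoly.id : IsPoly fun x => x := ⟨.X, fun x => by simp⟩

theorem IsPoly.add {f g : ℕ → ℕ} : IsPoly f → IsPoly g → IsPoly fun x => f x + g x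
  | ⟨P, hP⟩, ⟨Q, hQ⟩ => ⟨P + Q, fun x => by simp [hP, hQ]⟩

theorem IsPoly.mul {f g : ℕ → ℕ} : IsPoly f → IsPoly g → IsPoly fun x => f x * g x
  | ⟨P, hP⟩, ⟨Q, hQ⟩ => ⟨P * Q, fun x => by simp [hP, hQ]⟩

theorem isPoly_solveTime (W : WeaklyVerifiablePuzzle) (A : QPTAlg) : IsPoly (solveTime W A) := by
  show IsPoly fun M => solveTime W A M
  simp only [solveTime, indexTime, phasesTime, phaseTime, selfAttemptTime, realAttemptTime,
    attemptTime, sampleKeysTime, tupleTime, verTime, genAllTime, keyTime, callTime]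
  repeat' first
    | exact IsPoly.const _
    | exact IsPoly.id
    | apply IsPoly.add
    | apply IsPoly.mul

theorem Pushes.mono {p : Prog} {sec T T' x k : ℕ} (h : Pushes p sec T x k) (hT : T ≤ T') :
    Pushes p sec T' x k := fun σ h0 h4 h5 h10 h13 => (h σ h0 h4 h5 h10 h13).mono hT

theorem exists_pushes (P : Polynomial ℕ) (x : ℕ) (hx : 13 < x) :
    ∃ (p : Prog) (T : Polynomial ℕ), ∀ sec, Pushes p sec (T.eval sec) x (P.eval sec) := by
  obtain ⟨p, T, h⟩ := exists_polyProg P x hx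
  exact ⟨p, T, fun sec σ => h σ sec⟩

/-- The reduction is a QPT algorithm. -/
theorem exists_solveAlg (W : WeaklyVerifiablePuzzle) (A : QPTAlg) (n m t N : Polynomial ℕ) :
    ∃ A' : QPTAlg, ∀ sec X, A'.exec sec X [] =
      solve W A sec (n.eval sec - 1) (N.eval sec) (t.eval sec) (m.eval sec) X := by
  obtain ⟨pn, Tn, hpn⟩ := exists_pushes n 24 (by decide)
  obtain ⟨pm, Tm, hpm⟩ := exists_pushes m 21 (by decide)
  obtain ⟨pt, Tt, hpt⟩ := exists_pushes t 22 (by decide)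
  obtain ⟨pN, TN, hpN⟩ := exists_pushes N 21 (by decide)
  obtain ⟨Tsolve, hsolve⟩ := isPoly_solveTime W A
  let κ : Polynomial ℕ := W.CheckGen.time
  let π : Polynomial ℕ := W.PuzzleGen.time.comp (.X + κ)
  -- The summand `.X` lets `β` also cover the given input, whose length is at most the argument `s`
  -- at which all these polynomials are evaluated.
  let β : Polynomial ℕ := t * (2 * π + 1) + .X
  let L : Polynomial ℕ := 2 * (n + 1) * (2 * π + 1) + (2 * β + 1)
  let α : Polynomial ℕ := A.time.comp (.X + t * (2 * L + 1))
  let M : Polynomial ℕ := .X + κ + (n + 2) * (2 * κ + 2) + π + (n + 1) + t + β + L + t * (2 * L + 1) + α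
    + W.Ver.time.comp (.X + κ + α) + N + m + 5 + Tn + Tm + Tt + TN
  have key : ∀ sec X Y μ, ((startConfig (solveProg W A pn pm pt pN) sec X Y μ).run
      ((Tsolve.comp M).eval (sec + X.length + Y.length))).map (fun c => (c.todo, c.store 3, c.mem)) =
      (solve W A sec (n.eval sec - 1) (N.eval sec) (t.eval sec) (m.eval sec) X μ).map
        fun r => ([], r.1, r.2) := by
    intro sec X Y μ
    obtain ⟨s, hs⟩ : ∃ s, s = sec + X.length + Y.length := ⟨_, rfl⟩
    have hsec : sec ≤ s := by omega
    have hM : M.eval s = s + κ.eval s + (n.eval s + 2) * (2 * κ.eval s + 2) + π.eval s +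
        (n.eval s + 1) + t.eval s + β.eval s + L.eval s + t.eval s * (2 * L.eval s + 1) + α.eval s
        + W.Ver.time.eval (s + κ.eval s + α.eval s) + N.eval s + m.eval s + 5 + Tn.eval s + Tm.eval s
        + Tt.eval s + TN.eval s := by
      simp [M, Polynomial.eval_comp]
    have hπ : π.eval s = W.PuzzleGen.time.eval (s + κ.eval s) := by simp [π, Polynomial.eval_comp]
    have hβ : β.eval s = t.eval s * (2 * π.eval s + 1) + s := by simp [β]
    have hL : L.eval s = 2 * (n.eval s + 1) * (2 * π.eval s + 1) + (2 * β.eval s + 1) := by simp [L]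
    have hα : α.eval s = A.time.eval (s + t.eval s * (2 * L.eval s + 1)) := by
      simp [α, Polynomial.eval_comp]
    have e1 := eval_mono n hsec
    have e2 := eval_mono t hsec
    have e3 := eval_mono N hsec
    have e4 := eval_mono m hsec
    have e5 := eval_mono Tn hsec
    have e6 := eval_mono Tm hsec
    have e7 := eval_mono Tt hsec
    have e8 := eval_mono TN hsec
    have e9 : t.eval sec * (2 * L.eval s + 1) ≤ t.eval s * (2 * L.eval s + 1) :=
      Nat.mul_le_mul_right _ e2
    -- If `n` vanishes at `sec`, truncated subtraction makes the program act as if there were one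
    -- key. It has to halt in polynomial time there as well.
    have hsz : Sizes W A sec (n.eval sec - 1 + 1) (t.eval sec) (κ.eval s) (π.eval s) (β.eval s)
        (L.eval s) (α.eval s) (M.eval s) :=
      { sec_le := by omega
        checkGen := eval_mono _ hsec
        key_le := by omega
        keys_le := (Nat.mul_le_mul_right _ (by omega : _ ≤ n.eval s + 2)).trans (by omega)
        puzzleGen := (eval_mono _ (by omega)).trans hπ.ge
        puzzle_le := by omega
        n_le := by omega
        t_le := by omega
        block := (Nat.mul_le_mul_right _ e2).trans (by omega)
        block_le := by omega
        tuple := by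
          rw [hL]
          exact Nat.add_le_add_right (Nat.mul_le_mul_right _ (by omega)) _
        tuple_le := by omega
        input_le := by omega
        adversary := (eval_mono _ (by omega)).trans hα.ge
        answer_le := by omega
        ver := (eval_mono _ (b := s + κ.eval s + α.eval s) (by omega)).trans (by omega) }
    rw [← hs, Polynomial.eval_comp, hsolve]
    exact solveProg_run rfl hsz ((hpn sec).mono (by omega)) ((hpm sec).mono (by omega))
      ((hpt sec).mono (by omega)) ((hpN sec).mono (by omega)) (by omega) (by omega) (by omega)
      (by omega) Y μ
  refine ⟨⟨solveProg W A pn pm pt pN, Tsolve.comp M, fun sec X Y μ c hc => ?_⟩, fun sec X => ?_⟩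
  · have h1 := List.mem_map_of_mem (f := fun c : Config => (c.todo, c.store 3, c.mem)) hc
    rw [key] at h1
    obtain ⟨r, -, hr⟩ := List.mem_map.1 h1
    exact (congrArg Prod.fst hr).symm
  · funext μ
    have h1 := congrArg (List.map Prod.snd) (key sec X [] μ)
    simp only [List.map_map, Function.comp_def] at h1
    simpa [QPTAlg.exec] using h1


/-! ## States -/

/-- Squared norm. -/
noncomputable def nsq (ψ : Finset ℕ →₀ ℂ) : ℝ := ψ.sum fun _ a => ‖a‖ ^ 2

theorem nsq_eq_sum {ψ : Finset ℕ →₀ ℂ} {A : Finset (Finset ℕ)} (h : ψ.support ⊆ A) :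
    nsq ψ = ∑ S ∈ A, ‖ψ S‖ ^ 2 :=
  Finsupp.sum_of_support_subset _ h _ (by simp)

theorem nsq_single (S : Finset ℕ) (a : ℂ) : nsq (Finsupp.single S a) = ‖a‖ ^ 2 := by
  simp [nsq]

theorem nsq_nonneg (ψ : Finset ℕ →₀ ℂ) : 0 ≤ nsq ψ := Finset.sum_nonneg fun _ _ => by positivity

/-- The qubits of the first register are renamed by `f`, those of the second one keep their names. -/
noncomputable def embed (f : ℕ ↪ ℕ) (R ψ : Finset ℕ →₀ ℂ) : Finset ℕ →₀ ℂ :=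
  R.sum fun Q b => b • ψ.mapDomain fun S => S.map f ∪ Q

theorem embed_eq_sum (f : ℕ ↪ ℕ) (R ψ : Finset ℕ →₀ ℂ) : embed f R ψ =
    R.sum fun Q b => ψ.sum fun S a => Finsupp.single (S.map f ∪ Q) (b * a) := by
  simp only [embed, Finsupp.mapDomain, Finsupp.smul_sum, Finsupp.smul_single, smul_eq_mul]

theorem embed_congr {f g : ℕ ↪ ℕ} {R ψ : Finset ℕ →₀ ℂ}
    (h : ∀ S ∈ ψ.support, ∀ x ∈ S, f x = g x) : embed f R ψ = embed g R ψ := by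
  rw [embed_eq_sum, embed_eq_sum]
  refine Finset.sum_congr rfl fun Q _ => Finset.sum_congr rfl fun S hS => ?_
  have : S.map f = S.map g := by
    ext x
    simp only [Finset.mem_map]
    exact ⟨fun ⟨y, hy, e⟩ => ⟨y, hy, (h S hS y hy).symm.trans e⟩,
      fun ⟨y, hy, e⟩ => ⟨y, hy, (h S hS y hy).trans e⟩⟩
  simp only [this]

/-- A product of two states is symmetric: either factor may be regarded as the renamed one. -/
theorem embed_comm (f : ℕ ↪ ℕ) (R ψ : Finset ℕ →₀ ℂ) :
    embed (.refl ℕ) (ψ.mapDomain (Finset.map f)) R = embed f R ψ := by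
  rw [embed_eq_sum, embed_eq_sum, Finsupp.sum_mapDomain_index (by simp)
    (by intros; simp only [add_mul, Finsupp.single_add, Finsupp.sum_add])]
  conv_rhs => rw [Finsupp.sum_comm]
  simp only [Finset.map_refl, Finset.union_comm, mul_comm]

theorem embed_single (f : ℕ ↪ ℕ) (ψ : Finset ℕ →₀ ℂ) :
    embed f (Finsupp.single ∅ 1) ψ = ψ.mapDomain (Finset.map f) := by
  simp [embed]

theorem nsq_sum_single {ι : Type} {I : Finset ι} {e : ι → Finset ℕ} (c : ι → ℂ)
    (he : Set.InjOn e I) : nsq (∑ p ∈ I, Finsupp.single (e p) (c p)) = ∑ p ∈ I, ‖c p‖ ^ 2 := by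
  classical
  have h1 : ∀ p ∈ I, (∑ p ∈ I, Finsupp.single (e p) (c p)) (e p) = c p := by
    intro p hp
    rw [Finsupp.finsetSum_apply, Finset.sum_eq_single_of_mem p hp]
    · simp
    · intro p' hp' hne
      exact Finsupp.single_eq_of_ne fun h => hne (he hp' hp h.symm)
  rw [nsq_eq_sum (A := I.image e), Finset.sum_image he]
  · exact Finset.sum_congr rfl fun p hp => by rw [h1 p hp]
  · refine Finsupp.support_finsetSum.trans (Finset.biUnion_subset.2 fun p hp => ?_)
    exact Finsupp.support_single_subset.trans (Finset.singleton_subset_iff.2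
      (Finset.mem_image_of_mem e hp))

/-- Because the two registers are disjoint, the pair of basis states can be recovered from its
union. The terms of the product are then orthogonal, and norms multiply. -/
theorem nsq_embed {f : ℕ ↪ ℕ} {R ψ : Finset ℕ →₀ ℂ}
    (h : ∀ S ∈ ψ.support, ∀ Q ∈ R.support, Disjoint (S.map f) Q) :
    nsq (embed f R ψ) = nsq ψ * nsq R := by
  have h1 : embed f R ψ = ∑ p ∈ ψ.support ×ˢ R.support,
      Finsupp.single (p.1.map f ∪ p.2) (R p.2 * ψ p.1) := by
    rw [embed_eq_sum, Finset.sum_product_right]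
    rfl
  rw [h1, nsq_sum_single]
  · rw [nsq, nsq, Finsupp.sum, Finsupp.sum, Finset.sum_mul_sum, Finset.sum_product]
    exact Finset.sum_congr rfl fun S _ => Finset.sum_congr rfl fun Q _ => by
      rw [norm_mul, mul_pow, mul_comm]
  · rintro ⟨S, Q⟩ hp ⟨S', Q'⟩ hp' heq
    simp only [Finset.coe_product, Set.mem_prod, Finset.mem_coe] at hp hp' heq
    have d : ∀ x, x ∈ S.map f → x ∉ Q' := fun x hx => Finset.disjoint_left.1 (h S hp.1 Q' hp'.2) hx
    have d' : ∀ x, x ∈ S'.map f → x ∉ Q := fun x hx => Finset.disjoint_left.1 (h S' hp'.1 Q hp.2) hx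
    have hm : ∀ x, (x ∈ S.map f ∨ x ∈ Q) ↔ (x ∈ S'.map f ∨ x ∈ Q') := fun x => by
      simpa only [Finset.mem_union] using Finset.ext_iff.1 heq x
    have e1 : S.map f = S'.map f := Finset.ext fun x =>
      ⟨fun hx => ((hm x).1 (.inl hx)).resolve_right (d x hx),
        fun hx => ((hm x).2 (.inl hx)).resolve_right (d' x hx)⟩
    have e2 : Q = Q' := Finset.ext fun x =>
      ⟨fun hx => ((hm x).1 (.inr hx)).resolve_left fun h' => d' x h' hx,
        fun hx => ((hm x).2 (.inr hx)).resolve_left fun h' => d x h' hx⟩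
    rw [Finset.map_injective f e1, e2]

/-! ## Gates -/

theorem hadamard_single (i : ℕ) (S : Finset ℕ) (a : ℂ) : hadamard i (Finsupp.single S a) =
    a • ((Real.sqrt 2 : ℂ)⁻¹) • if i ∈ S then Finsupp.single (S.erase i) (1 : ℂ) - Finsupp.single S 1
      else Finsupp.single S 1 + Finsupp.single (insert i S) 1 := by
  simp [hadamard, Finsupp.linearCombination_single]

section
variable {f : ℕ → ℕ} {τ : Finset ℕ → Finset ℕ}

theorem hadamard_mapDomain {i : ℕ} (hi : ∀ S, f i ∈ τ S ↔ i ∈ S)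
    (he : ∀ S, τ (S.erase i) = (τ S).erase (f i)) (hin : ∀ S, τ (insert i S) = insert (f i) (τ S))
    (ψ : Finset ℕ →₀ ℂ) : hadamard (f i) (ψ.mapDomain τ) = (hadamard i ψ).mapDomain τ := by
  induction ψ using Finsupp.induction_linear with
  | zero => simp
  | add a b ha hb => simp [Finsupp.mapDomain_add, ha, hb]
  | single S a =>
    rw [Finsupp.mapDomain_single, hadamard_single, hadamard_single]
    simp only [hi]
    split_ifs <;> simp only [Finsupp.mapDomain_smul, Finsupp.mapDomain_add, sub_eq_add_neg,
      ← Finsupp.single_neg, he, hin, Finsupp.mapDomain_single]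

theorem tGate_mapDomain {i : ℕ} (hi : ∀ S, f i ∈ τ S ↔ i ∈ S) (ψ : Finset ℕ →₀ ℂ) :
    tGate (f i) (ψ.mapDomain τ) = (tGate i ψ).mapDomain τ := by
  induction ψ using Finsupp.induction_linear with
  | zero => simp
  | add a b ha hb => simp [Finsupp.mapDomain_add, ha, hb]
  | single S a => simp [tGate, Finsupp.linearCombination_single, Finsupp.mapDomain_single, hi]

theorem cnot_mapDomain {i j : ℕ} (hi : ∀ S, f i ∈ τ S ↔ i ∈ S) (hij : f i = f j ↔ i = j)
    (hs : ∀ S, τ (symmDiff S {j}) = symmDiff (τ S) {f j}) (ψ : Finset ℕ →₀ ℂ) :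
    QPuzzle.cnot (f i) (f j) (ψ.mapDomain τ) = (QPuzzle.cnot i j ψ).mapDomain τ := by
  induction ψ using Finsupp.induction_linear with
  | zero => simp
  | add a b ha hb => simp [Finsupp.mapDomain_add, ha, hb]
  | single S a =>
    simp only [QPuzzle.cnot, Finsupp.linearCombination_single, Finsupp.mapDomain_single, hi, ne_eq, hij,
      Finsupp.smul_single]
    split_ifs <;> simp [hs]

theorem project_mapDomain {i : ℕ} (hi : ∀ S, f i ∈ τ S ↔ i ∈ S) (b : Bool) (ψ : Finset ℕ →₀ ℂ) :
    project (f i) b (ψ.mapDomain τ) = (project i b ψ).mapDomain τ := by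
  induction ψ using Finsupp.induction_linear with
  | zero => simp [project, Finsupp.filter_zero]
  | add a c ha hb => simp only [project, Finsupp.mapDomain_add, Finsupp.filter_add] at ha hb ⊢; rw [ha, hb]
  | single S a =>
    simp only [project, Finsupp.mapDomain_single]
    by_cases h : decide (i ∈ S) = b
    · rw [Finsupp.filter_single_of_pos _ (by simpa [hi] using h), Finsupp.filter_single_of_pos (p := fun S => decide (i ∈ S) = b) h,
        Finsupp.mapDomain_single]
    · rw [Finsupp.filter_single_of_neg _ (by simpa [hi] using h), Finsupp.filter_single_of_neg (p := fun S => decide (i ∈ S) = b) h,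
        Finsupp.mapDomain_zero]

end

/-- By linearity, it suffices to look at one basis state `Q` of the second register at a time, where
the embedding is a mere relabelling of basis states. -/
theorem map_embed {f : ℕ ↪ ℕ} {R : Finset ℕ →₀ ℂ} (G G' : (Finset ℕ →₀ ℂ) →ₗ[ℂ] (Finset ℕ →₀ ℂ))
    (h : ∀ Q ∈ R.support, ∀ ψ : Finset ℕ →₀ ℂ, G' (ψ.mapDomain fun S => S.map f ∪ Q) =
      (G ψ).mapDomain fun S => S.map f ∪ Q) (ψ : Finset ℕ →₀ ℂ) :
    G' (embed f R ψ) = embed f R (G ψ) := by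
  simp only [embed, Finsupp.sum, map_sum, map_smul]
  exact Finset.sum_congr rfl fun Q hQ => by rw [h Q hQ]

/-- `project` as a linear map. -/
noncomputable def projectL (i : ℕ) (b : Bool) : (Finset ℕ →₀ ℂ) →ₗ[ℂ] (Finset ℕ →₀ ℂ) where
  toFun := project i b
  map_add' _ _ := Finsupp.filter_add
  map_smul' _ _ := Finsupp.filter_smul

section
variable {f : ℕ ↪ ℕ} {R : Finset ℕ →₀ ℂ} {i j : ℕ}

theorem mem_map_union {Q : Finset ℕ} (hi : f i ∉ Q) (S : Finset ℕ) : f i ∈ S.map f ∪ Q ↔ i ∈ S := by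
  simp [hi]

theorem hadamard_embed (hi : ∀ Q ∈ R.support, f i ∉ Q) (ψ : Finset ℕ →₀ ℂ) :
    hadamard (f i) (embed f R ψ) = embed f R (hadamard i ψ) :=
  map_embed _ _ (fun Q hQ ψ => hadamard_mapDomain (mem_map_union (hi Q hQ))
    (fun S => by
      rw [Finset.map_erase, Finset.erase_union_distrib, Finset.erase_eq_of_notMem (hi Q hQ)])
    (fun S => by rw [Finset.map_insert, Finset.insert_union]) ψ) ψ

theorem tGate_embed (hi : ∀ Q ∈ R.support, f i ∉ Q) (ψ : Finset ℕ →₀ ℂ) :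
    tGate (f i) (embed f R ψ) = embed f R (tGate i ψ) :=
  map_embed _ _ (fun Q hQ ψ => tGate_mapDomain (mem_map_union (hi Q hQ)) ψ) ψ

theorem cnot_embed (hi : ∀ Q ∈ R.support, f i ∉ Q) (hj : ∀ Q ∈ R.support, f j ∉ Q)
    (ψ : Finset ℕ →₀ ℂ) :
    QPuzzle.cnot (f i) (f j) (embed f R ψ) = embed f R (QPuzzle.cnot i j ψ) :=
  map_embed _ _ (fun Q hQ ψ => cnot_mapDomain (mem_map_union (hi Q hQ)) f.injective.eq_iff
    (fun S => by
      have := hj Q hQ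
      ext x
      simp only [Finset.mem_union, Finset.mem_map, Finset.mem_symmDiff, Finset.mem_singleton]
      by_cases hx : x = f j
      · subst hx
        simp [this]
      · simp only [hx, not_false_eq_true, and_true, false_and, or_false]
        refine or_congr_left ⟨fun ⟨y, hy, e⟩ => ⟨y, ?_, e⟩, fun ⟨y, hy, e⟩ => ⟨y, ?_, e⟩⟩
        · rcases hy with hy | hy
          exacts [hy.1, absurd (hy.1 ▸ e.symm) hx]
        · exact .inl ⟨hy, fun h => hx (h ▸ e.symm)⟩) ψ) ψ

theorem project_embed (hi : ∀ Q ∈ R.support, f i ∉ Q) (b : Bool) (ψ : Finset ℕ →₀ ℂ) :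
    project (f i) b (embed f R ψ) = embed f R (project i b ψ) :=
  map_embed (projectL i b) (projectL (f i) b)
    (fun Q hQ ψ => project_mapDomain (mem_map_union (hi Q hQ)) b ψ) ψ

end

/-! ## Gates preserve the norm -/

theorem nsq_project (i : ℕ) (ψ : Finset ℕ →₀ ℂ) :
    nsq (project i false ψ) + nsq (project i true ψ) = nsq ψ := by
  rw [nsq_eq_sum (A := ψ.support) (by rw [project, Finsupp.support_filter]; exact Finset.filter_subset _ _), nsq_eq_sum (A := ψ.support)
    (by rw [project, Finsupp.support_filter]; exact Finset.filter_subset _ _), nsq_eq_sum subset_rfl, ← Finset.sum_add_distrib]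
  refine Finset.sum_congr rfl fun S _ => ?_
  by_cases h : i ∈ S <;> simp [project, h]

theorem tGate_apply (i : ℕ) (ψ : Finset ℕ →₀ ℂ) (S : Finset ℕ) :
    tGate i ψ S = ψ S * (if i ∈ S then Complex.exp (Complex.I * (Real.pi / 4)) else 1) := by
  induction ψ using Finsupp.induction_linear with
  | zero => simp
  | add a b ha hb => simp only [map_add, Finsupp.add_apply, ha, hb, add_mul]
  | single Q a =>
    simp only [tGate, Finsupp.linearCombination_single, Finsupp.smul_single, smul_eq_mul]
    by_cases h : Q = S
    · simp [h]
    · simp [h]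

theorem nsq_tGate (i : ℕ) (ψ : Finset ℕ →₀ ℂ) : nsq (tGate i ψ) = nsq ψ := by
  rw [nsq_eq_sum (A := ψ.support), nsq_eq_sum subset_rfl]
  · refine Finset.sum_congr rfl fun S _ => ?_
    rw [tGate_apply]
    split_ifs
    · rw [norm_mul, show Complex.I * (Real.pi / 4) = ((Real.pi / 4 : ℝ) : ℂ) * Complex.I by
        push_cast; ring, Complex.norm_exp_ofReal_mul_I, mul_one]
    · rw [mul_one]
  · intro S hS
    rw [Finsupp.mem_support_iff, tGate_apply] at hS
    exact Finsupp.mem_support_iff.2 (left_ne_zero_of_mul hS)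

theorem nsq_cnot (i j : ℕ) (ψ : Finset ℕ →₀ ℂ) : nsq (QPuzzle.cnot i j ψ) = nsq ψ := by
  have h1 : QPuzzle.cnot i j ψ =
      ψ.mapDomain fun S => if i ≠ j ∧ i ∈ S then symmDiff S {j} else S := by
    induction ψ using Finsupp.induction_linear with
    | zero => simp
    | add a b ha hb => simp only [map_add, Finsupp.mapDomain_add, ha, hb]
    | single Q a => simp [QPuzzle.cnot, Finsupp.linearCombination_single, Finsupp.mapDomain_single]
  rw [h1, nsq, Finsupp.sum_mapDomain_index_inj, nsq]
  -- The gate permutes basis states. For `i ≠ j`, flipping the target leaves the control unchanged,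
  -- so the permutation is its own inverse; without that guard it would not be.
  have hinv : Function.Involutive fun S : Finset ℕ =>
      if i ≠ j ∧ i ∈ S then symmDiff S {j} else S := by
    intro S
    dsimp only
    by_cases h : i ≠ j ∧ i ∈ S
    · rw [if_pos h, if_pos ⟨h.1, by simp [Finset.mem_symmDiff, h.1, h.2]⟩, symmDiff_symmDiff_cancel_right]
    · rw [if_neg h, if_neg h]
  exact hinv.injective

theorem hadamard_apply (i : ℕ) (ψ : Finset ℕ →₀ ℂ) (S : Finset ℕ) : hadamard i ψ S =
    (Real.sqrt 2 : ℂ)⁻¹ * (ψ (symmDiff S {i}) + if i ∈ S then - ψ S else ψ S) := by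
  induction ψ using Finsupp.induction_linear with
  | zero => simp
  | add a b ha hb =>
    simp only [map_add, Finsupp.add_apply, ha, hb]
    split_ifs <;> ring
  | single Q a =>
    rw [hadamard_single]
    have hT : ∀ S : Finset ℕ, i ∈ S → symmDiff S {i} = S.erase i := fun S h => by
      ext x; by_cases hx : x = i <;> simp [Finset.mem_symmDiff, hx, h]
    have hT' : ∀ S : Finset ℕ, i ∉ S → symmDiff S {i} = insert i S := fun S h => by
      ext x; by_cases hx : x = i <;> simp [Finset.mem_symmDiff, hx, h]
    have hQS : Q = symmDiff S {i} ↔ symmDiff Q {i} = S :=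
      ⟨fun h => by rw [h, symmDiff_symmDiff_cancel_right], fun h => by
        rw [← h, symmDiff_symmDiff_cancel_right]⟩
    simp only [Finsupp.smul_apply, smul_eq_mul, Finsupp.single_apply, hQS]
    by_cases hQ : i ∈ Q
    · rw [if_pos hQ, hT Q hQ]
      by_cases hS : Q = S
      · subst hS
        have : Q.erase i ≠ Q := fun h => by rw [← h] at hQ; simp at hQ
        simp [hQ, this]; ring
      · simp only [Finsupp.sub_apply, Finsupp.single_apply, if_neg hS, neg_zero, ite_self]
        split_ifs <;> ring
    · rw [if_neg hQ, hT' Q hQ]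
      by_cases hS : Q = S
      · subst hS
        have : insert i Q ≠ Q := fun h => by rw [← h] at hQ; simp at hQ
        simp [hQ, this]; ring
      · simp only [Finsupp.add_apply, Finsupp.single_apply, if_neg hS, neg_zero, ite_self]
        split_ifs <;> ring

/-- The gate mixes the amplitudes of `S` and of `S` with qubit `i` flipped. On such a pair it
preserves the squared norm by the parallelogram law, and the finite set `A` is closed under the
flip. -/
theorem nsq_hadamard (i : ℕ) (ψ : Finset ℕ →₀ ℂ) : nsq (hadamard i ψ) = nsq ψ := by
  let σ : Equiv.Perm (Finset ℕ) :=
    ⟨fun S => symmDiff S {i}, fun S => symmDiff S {i}, fun S => symmDiff_symmDiff_cancel_right _ _,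
      fun S => symmDiff_symmDiff_cancel_right _ _⟩
  have hσ : ∀ S, σ S = symmDiff S {i} := fun _ => rfl
  have hσσ : ∀ S, σ (σ S) = S := fun S => symmDiff_symmDiff_cancel_right _ _
  let A := ψ.support ∪ ψ.support.map σ.toEmbedding
  have hA : ∀ S, S ∈ A ↔ ψ S ≠ 0 ∨ ψ (σ S) ≠ 0 := by
    intro S
    simp only [A, Finset.mem_union, Finsupp.mem_support_iff, Finset.mem_map, Equiv.coe_toEmbedding]
    exact or_congr_right ⟨fun ⟨Q, hQ, e⟩ => by rwa [← e, hσσ], fun h => ⟨_, h, hσσ S⟩⟩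
  have hAσ : ∀ S, S ∈ A ↔ σ S ∈ A := fun S => by rw [hA, hA, hσσ, or_comm]
  have h1 : (hadamard i ψ).support ⊆ A := by
    intro S hS
    rw [hA]
    by_contra hc
    push Not at hc
    rw [Finsupp.mem_support_iff, hadamard_apply, ← hσ, hc.1, hc.2] at hS
    simp at hS
  have h2 : ψ.support ⊆ A := Finset.subset_union_left
  have hsum : ∀ F : Finset ℕ → ℝ, ∑ S ∈ A, F (σ S) = ∑ S ∈ A, F S := fun F =>
    Finset.sum_equiv σ hAσ fun _ _ => rfl
  have h3 : ∀ S, ‖hadamard i ψ S‖ ^ 2 + ‖hadamard i ψ (σ S)‖ ^ 2 = ‖ψ S‖ ^ 2 + ‖ψ (σ S)‖ ^ 2 := by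
    intro S
    have hm : i ∈ σ S ↔ i ∉ S := by simp [hσ, Finset.mem_symmDiff]
    have h2' : ‖(Real.sqrt 2 : ℂ)⁻¹‖ ^ 2 = 2⁻¹ := by
      rw [norm_inv, inv_pow, Complex.norm_real, Real.norm_eq_abs, sq_abs,
        Real.sq_sqrt (by norm_num)]
    have hp := parallelogram_law_with_norm ℝ (ψ S) (ψ (σ S))
    rw [hadamard_apply, hadamard_apply, ← hσ, ← hσ, hσσ, norm_mul, norm_mul, mul_pow, mul_pow, h2']
    by_cases h : i ∈ S
    · rw [if_pos h, if_neg (by simp [hm, h]), ← sub_eq_add_neg, norm_sub_rev]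
      nlinarith
    · rw [if_neg h, if_pos (by simp [hm, h]), ← sub_eq_add_neg, add_comm (ψ (σ S)) (ψ S)]
      nlinarith
  have h4 := Finset.sum_congr rfl fun S (_ : S ∈ A) => h3 S
  rw [Finset.sum_add_distrib, Finset.sum_add_distrib, hsum fun S => ‖hadamard i ψ S‖ ^ 2,
    hsum fun S => ‖ψ S‖ ^ 2] at h4
  rw [nsq_eq_sum h1, nsq_eq_sum h2]
  linarith


/-! ## Data that name qubits -/

/-- Data in which qubits can be renamed. -/
class Nom (α : Type) where
  ren : (ℕ → ℕ) → α → α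
  ren_id : ∀ a, ren (fun x => x) a = a
  ren_ren : ∀ f g a, ren g (ren f a) = ren (fun x => g (f x)) a

open Nom (ren)

/-- Data that name no qubits. -/
class NoQubits (α : Type) extends Nom α where
  ren_eq : ∀ f (a : α), Nom.ren f a = a

/-- All qubits in `a` have names `< N`. -/
def Bdd {α : Type} [Nom α] (N : ℕ) (a : α) : Prop :=
  ∀ f g : ℕ → ℕ, (∀ x < N, f x = g x) → ren f a = ren g a

section
variable {α β : Type} [Nom α] [Nom β]

theorem Bdd.mono {N N' : ℕ} {a : α} (h : Bdd N a) (hN : N ≤ N') : Bdd N' a :=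
  fun f g hfg => h f g fun x hx => hfg x (hx.trans_le hN)

theorem Bdd.rename {N N' : ℕ} {a : α} (h : Bdd N a) {f : ℕ → ℕ} (hf : ∀ x < N, f x < N') :
    Bdd N' (ren f a) := fun g g' hg => by
  rw [Nom.ren_ren, Nom.ren_ren]
  exact h _ _ fun x hx => hg _ (hf x hx)

theorem Bdd.ren_eq {N : ℕ} {a : α} (h : Bdd N a) {f : ℕ → ℕ} (hf : ∀ x < N, f x = x) :
    Nom.ren f a = a := (h f (fun x => x) hf).trans (Nom.ren_id a)

/-- `g` commutes with renaming. -/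
def Eqv (g : α → β) : Prop := ∀ f a, ren f (g a) = g (ren f a)

theorem Eqv.bdd {g : α → β} (hg : Eqv g) {N : ℕ} {a : α} (h : Bdd N a) : Bdd N (g a) :=
  fun f f' hf => by rw [hg, hg, h f f' hf]

end

instance : Nom Cell where
  ren f c := match c with
    | .bit b => .bit b
    | .qubit i => .qubit (f i)
  ren_id c := by cases c <;> rfl
  ren_ren f g c := by cases c <;> rfl

instance {α : Type} [Nom α] : Nom (List α) where
  ren f l := l.map (ren f)
  ren_id l := by
    rw [show (ren (fun x => x) : α → α) = id from funext Nom.ren_id, List.map_id]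
  ren_ren f g l := by
    rw [List.map_map]
    exact List.map_congr_left fun a _ => Nom.ren_ren f g a

instance {α β : Type} [Nom α] [Nom β] : Nom (α × β) where
  ren f p := (ren f p.1, ren f p.2)
  ren_id p := by rw [Nom.ren_id, Nom.ren_id]
  ren_ren f g p := by rw [Nom.ren_ren, Nom.ren_ren]

instance : Nom Store where
  ren f σ r := ren f (σ r)
  ren_id _ := funext fun _ => Nom.ren_id _
  ren_ren f g _ := funext fun _ => Nom.ren_ren f g _

instance : NoQubits Bool where
  ren _ b := b
  ren_id _ := rfl
  ren_ren _ _ _ := rfl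
  ren_eq _ _ := rfl

instance : NoQubits Unit where
  ren _ b := b
  ren_id _ := rfl
  ren_ren _ _ _ := rfl
  ren_eq _ _ := rfl

instance : NoQubits ℕ where
  ren _ b := b
  ren_id _ := rfl
  ren_ren _ _ _ := rfl
  ren_eq _ _ := rfl

theorem ren_list_eq {α : Type} [NoQubits α] (f : ℕ → ℕ) (l : List α) : ren f l = l :=
  (List.map_congr_left fun a _ => NoQubits.ren_eq f a).trans (List.map_id l)

instance {α : Type} [NoQubits α] : NoQubits (List α) where
  ren_eq := ren_list_eq

instance {α β : Type} [NoQubits α] [NoQubits β] : NoQubits (α × β) where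
  ren_eq f p := Prod.ext (NoQubits.ren_eq f p.1) (NoQubits.ren_eq f p.2)

section
variable {α β : Type} [Nom α] [Nom β]

theorem ren_pair (f : ℕ → ℕ) (a : α) (b : β) : ren f (a, b) = (ren f a, ren f b) := rfl

theorem ren_nil (f : ℕ → ℕ) : ren f ([] : List α) = [] := rfl

theorem ren_cons (f : ℕ → ℕ) (a : α) (l : List α) : ren f (a :: l) = ren f a :: ren f l := rfl

theorem ren_append (f : ℕ → ℕ) (l l' : List α) : ren f (l ++ l') = ren f l ++ ren f l' :=
  List.map_append

theorem Bdd.pair {N : ℕ} {a : α} {b : β} (ha : Bdd N a) (hb : Bdd N b) : Bdd N (a, b) :=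
  fun f g h => by rw [ren_pair, ren_pair, ha f g h, hb f g h]

theorem Bdd.snd {N : ℕ} {p : α × β} (h : Bdd N p) : Bdd N p.2 := fun f g hf =>
  congrArg Prod.snd (h f g hf)

theorem Bdd.of_noQubits {γ : Type} [NoQubits γ] (N : ℕ) (c : γ) : Bdd N c := fun f g _ => by
  rw [NoQubits.ren_eq, NoQubits.ren_eq]

theorem ren_bit (f : ℕ → ℕ) (b : Bool) : ren f (Cell.bit b) = .bit b := rfl

theorem ren_qubit (f : ℕ → ℕ) (i : ℕ) : ren f (Cell.qubit i) = .qubit (f i) := rfl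

theorem ren_apply (f : ℕ → ℕ) (σ : Store) (r : ℕ) : (ren f σ : Store) r = ren f (σ r) := rfl

theorem Bdd.qubit_lt {N i : ℕ} (h : Bdd N (Cell.qubit i)) : i < N := by
  by_contra hc
  -- The second renaming moves every name from `N` on, so it can agree with the identity on the
  -- qubit only if `i < N`.
  have := h (fun x => x) (fun x => if x < N then x else x + 1) (fun x hx => by simp [hx])
  simp only [ren_qubit, hc, if_false, Cell.qubit.injEq] at this
  omega

theorem Bdd.cons_iff {N : ℕ} {a : α} {l : List α} : Bdd N (a :: l) ↔ Bdd N a ∧ Bdd N l :=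
  ⟨fun h => ⟨fun f g hf => (List.cons.inj (h f g hf)).1, fun f g hf => (List.cons.inj (h f g hf)).2⟩,
    fun h f g hf => by rw [ren_cons, ren_cons, h.1 f g hf, h.2 f g hf]⟩

theorem Bdd.stack {N : ℕ} {σ : Store} (h : Bdd N σ) (r : ℕ) : Bdd N (σ r) := fun f g hf =>
  congrFun (h f g hf) r

theorem Bdd.update {N : ℕ} {σ : Store} (h : Bdd N σ) {r : ℕ} {w : List Cell} (hw : Bdd N w) :
    Bdd N (Function.update σ r w) := fun f g hf => by
  funext x
  by_cases hx : x = r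
  · subst hx
    simpa [ren_apply] using hw f g hf
  · simpa [ren_apply, hx] using congrFun (h f g hf) x

theorem ren_update (f : ℕ → ℕ) (σ : Store) (r : ℕ) (w : List Cell) :
    ren f (Function.update σ r w) = Function.update (ren f σ) r (ren f w) := by
  funext x
  by_cases hx : x = r
  · subst hx; simp [ren_apply]
  · simp [ren_apply, hx]

theorem topOf_ren (f : ℕ → ℕ) (w : List Cell) : topOf (ren f w) = topOf w := by
  rcases w with _ | ⟨_ | _, w⟩
  · rfl
  · rename_i b; cases b <;> rfl
  · rfl

end

/-! ## Frames -/

/-- The state is one of the qubits allocated so far. -/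
def QMem.Good (μ : QMem) : Prop := ∀ S ∈ μ.ψ.support, ∀ x ∈ S, x < μ.next

/-- `μ` is the product of `ν`, renamed by `f`, and the state `R` of the qubits in `D`. -/
structure Frame (f : ℕ ↪ ℕ) (D : Set ℕ) (R : Finset ℕ →₀ ℂ) (ν μ : QMem) : Prop where
  good : ν.Good
  rest : ∀ S ∈ R.support, ∀ x ∈ S, x ∈ D
  names : ∀ x, x < μ.next ↔ x ∈ D ∨ ∃ y < ν.next, f y = x
  disj : ∀ y < ν.next, f y ∉ D
  state : μ.ψ = embed f R ν.ψ

theorem good_vacuum : QMem.vacuum.Good := by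
  intro S hS x hx
  have := Finsupp.support_single_subset hS
  rw [Finset.mem_singleton] at this
  subst this
  simp at hx

namespace Frame
variable {f : ℕ ↪ ℕ} {D : Set ℕ} {R : Finset ℕ →₀ ℂ} {ν μ : QMem}

theorem lt (h : Frame f D R ν μ) {y : ℕ} (hy : y < ν.next) : f y < μ.next :=
  (h.names _).2 (.inr ⟨y, hy, rfl⟩)

theorem mem_lt (h : Frame f D R ν μ) {x : ℕ} (hx : x ∈ D) : x < μ.next := (h.names _).2 (.inl hx)

theorem weight_eq (h : Frame f D R ν μ) : μ.weight = ν.weight * nsq R := by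
  show nsq μ.ψ = nsq ν.ψ * nsq R
  rw [h.state]
  refine nsq_embed fun S hS Q hQ => Finset.disjoint_left.2 fun x hx hxQ => ?_
  obtain ⟨y, hy, rfl⟩ := Finset.mem_map.1 hx
  exact h.disj y (h.good S hS y hy) (h.rest Q hQ _ hxQ)

theorem notMem (h : Frame f D R ν μ) {i : ℕ} (hi : i < ν.next) : ∀ Q ∈ R.support, f i ∉ Q :=
  fun Q hQ hm => h.disj i hi (h.rest Q hQ _ hm)

/-- A gate acts on both sides. -/
theorem gate (h : Frame f D R ν μ) {ψ ψ' : Finset ℕ →₀ ℂ}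
    (hg : ∀ S ∈ ψ.support, ∀ x ∈ S, x < ν.next) (hψ : ψ' = embed f R ψ) :
    Frame f D R ⟨ν.next, ψ⟩ ⟨μ.next, ψ'⟩ := ⟨hg, h.rest, h.names, h.disj, hψ⟩

theorem of_good (h : ν.Good) : Frame (.refl ℕ) ∅ (.single ∅ 1) ν ν where
  good := h
  rest S hS x hx := by
    have := Finsupp.support_single_subset hS
    rw [Finset.mem_singleton] at this
    subst this
    simp at hx
  names x := by simp
  disj y _ := by simp
  state := by
    rw [embed_single]
    rw [show (Finset.map (.refl ℕ) : Finset ℕ → Finset ℕ) = id from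
      funext fun _ => Finset.map_refl, Finsupp.mapDomain_id]

/-- Everything is a frame for the empty memory. -/
theorem vacuum (hμ : μ.Good) : Frame (.refl ℕ) {x | x < μ.next} μ.ψ .vacuum μ where
  good := good_vacuum
  rest := hμ
  names x := by simp [QMem.vacuum]
  disj y hy := absurd hy (by simp [QMem.vacuum])
  state := by
    rw [← embed_comm, QMem.vacuum, Finsupp.mapDomain_single, Finset.map_empty, embed_single]
    rw [show (Finset.map (.refl ℕ) : Finset ℕ → Finset ℕ) = id from
      funext fun _ => Finset.map_refl, Finsupp.mapDomain_id]

/-- A new qubit. -/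
theorem new (h : Frame f D R ν μ) : ∃ f' : ℕ ↪ ℕ, (∀ x < ν.next, f' x = f x) ∧
    f' ν.next = μ.next ∧ Frame f' D R ⟨ν.next + 1, ν.ψ⟩ ⟨μ.next + 1, μ.ψ⟩ := by
  -- The transposition sends the image of the new name to the new name. It does not affect the names
  -- in use: by injectivity their images differ from `f ν.next`, and they lie below `μ.next`.
  let f' : ℕ ↪ ℕ := f.trans (Equiv.swap (f ν.next) μ.next).toEmbedding
  have h1 : ∀ x < ν.next, f' x = f x := fun x hx =>
    Equiv.swap_apply_of_ne_of_ne (fun e => hx.ne (f.injective e)) (h.lt hx).ne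
  have h2 : f' ν.next = μ.next := Equiv.swap_apply_left _ _
  refine ⟨f', h1, h2, fun S hS x hx => (h.good S hS x hx).trans (Nat.lt_succ_self _), h.rest,
    fun x => ?_, fun y hy => ?_, h.state.trans (embed_congr fun S hS x hx =>
      (h1 x (h.good S hS x hx)).symm)⟩
  · dsimp only
    rw [Nat.lt_succ_iff_lt_or_eq, h.names]
    constructor
    · rintro ((hx | ⟨y, hy, rfl⟩) | rfl)
      · exact .inl hx
      · exact .inr ⟨y, by omega, h1 y hy⟩
      · exact .inr ⟨_, Nat.lt_succ_self _, h2⟩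
    · rintro (hx | ⟨y, hy, rfl⟩)
      · exact .inl (.inl hx)
      · rcases Nat.lt_succ_iff_lt_or_eq.1 hy with hy | rfl
        · exact .inl (.inr ⟨y, hy, (h1 y hy).symm⟩)
        · exact .inr h2
  · rcases Nat.lt_succ_iff_lt_or_eq.1 hy with hy | rfl
    · rw [h1 y hy]; exact h.disj y hy
    · rw [h2]; exact fun hm => absurd (h.mem_lt hm) (lt_irrefl _)

theorem good_right (h : Frame f D R ν μ) : μ.Good := by
  intro S hS x hx
  rw [h.state, embed_eq_sum] at hS
  obtain ⟨Q, hQ, hS⟩ := Finset.mem_biUnion.1 (Finsupp.support_finsetSum hS)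
  obtain ⟨S', hS', hS⟩ := Finset.mem_biUnion.1 (Finsupp.support_finsetSum hS)
  have := Finsupp.support_single_subset hS
  rw [Finset.mem_singleton] at this
  subst this
  rcases Finset.mem_union.1 hx with hx | hx
  · obtain ⟨y, hy, rfl⟩ := Finset.mem_map.1 hx
    exact h.lt (h.good _ hS' y hy)
  · exact h.mem_lt (h.rest Q hQ x hx)

/-- The state of the frame, as a state of its own. -/
theorem swap {μ₀ : QMem} (h : Frame f {x | x < μ₀.next} μ₀.ψ ν μ) (h₀ : μ₀.Good) :
    Frame (.refl ℕ) {x | ∃ y < ν.next, f y = x} (ν.ψ.mapDomain (Finset.map f)) μ₀ μ where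
  good := h₀
  rest S hS x hx := by
    obtain ⟨S', hS', rfl⟩ := Finset.mem_image.1 (Finsupp.mapDomain_support hS)
    obtain ⟨y, hy, rfl⟩ := Finset.mem_map.1 hx
    exact ⟨y, h.good S' hS' y hy, rfl⟩
  names x := by
    rw [h.names]
    simp only [Set.mem_ofPred_eq, Function.Embedding.refl_apply, exists_eq_right, or_comm]
  disj y hy := by
    rintro ⟨z, hz, e⟩
    exact h.disj z hz (by rw [e]; exact hy)
  state := h.state.trans (embed_comm _ _ _).symm

end Frame

/-! ## Equivariant procedures -/

section
variable {α β γ : Type} [Nom α] [Nom β] [Nom γ]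

/-- Corresponding results. -/
def Corr (N : ℕ) (f : ℕ ↪ ℕ) (D : Set ℕ) (R : Finset ℕ →₀ ℂ) (r r' : α × QMem) : Prop :=
  ∃ f' : ℕ ↪ ℕ, (∀ x < N, f' x = f x) ∧ N ≤ r.2.next ∧ Bdd r.2.next r.1 ∧ r'.1 = ren f' r.1 ∧
    Frame f' D R r.2 r'.2

/-- The procedure depends neither on the names of its qubits nor on other qubits. -/
def Equi (h : β → QM α) : Prop :=
  ∀ f D R ν μ, Frame f D R ν μ → ∀ b, Bdd ν.next b →
    List.Forall₂ (Corr ν.next f D R) (h b ν) (h (ren f b) μ)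

theorem forall₂_flatMap {ι κ ι' κ' : Type} {P : ι → ι' → Prop} {Q : κ → κ' → Prop} {g : ι → List κ}
    {g' : ι' → List κ'} (hg : ∀ a a', P a a' → List.Forall₂ Q (g a) (g' a')) {l : List ι}
    {l' : List ι'} (hl : List.Forall₂ P l l') : List.Forall₂ Q (l.flatMap g) (l'.flatMap g') := by
  induction hl with
  | nil => exact .nil
  | cons h _ ih => exact List.rel_append (hg _ _ h) ih

theorem Equi.pure {g : β → α} (hg : Eqv g) : Equi fun b => (pure (g b) : QM α) :=
  fun f _ _ _ _ h _ hb => .cons ⟨f, fun _ _ => rfl, le_rfl, hg.bdd hb, (hg _ _).symm, h⟩ .nil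

theorem Equi.comp {h : β → QM α} (hh : Equi h) {g : γ → β} (hg : Eqv g) : Equi fun c => h (g c) :=
  fun f D R ν μ hF c hc => by
    dsimp only
    rw [← hg]
    exact hh f D R ν μ hF (g c) (hg.bdd hc)

/-- The input `b` is still available to `h`, so it must keep its meaning while `m` allocates qubits.
This holds because the new renaming extends the old one on the names below `ν.next`. -/
theorem Equi.bind {m : β → QM α} {h : β → α → QM γ} (hm : Equi m)
    (hh : Equi fun p : β × α => h p.1 p.2) : Equi fun b => m b >>= h b := by
  intro f D R ν μ hF b hb
  dsimp only
  rw [QM.bind_apply, QM.bind_apply]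
  refine forall₂_flatMap (fun r r' hr => ?_) (hm f D R ν μ hF b hb)
  obtain ⟨f', hf, hN, hB, he, hF'⟩ := hr
  have := hh f' D R r.2 r'.2 hF' (b, r.1) ((hb.mono hN).pair hB)
  rw [ren_pair, ← he, hb f' f hf] at this
  refine this.imp fun s s' ⟨f'', hf'', hN', hs⟩ => ⟨f'', fun x hx => ?_, hN.trans hN', hs⟩
  rw [hf'' x (hx.trans_le hN), hf x hx]

theorem Equi.noQubits {δ : Type} [NoQubits δ] {h : δ → β → QM α} (hh : ∀ d, Equi (h d)) :
    Equi fun p : δ × β => h p.1 p.2 := fun f D R ν μ hF p hp => by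
  have := hh p.1 f D R ν μ hF p.2 hp.snd
  rwa [show ren f p = (p.1, ren f p.2) from Prod.ext (NoQubits.ren_eq f p.1) rfl]

theorem Equi.foldlM {ι : Type} {f : β → α → ι → QM α}
    (hf : ∀ i, Equi fun p : β × α => f p.1 p.2 i) (l : List ι) :
    Equi fun p : β × α => l.foldlM (f p.1) p.2 := by
  induction l with
  | nil => exact Equi.pure (g := Prod.snd) fun _ _ => rfl
  | cons i l ih =>
    simp only [List.foldlM_cons]
    exact (hf i).bind (ih.comp (g := fun p : (β × α) × α => (p.1.1, p.2)) fun _ _ => rfl)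

end

/-! ## Programs are equivariant -/

theorem support_hadamard {i N : ℕ} (hi : i < N) {ψ : Finset ℕ →₀ ℂ}
    (h : ∀ S ∈ ψ.support, ∀ x ∈ S, x < N) : ∀ S ∈ (hadamard i ψ).support, ∀ x ∈ S, x < N := by
  intro S hS x hx
  rw [Finsupp.mem_support_iff, hadamard_apply] at hS
  by_cases h1 : ψ S = 0
  · have h2 : ψ (symmDiff S {i}) ≠ 0 := fun h2 => hS (by simp [h1, h2])
    by_cases hxi : x = i
    · exact hxi ▸ hi
    · exact h _ (Finsupp.mem_support_iff.2 h2) x (by simp [Finset.mem_symmDiff, hx, hxi])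
  · exact h S (Finsupp.mem_support_iff.2 h1) x hx

theorem support_tGate {i N : ℕ} {ψ : Finset ℕ →₀ ℂ}
    (h : ∀ S ∈ ψ.support, ∀ x ∈ S, x < N) : ∀ S ∈ (tGate i ψ).support, ∀ x ∈ S, x < N := by
  intro S hS
  rw [Finsupp.mem_support_iff, tGate_apply] at hS
  exact h S (Finsupp.mem_support_iff.2 (left_ne_zero_of_mul hS))

theorem cnot_eq_mapDomain (i j : ℕ) (ψ : Finset ℕ →₀ ℂ) : QPuzzle.cnot i j ψ =
    ψ.mapDomain fun S => if i ≠ j ∧ i ∈ S then symmDiff S {j} else S := by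
  induction ψ using Finsupp.induction_linear with
  | zero => simp
  | add a b ha hb => simp only [map_add, Finsupp.mapDomain_add, ha, hb]
  | single Q a => simp [QPuzzle.cnot, Finsupp.linearCombination_single, Finsupp.mapDomain_single]

theorem support_cnot {i j N : ℕ} (hj : j < N) {ψ : Finset ℕ →₀ ℂ}
    (h : ∀ S ∈ ψ.support, ∀ x ∈ S, x < N) :
    ∀ S ∈ (QPuzzle.cnot i j ψ).support, ∀ x ∈ S, x < N := by
  intro S hS x hx
  rw [cnot_eq_mapDomain] at hS
  obtain ⟨S', hS', rfl⟩ := Finset.mem_image.1 (Finsupp.mapDomain_support hS)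
  split_ifs at hx with hc
  · rw [Finset.mem_symmDiff, Finset.mem_singleton] at hx
    rcases hx with hx | hx
    exacts [h _ hS' x hx.1, hx.1 ▸ hj]
  · exact h _ hS' x hx

theorem support_project {i N : ℕ} {b : Bool} {ψ : Finset ℕ →₀ ℂ}
    (h : ∀ S ∈ ψ.support, ∀ x ∈ S, x < N) : ∀ S ∈ (project i b ψ).support, ∀ x ∈ S, x < N := by
  intro S hS
  rw [project, Finsupp.support_filter] at hS
  exact h S (Finset.mem_of_mem_filter _ hS)

section
variable {f : ℕ ↪ ℕ} {D : Set ℕ} {R : Finset ℕ →₀ ℂ} {ν μ : QMem}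

theorem Corr.same {α : Type} [Nom α] (h : Frame f D R ν μ) {a : α} (ha : Bdd ν.next a) {a' : α}
    (he : a' = ren f a) {ψ ψ' : Finset ℕ →₀ ℂ} (hg : ∀ S ∈ ψ.support, ∀ x ∈ S, x < ν.next)
    (hψ : ψ' = embed f R ψ) : Corr ν.next f D R (a, ⟨ν.next, ψ⟩) (a', ⟨μ.next, ψ'⟩) :=
  ⟨f, fun _ _ => rfl, le_rfl, ha, he, h.gate hg hψ⟩

theorem Corr.refl {α : Type} [Nom α] (h : Frame f D R ν μ) {a : α} (ha : Bdd ν.next a) {a' : α}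
    (he : a' = ren f a) : Corr ν.next f D R (a, ν) (a', μ) :=
  ⟨f, fun _ _ => rfl, le_rfl, ha, he, h⟩

theorem ren_stack {g : ℕ → ℕ} {σ : Store} {x : ℕ} {w : List Cell} (h : σ x = w) :
    (ren g σ : Store) x = ren g w := by rw [← h]; rfl

/-- An instruction touches only qubits named in its stacks. These have been allocated, so their
images avoid `D`, and gates and measurements act on one factor of the product. A new qubit extends
the renaming by `Frame.new`. -/
theorem Instr.equi (a : Instr) : Equi fun σ : Store => (fun μ => a.apply σ μ : QM Store) := by
  intro f D R ν μ h σ hσ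
  cases a with
  | push x b =>
    exact .cons (.refl h (hσ.update (Bdd.cons_iff.2 ⟨fun _ _ _ => rfl, hσ.stack x⟩))
      (by rw [ren_update]; rfl)) .nil
  | pop x =>
    refine .cons (.refl h (hσ.update ?_) ?_) .nil
    · have := hσ.stack x
      cases hx : σ x with
      | nil => exact fun _ _ _ => rfl
      | cons c w => rw [hx] at this; exact (Bdd.cons_iff.1 this).2
    · rw [ren_update]
      congr 1
      exact (List.map_tail ..).symm
  | move x y =>
    have hx := hσ.stack x
    cases e : σ x with
    | nil =>
      simp only [Instr.apply, e, ren_stack e, ren_nil]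
      exact .cons (.refl h hσ rfl) .nil
    | cons c w =>
      rw [e, Bdd.cons_iff] at hx
      simp only [Instr.apply, e, ren_stack e, ren_cons]
      have h1 := hσ.update (r := x) hx.2
      refine .cons (.refl h (h1.update (Bdd.cons_iff.2 ⟨hx.1, h1.stack y⟩)) ?_) .nil
      rw [← ren_update, ren_update _ (Function.update σ x w)]
      rfl
  | new x =>
    obtain ⟨f', h1, h2, hF⟩ := h.new
    refine .cons ⟨f', h1, Nat.le_succ _, ?_, ?_, hF⟩ .nil
    · refine (hσ.mono (Nat.le_succ _)).update (Bdd.cons_iff.2 ⟨fun g g' hg => ?_,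
        (hσ.stack x).mono (Nat.le_succ _)⟩)
      exact congrArg Cell.qubit (hg _ (Nat.lt_succ_self _))
    · rw [ren_update, hσ f' f h1, ren_cons, (hσ.stack x) f' f h1]
      simp only [ren, h2]
  | had x =>
    have hx := hσ.stack x
    rcases e : σ x with _ | ⟨_ | i, w⟩
    · simp only [Instr.apply, e, ren_stack e, ren_nil]
      exact .cons (.refl h hσ rfl) .nil
    · simp only [Instr.apply, e, ren_stack e, ren_cons, ren_bit]
      exact .cons (.refl h hσ rfl) .nil
    · rw [e, Bdd.cons_iff] at hx
      have hi := hx.1.qubit_lt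
      simp only [Instr.apply, e, ren_stack e, ren_cons, ren_qubit]
      exact .cons (.same h hσ rfl (support_hadamard hi h.good)
        (by rw [h.state, hadamard_embed (h.notMem hi)])) .nil
  | tgate x =>
    have hx := hσ.stack x
    rcases e : σ x with _ | ⟨_ | i, w⟩
    · simp only [Instr.apply, e, ren_stack e, ren_nil]
      exact .cons (.refl h hσ rfl) .nil
    · simp only [Instr.apply, e, ren_stack e, ren_cons, ren_bit]
      exact .cons (.refl h hσ rfl) .nil
    · rw [e, Bdd.cons_iff] at hx
      have hi := hx.1.qubit_lt
      simp only [Instr.apply, e, ren_stack e, ren_cons, ren_qubit]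
      exact .cons (.same h hσ rfl (support_tGate h.good)
        (by rw [h.state, tGate_embed (h.notMem hi)])) .nil
  | cnot x y =>
    have hx := hσ.stack x
    have hy := hσ.stack y
    rcases e : σ x with _ | ⟨_ | i, w⟩
    · simp only [Instr.apply, e, ren_stack e, ren_nil]
      exact .cons (.refl h hσ rfl) .nil
    · simp only [Instr.apply, e, ren_stack e, ren_cons, ren_bit]
      exact .cons (.refl h hσ rfl) .nil
    · rw [e, Bdd.cons_iff] at hx
      have hi := hx.1.qubit_lt
      rcases e' : σ y with _ | ⟨_ | j, v⟩
      · simp only [Instr.apply, e, e', ren_stack e, ren_stack e', ren_nil]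
        exact .cons (.refl h hσ rfl) .nil
      · simp only [Instr.apply, e, e', ren_stack e, ren_stack e', ren_cons,
          ren_bit]
        exact .cons (.refl h hσ rfl) .nil
      · rw [e', Bdd.cons_iff] at hy
        have hj := hy.1.qubit_lt
        simp only [Instr.apply, e, e', ren_stack e, ren_stack e', ren_cons,
          ren_qubit]
        exact .cons (.same h hσ rfl (support_cnot hj h.good)
          (by rw [h.state, cnot_embed (h.notMem hi) (h.notMem hj)])) .nil
  | meas x =>
    have hx := hσ.stack x
    rcases e : σ x with _ | ⟨_ | i, w⟩
    · simp only [Instr.apply, e, ren_stack e, ren_nil]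
      exact .cons (.refl h hσ rfl) .nil
    · simp only [Instr.apply, e, ren_stack e, ren_cons, ren_bit]
      exact .cons (.refl h hσ rfl) .nil
    · rw [e, Bdd.cons_iff] at hx
      have hi := hx.1.qubit_lt
      simp only [Instr.apply, e, ren_stack e, ren_cons, ren_qubit]
      have hb : ∀ b, Corr ν.next f D R (Function.update σ x (.bit b :: w), ⟨ν.next, project i b ν.ψ⟩)
          (Function.update (ren f σ) x (.bit b :: ren f w), ⟨μ.next, project (f i) b μ.ψ⟩) := fun b =>
        .same h (hσ.update (Bdd.cons_iff.2 ⟨fun _ _ _ => rfl, hx.2⟩)) (by rw [ren_update]; rfl)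
          (support_project h.good) (by rw [h.state, project_embed (h.notMem hi)])
      exact .cons (hb false) (.cons (hb true) .nil)

/-- Corresponding configurations. -/
def CorrConfig (N : ℕ) (f : ℕ ↪ ℕ) (D : Set ℕ) (R : Finset ℕ →₀ ℂ) (c c' : Config) : Prop :=
  c'.todo = c.todo ∧ Corr N f D R (c.store, c.mem) (c'.store, c'.mem)

theorem CorrConfig.step {N : ℕ} {c c' : Config} (h : CorrConfig N f D R c c') :
    List.Forall₂ (CorrConfig N f D R) c.step c'.step := by
  obtain ⟨K, σ, ν⟩ := c
  obtain ⟨K', σ', μ⟩ := c'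
  obtain ⟨hK, f', hf, hN, hB, he, hF⟩ := h
  dsimp only at hK hN hB he hF
  subst hK he
  have hsame : ∀ K, CorrConfig N f D R ⟨K, σ, ν⟩ ⟨K, ren f' σ, μ⟩ :=
    fun K => ⟨rfl, f', hf, hN, hB, rfl, hF⟩
  have htop : ∀ x, topOf ((ren f' σ : Store) x) = topOf (σ x) := fun x => topOf_ren _ _
  rcases K' with _ | ⟨p, K⟩
  · exact .cons (hsame _) .nil
  · cases p with
    | skip => exact .cons (hsame _) .nil
    | instr a =>
      refine List.forall₂_map_left_iff.2 (List.forall₂_map_right_iff.2 ?_)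
      refine (a.equi f' D R ν μ hF σ hB).imp fun r r' ⟨f'', hf'', hN', hr⟩ =>
        ⟨rfl, f'', fun x hx => ?_, hN.trans hN', hr⟩
      rw [hf'' x (hx.trans_le hN), hf x hx]
    | seq p q => exact .cons (hsame _) .nil
    | ite x s p q =>
      simp only [Config.step, htop]
      exact .cons (hsame _) .nil
    | loop x s p =>
      simp only [Config.step, htop]
      exact .cons (hsame _) .nil

theorem CorrConfig.run {N : ℕ} {c c' : Config} (h : CorrConfig N f D R c c') (T : ℕ) :
    List.Forall₂ (CorrConfig N f D R) (c.run T) (c'.run T) := by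
  induction T with
  | zero => exact .cons h .nil
  | succ T ih => exact forall₂_flatMap (fun _ _ h => h.step) ih

end

/-- This is the only place where programs are examined. Every later statement about independence is
derived from it by composition. -/
theorem QPTAlg.equi_exec (B : QPTAlg) (sec : ℕ) :
    Equi fun p : List Cell × List Cell => B.exec sec p.1 p.2 := by
  intro f D R ν μ h p hp
  have h0 : ren f (inputStore sec p.1 p.2) = inputStore sec (ren f p.1) (ren f p.2) := by
    funext r
    simp only [inputStore, ren_apply]
    split_ifs <;> simp [ren]
  have hB : Bdd ν.next (inputStore sec p.1 p.2) := by
    intro g g' hg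
    funext r
    have h1 : (ren g p.1, ren g p.2) = (ren g' p.1, ren g' p.2) := hp g g' hg
    simp only [Prod.mk.injEq, ren] at h1
    simp only [inputStore, ren]
    split_ifs <;> simp [h1]
  have h1 := CorrConfig.run (N := ν.next) (c := startConfig B.prog sec p.1 p.2 ν)
    (c' := startConfig B.prog sec (ren f p.1) (ren f p.2) μ)
    ⟨rfl, f, fun _ _ => rfl, le_rfl, hB, h0.symm, h⟩ (B.time.eval (sec + p.1.length + p.2.length))
  have hl : ∀ w : List Cell, (ren f w).length = w.length := fun w => List.length_map _
  simp only [QPTAlg.exec]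
  rw [show (ren f p).1 = ren f p.1 from rfl, show (ren f p).2 = ren f p.2 from rfl, hl, hl]
  refine List.forall₂_map_left_iff.2 (List.forall₂_map_right_iff.2 (h1.imp ?_))
  rintro c c' ⟨-, f', hf, hN, hb, he, hF⟩
  exact ⟨f', hf, hN, hb.stack 3, congrFun he 3, hF⟩

open Nom (ren)

/-! ## Expectations -/

/-- The sum of `φ` over all results of `m`. -/
noncomputable def wp {α : Type} (m : QM α) (φ : α → QMem → ℝ) (μ : QMem) : ℝ :=
  ((m μ).map fun r => φ r.1 r.2).sum

theorem wp_bind {α β : Type} (m : QM α) (h : α → QM β) (φ : β → QMem → ℝ) (μ : QMem) :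
    wp (m >>= h) φ μ = wp m (fun a => wp (h a) φ) μ := by
  simp only [wp, QM.bind_apply]
  generalize m μ = l
  induction l with
  | nil => rfl
  | cons r l ih => rw [List.flatMap_cons, List.map_append, List.sum_append, ih]; simp

theorem wp_pure {α : Type} (a : α) (φ : α → QMem → ℝ) (μ : QMem) :
    wp (pure a : QM α) φ μ = φ a μ := by
  simp [wp, QM.pure_apply]

theorem wp_map {α β : Type} (m : QM α) (h : α → β) (φ : β → QMem → ℝ) (μ : QMem) :
    wp (h <$> m) φ μ = wp m (fun a => φ (h a)) μ := by
  simp only [wp, QM.map_apply, List.map_map]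
  rfl

theorem wp_add {α : Type} (m : QM α) (φ φ' : α → QMem → ℝ) (μ : QMem) :
    wp m (fun a ν => φ a ν + φ' a ν) μ = wp m φ μ + wp m φ' μ := by
  simp only [wp, List.sum_map_add]

theorem wp_const_mul {α : Type} (m : QM α) (c : ℝ) (φ : α → QMem → ℝ) (μ : QMem) :
    wp m (fun a ν => c * φ a ν) μ = c * wp m φ μ := by
  simp only [wp, List.sum_map_mul_left]

theorem wp_mono {α : Type} {m : QM α} {φ φ' : α → QMem → ℝ} {μ : QMem}
    (h : ∀ a ν, φ a ν ≤ φ' a ν) : wp m φ μ ≤ wp m φ' μ :=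
  List.sum_le_sum fun r _ => h r.1 r.2

theorem prob_eq_wp (m : QM Bool) :
    prob m = wp m (fun b μ => if b = true then μ.weight else 0) .vacuum := rfl

theorem weight_nonneg (μ : QMem) : 0 ≤ μ.weight := nsq_nonneg μ.ψ

theorem weight_vacuum : QMem.vacuum.weight = 1 := by
  show nsq _ = 1
  simp [QMem.vacuum, nsq_single]

theorem sum_forall₂ {ι κ : Type} {P : ι → κ → Prop} {F : ι → ℝ} {G : κ → ℝ}
    (h : ∀ a b, P a b → F a = G b) {l : List ι} {l' : List κ} (hl : List.Forall₂ P l l') :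
    (l.map F).sum = (l'.map G).sum := by
  induction hl with
  | nil => rfl
  | cons h1 _ ih => simp [h _ _ h1, ih]

theorem forall₂_left {ι κ : Type} {P : ι → κ → Prop} {Q : ι → Prop} (h : ∀ a b, P a b → Q a)
    {l : List ι} {l' : List κ} (hl : List.Forall₂ P l l') : ∀ a ∈ l, Q a := by
  induction hl with
  | nil => simp
  | cons h1 _ ih => simpa using ⟨h _ _ h1, ih⟩

/-! ## Trace preservation -/

def TP {α : Type} (m : QM α) : Prop := ∀ μ, wp m (fun _ ν => ν.weight) μ = μ.weight

section
variable {α β : Type}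

theorem TP.pure (a : α) : TP (pure a : QM α) := fun _ => wp_pure _ _ _

theorem TP.bind {m : QM α} {h : α → QM β} (hm : TP m) (hh : ∀ a, TP (h a)) : TP (m >>= h) :=
  fun μ => by
    rw [wp_bind, ← hm μ]
    exact congrArg (fun φ => wp m φ μ) (funext fun a => funext fun ν => hh a ν)

theorem TP.foldlM {ι : Type} {f : α → ι → QM α} (hf : ∀ a i, TP (f a i)) :
    ∀ (l : List ι) (a : α), TP (l.foldlM f a)
  | [], a => TP.pure a
  | i :: l, a => by
    rw [List.foldlM_cons]
    exact (hf a i).bind fun a' => TP.foldlM hf l a'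

theorem TP.mapM {ι : Type} {f : ι → QM α} (hf : ∀ i, TP (f i)) : ∀ l : List ι, TP (l.mapM f)
  | [] => by rw [List.mapM_nil]; exact TP.pure _
  | i :: l => by
    rw [List.mapM_cons]
    exact (hf i).bind fun a => (TP.mapM hf l).bind fun _ => TP.pure _

end

theorem Instr.tp (a : Instr) (σ : Store) : TP (fun μ => a.apply σ μ : QM Store) := by
  intro μ
  have hw : ∀ (N : ℕ) ψ, (QMem.mk N ψ).weight = nsq ψ := fun _ _ => rfl
  cases a <;> simp only [wp, Instr.apply] <;> (try split) <;>
    simp [hw, nsq_hadamard, nsq_tGate, nsq_cnot, nsq_project]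

theorem Config.step_weight (c : Config) :
    (c.step.map fun c' => c'.mem.weight).sum = c.mem.weight := by
  obtain ⟨K, σ, μ⟩ := c
  rcases K with _ | ⟨p, K⟩
  · simp [Config.step]
  · cases p with
    | instr a =>
      have := a.tp σ μ
      simp only [wp] at this
      simp only [Config.step, List.map_map]
      exact this
    | skip => simp [Config.step]
    | seq p q => simp [Config.step]
    | ite x s p q => simp [Config.step]
    | loop x s p => simp [Config.step]

theorem Config.run_weight (c : Config) (T : ℕ) :
    ((c.run T).map fun c' => c'.mem.weight).sum = c.mem.weight := by
  induction T with
  | zero => simp [Config.run]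
  | succ T ih =>
    rw [← ih, Config.run]
    generalize c.run T = l
    induction l with
    | nil => rfl
    | cons c' l ih' =>
      rw [List.flatMap_cons, List.map_append, List.sum_append, ih', Config.step_weight]
      simp

theorem QPTAlg.tp_exec (B : QPTAlg) (sec : ℕ) (x y : List Cell) : TP (B.exec sec x y) := fun μ => by
  simp only [wp, QPTAlg.exec, List.map_map]
  exact Config.run_weight _ _

/-! ## Invariant functions -/

/-- The function does not depend on the names of qubits, and is multiplicative for products. -/
def Inv {α : Type} [Nom α] (φ : α → QMem → ℝ) : Prop :=
  ∀ f D R ν μ, Frame f D R ν μ → ∀ a, Bdd ν.next a → φ (ren f a) μ = φ a ν * nsq R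

section
variable {α β γ δ : Type} [Nom α] [Nom β] [Nom γ] [NoQubits δ]

/-- The results in the small and in the large memory correspond one by one, and each pair of
corresponding summands differs by the same factor `nsq R`. -/
theorem Inv.wp {h : β → QM α} (hh : Equi h) {φ : β → α → QMem → ℝ}
    (hφ : Inv fun p : β × α => φ p.1 p.2) : Inv fun b => wp (h b) (φ b) := by
  intro f D R ν μ hF b hb
  simp only [QPuzzle.wp]
  rw [← List.sum_map_mul_right]
  refine (sum_forall₂ (fun r r' ⟨f', hf, hN, hB, he, hF'⟩ => ?_) (hh f D R ν μ hF b hb)).symm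
  rw [← hφ f' D R r.2 r'.2 hF' (b, r.1) ((hb.mono hN).pair hB), ren_pair, ← he, hb f' f hf]

theorem Inv.comp {φ : β → QMem → ℝ} (hφ : Inv φ) {g : α → β} (hg : Eqv g) :
    Inv fun a => φ (g a) := fun f D R ν μ hF a ha => by
  dsimp only
  rw [← hg]
  exact hφ f D R ν μ hF _ (hg.bdd ha)

theorem Inv.weight {g : α → ℝ} (hg : ∀ f a, g (ren f a) = g a) :
    Inv fun a (μ : QMem) => g a * μ.weight := fun f D R ν μ hF a _ => by
  dsimp only
  rw [hg, hF.weight_eq, mul_assoc]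

/-- The memory as a whole is a frame around the empty memory, so data without qubits see it only
through its weight. -/
theorem Inv.closed {φ : α → QMem → ℝ} (hφ : Inv φ) {μ : QMem} (hμ : μ.Good) {a : α} (ha : Bdd 0 a) :
    φ a μ = φ a .vacuum * μ.weight := by
  have := hφ _ _ _ _ _ (Frame.vacuum hμ) a ha
  rwa [ha.ren_eq (f := Function.Embedding.refl ℕ) fun _ _ => rfl] at this

theorem Equi.good {h : β → QM α} (hh : Equi h) {μ : QMem} (hμ : μ.Good) {b : β} (hb : Bdd μ.next b) :
    ∀ r ∈ h b μ, r.2.Good ∧ μ.next ≤ r.2.next ∧ Bdd r.2.next r.1 :=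
  forall₂_left (fun _ _ ⟨_, _, hN, hB, _, hF⟩ => ⟨hF.good, hN, hB⟩)
    (hh _ _ _ _ _ (Frame.of_good hμ) b hb)

theorem wp_congr {h : β → QM α} (hh : Equi h) {μ : QMem} (hμ : μ.Good) {b : β} (hb : Bdd μ.next b)
    {φ φ' : α → QMem → ℝ}
    (hφ : ∀ a ν, ν.Good → μ.next ≤ ν.next → Bdd ν.next a → φ a ν = φ' a ν) :
    wp (h b) φ μ = wp (h b) φ' μ := by
  have := hh.good hμ hb
  exact congrArg List.sum (List.map_congr_left fun r hr =>
    hφ _ _ (this r hr).1 (this r hr).2.1 (this r hr).2.2)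

/-! ## Independent procedures commute -/

theorem exists_embedding {N : ℕ} {g : ℕ → ℕ} (hg : ∀ x < N, ∀ y < N, g x = g y → x = y) :
    ∃ u : ℕ ↪ ℕ, ∀ x < N, u x = g x := by
  obtain ⟨B, hB⟩ : ∃ B, ∀ x < N, g x ≤ B := ⟨∑ y ∈ Finset.range N, g y, fun x hx =>
    Finset.single_le_sum (f := g) (fun _ _ => Nat.zero_le _) (Finset.mem_range.2 hx)⟩
  -- Names outside the given range are sent above the bound `B` of all prescribed values, which
  -- keeps the extension injective.
  refine ⟨⟨fun x => if x < N then g x else x + B + 1, fun x y h => ?_⟩, fun x hx => if_pos hx⟩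
  replace h : (if x < N then g x else x + B + 1) = if y < N then g y else y + B + 1 := h
  by_cases hx : x < N <;> by_cases hy : y < N
  · rw [if_pos hx, if_pos hy] at h
    exact hg x hx y hy h
  · rw [if_pos hx, if_neg hy] at h
    have := hB x hx
    omega
  · rw [if_neg hx, if_pos hy] at h
    have := hB y hy
    omega
  · rw [if_neg hx, if_neg hy] at h
    omega

def shiftBy (N : ℕ) : ℕ ↪ ℕ := ⟨fun x => x + N, fun _ _ h => Nat.add_right_cancel h⟩

/-- Two independent memories. -/
noncomputable def juxtapose (ξ ν : QMem) : QMem :=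
  ⟨ν.next + ξ.next, embed (shiftBy ξ.next) ξ.ψ ν.ψ⟩

theorem frame_juxtapose {ξ ν : QMem} (hξ : ξ.Good) (hν : ν.Good) :
    Frame (shiftBy ξ.next) {x | x < ξ.next} ξ.ψ ν (juxtapose ξ ν) where
  good := hν
  rest := hξ
  names x := by
    show x < ν.next + ξ.next ↔ x < ξ.next ∨ ∃ y < ν.next, y + ξ.next = x
    constructor
    · intro hx
      by_cases h : x < ξ.next
      · exact .inl h
      · exact .inr ⟨x - ξ.next, by omega, by omega⟩
    · rintro (h | ⟨y, hy, rfl⟩) <;> omega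
  disj y hy := by
    show ¬ y + ξ.next < ξ.next
    omega
  state := rfl

/-- If `μ` is composed of a part coming from `ν` and one coming from `ξ`, it equals their
juxtaposition up to names. This provides a normal form that does not depend on which part was
produced first. -/
theorem exists_joint {f' fν : ℕ ↪ ℕ} {ξ ν μ : QMem} (hν : ν.Good)
    (h : Frame f' {x | ∃ y < ν.next, fν y = x} (ν.ψ.mapDomain (Finset.map fν)) ξ μ) :
    ∃ u : ℕ ↪ ℕ, (∀ x < ξ.next, u x = f' x) ∧ (∀ y < ν.next, u (y + ξ.next) = fν y) ∧
      Frame u ∅ (.single ∅ 1) (juxtapose ξ ν) μ := by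
  obtain ⟨u, hu⟩ := exists_embedding (N := ν.next + ξ.next)
    (g := fun x => if x < ξ.next then f' x else fν (x - ξ.next)) (by
      intro x hx y hy e
      split_ifs at e with h1 h2 h2
      · exact f'.injective e
      · exact absurd ⟨y - ξ.next, by omega, e.symm⟩ (h.disj x h1)
      · exact absurd ⟨x - ξ.next, by omega, e⟩ (h.disj y h2)
      · have := fν.injective e
        omega)
  have hu1 : ∀ x < ξ.next, u x = f' x := fun x hx => by rw [hu x (by omega), if_pos hx]
  have hu2 : ∀ y < ν.next, u (y + ξ.next) = fν y := fun y hy => by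
    rw [hu _ (by omega), if_neg (by omega), Nat.add_sub_cancel]
  have hgood := (frame_juxtapose h.good hν).good_right
  refine ⟨u, hu1, hu2, hgood, (Frame.of_good hgood).rest, fun x => ?_, fun _ _ hm => hm.elim, ?_⟩
  · rw [h.names]
    simp only [Set.mem_ofPred_eq, Set.mem_empty_iff_false, false_or]
    constructor
    · rintro (⟨y, hy, rfl⟩ | ⟨y, hy, rfl⟩)
      · exact ⟨y + ξ.next, by simp only [juxtapose]; omega, hu2 y hy⟩
      · exact ⟨y, by simp only [juxtapose]; omega, hu1 y hy⟩
    · rintro ⟨z, hz, rfl⟩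
      by_cases h1 : z < ξ.next
      · exact .inr ⟨z, h1, (hu1 z h1).symm⟩
      · refine .inl ⟨z - ξ.next, by simp only [juxtapose] at hz; omega, ?_⟩
        rw [← hu2 _ (by simp only [juxtapose] at hz; omega), Nat.sub_add_cancel (by omega)]
  · rw [h.state, embed_single, juxtapose, embed_eq_sum, embed_eq_sum, Finsupp.sum_mapDomain_index
      (by simp) (by intros; simp only [add_mul, Finsupp.single_add, Finsupp.sum_add]),
      Finsupp.mapDomain_sum, Finsupp.sum_comm]
    refine Finset.sum_congr rfl fun Q hQ => ?_
    dsimp only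
    rw [Finsupp.mapDomain_sum]
    refine Finset.sum_congr rfl fun S hS => ?_
    dsimp only
    rw [Finsupp.mapDomain_single, Finset.map_union, Finset.map_map, Finset.union_comm, mul_comm]
    congr 2
    · ext x
      simp only [Finset.mem_map, Function.Embedding.trans_apply]
      exact exists_congr fun y => and_congr_right fun hy => by
        rw [show shiftBy ξ.next y = y + ξ.next from rfl, hu2 y (hν S hS y hy)]
    · ext x
      simp only [Finset.mem_map]
      exact exists_congr fun y => and_congr_right fun hy => by rw [hu1 y (h.good Q hQ y hy)]

/-- A procedure without inputs commutes with any other one. -/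
theorem wp_comm {g : QM α} (hg : Equi fun _ : Unit => g) {m : β → QM γ} (hm : Equi m)
    {φ : β → α → γ → QMem → ℝ} (hφ : Inv fun p : β × α × γ => φ p.1 p.2.1 p.2.2) {μ : QMem}
    (hμ : μ.Good) {b : β} (hb : Bdd μ.next b) :
    wp g (fun a => wp (m b) (φ b a)) μ = wp (m b) (fun c => wp g fun a => φ b a c) μ := by
  -- In either order, the value of `φ` on a pair of outcomes is its value on the juxtaposition of an
  -- outcome of `g` in the empty memory and one of `m b` in `μ`.
  have key : ∀ {s : α} {ν : QMem} {c : γ} {ξ μ₂ : QMem} {f' fν : ℕ ↪ ℕ}, ν.Good → Bdd ν.next s →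
      Bdd ξ.next c → μ.next ≤ ξ.next → (∀ x < μ.next, f' x = x) →
      Frame f' {x | ∃ y < ν.next, fν y = x} (ν.ψ.mapDomain (Finset.map fν)) ξ μ₂ →
      φ b (ren fν s) (ren f' c) μ₂ = φ b (ren (shiftBy ξ.next) s) c (juxtapose ξ ν) := by
    intro s ν c ξ μ₂ f' fν hν hs hc hle hf' hF
    obtain ⟨u, hu1, hu2, hu⟩ := exists_joint hν hF
    have hN : ∀ y < ν.next, shiftBy ξ.next y < (juxtapose ξ ν).next := fun y hy => by
      show y + ξ.next < ν.next + ξ.next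
      omega
    have := hφ _ _ _ _ _ hu (b, ren (shiftBy ξ.next) s, c)
      ((hb.mono (by simp only [juxtapose]; omega)).pair ((hs.rename hN).pair
        (hc.mono (by simp only [juxtapose]; omega))))
    simp only [ren_pair, Nom.ren_ren, nsq_single, norm_one, one_pow, mul_one] at this
    rw [hb.ren_eq fun x hx => (hu1 x (by omega)).trans (hf' x hx), hc u f' hu1,
      hs (fun x => u (shiftBy ξ.next x)) fν hu2] at this
    exact this
  have hg' := fun ξ (hξ : QMem.Good ξ) => hg _ _ _ _ _ (Frame.vacuum hξ) () (Bdd.of_noQubits _ _)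
  have hbr : ren (Function.Embedding.refl ℕ) b = b := hb.ren_eq fun _ _ => rfl
  let K (s : α × QMem) (r : γ × QMem) : ℝ :=
    φ b (ren (shiftBy r.2.next) s.1) r.1 (juxtapose r.2 s.2)
  -- Here `g` runs first: its outcomes are compared with those in the empty memory, and `Frame.swap`
  -- then makes `μ` the memory on which `m b` acts. For `h2` the roles are interchanged, and what
  -- remains is to exchange two finite sums.
  have h1 : wp g (fun a => wp (m b) (φ b a)) μ =
      ((g .vacuum).map fun s => ((m b μ).map fun r => K s r).sum).sum := by
    refine (sum_forall₂ (fun s s' ⟨fν, _, _, hs, he, hF⟩ => ?_) (hg' μ hμ)).symm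
    have hF' := hF.swap hμ
    have hm' := hm _ _ _ _ _ hF' b hb
    rw [hbr] at hm'
    refine sum_forall₂ (fun r r' ⟨f', hf', hN, hr, he', hF''⟩ => ?_) hm'
    rw [he, he']
    exact (key hF.good hs hr hN hf' hF'').symm
  have h2 : wp (m b) (fun c => wp g fun a => φ b a c) μ =
      ((m b μ).map fun r => ((g .vacuum).map fun s => K s r).sum).sum := by
    refine congrArg List.sum (List.map_congr_left fun r hr => ?_)
    obtain ⟨hr1, hr2, hr3⟩ := hm.good hμ hb r hr
    refine (sum_forall₂ (fun s s' ⟨fν, _, _, hs, he, hF⟩ => ?_) (hg' r.2 hr1)).symm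
    have hF' := hF.swap hr1
    have := key hF.good hs hr3 hr2 (fun _ _ => rfl) hF'
    rw [hr3.ren_eq (f := Function.Embedding.refl ℕ) fun _ _ => rfl] at this
    rw [he]
    exact this.symm
  rw [h1, h2]
  simpa using Multiset.sum_map_sum_map (g .vacuum : Multiset (α × QMem)) (m b μ) (f := K)

end
open Nom (ren)

/-! ## Equivariance of the reduction -/

section
variable {α β γ δ ι : Type} [Nom α] [Nom β] [Nom γ] [NoQubits δ]

theorem ren_unframe (f : ℕ → ℕ) (w : List Cell) :
    unframe (ren f w) = (ren f (unframe w).1, ren f (unframe w).2) := by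
  induction w using unframe.induct with
  | case1 => rfl
  | case2 c w ih =>
    simp only [ren_cons, ren_bit, unframe, ih]
  | case3 c w h =>
    rcases c with (_ | _) | i
    · rfl
    · cases w with
      | nil => rfl
      | cons c w => exact (h c w rfl rfl).elim
    · rfl

theorem ren_frame (f : ℕ → ℕ) (w : List Cell) : ren f (frame w) = frame (ren f w) := by
  rw [frame, frame, ren_append]
  congr 1
  induction w with
  | nil => rfl
  | cons c w ih =>
    rw [List.flatMap_cons, ren_append, ih]
    rfl

theorem ren_encode (f : ℕ → ℕ) (ws : List (List Cell)) : ren f (encode ws) = encode (ren f ws) := by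
  induction ws with
  | nil => rfl
  | cons w ws ih =>
    rw [ren_cons]
    simp only [encode, List.flatMap_cons] at ih ⊢
    rw [ren_append, ih, ren_frame]

theorem ren_map_bit (f : ℕ → ℕ) (k : List Bool) : ren f (k.map Cell.bit) = k.map Cell.bit := by
  show List.map _ _ = _
  rw [List.map_map]
  rfl

theorem bitsOf_ren (f : ℕ → ℕ) (w : List Cell) : bitsOf (ren f w) = bitsOf w := by
  show (List.map _ w).filterMap _ = _
  rw [List.filterMap_map]
  congr 1
  funext c
  cases c <;> rfl

theorem Eqv.const {c : δ} : Eqv fun _ : β => c := fun f _ => NoQubits.ren_eq f c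

theorem Equi.context {m : QM α} (h : Equi fun _ : Unit => m) : Equi fun _ : β => m :=
  h.comp (g := fun _ : β => ()) .const

theorem Equi.mapM {f : ι → QM α} (hf : ∀ i, Equi fun _ : Unit => f i) (l : List ι) :
    Equi fun _ : Unit => l.mapM f := by
  induction l with
  | nil => simp only [List.mapM_nil]; exact Equi.pure (g := fun _ => []) fun _ _ => rfl
  | cons i l ih =>
    simp only [List.mapM_cons]
    exact (hf i).bind (ih.context.bind (Equi.pure (g := fun p : (Unit × α) × List α => p.1.2 :: p.2)
      fun _ _ => rfl))

/-- For classical intermediate results, it suffices to look at each result. -/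
theorem Equi.bind_noQubits {m : β → QM δ} {h : β → δ → QM γ} (hm : Equi m)
    (hh : ∀ d, Equi fun b => h b d) : Equi fun b => m b >>= h b :=
  hm.bind ((Equi.noQubits hh).comp (g := fun p : β × δ => (p.2, p.1)) fun _ _ => rfl)

end

section
variable (W : WeaklyVerifiablePuzzle) (A : QPTAlg) (sec : ℕ)

theorem equi_newKey : Equi fun _ : Unit => W.newKey sec :=
  (((W.CheckGen.equi_exec sec).comp (g := fun _ : Unit => ([], [])) fun _ _ => rfl).bind
    (Equi.pure (g := fun p : Unit × List Cell => bitsOf p.2) fun f p => by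
      rw [NoQubits.ren_eq]; exact (bitsOf_ren f p.2).symm))

theorem equi_newPuzzle (k : List Bool) : Equi fun _ : Unit => W.newPuzzle sec k :=
  (W.PuzzleGen.equi_exec sec).comp (g := fun _ : Unit => (k.map Cell.bit, [])) fun f _ => by
    rw [ren_pair, ren_map_bit, ren_nil]

theorem equi_newPuzzles (ks : List (List Bool)) :
    Equi fun _ : Unit => ks.mapM (W.newPuzzle sec) := .mapM (equi_newPuzzle W sec) ks

theorem equi_accept (k : List Bool) : Equi fun ans => W.accept sec ans k :=
  ((W.Ver.equi_exec sec).comp (g := fun ans => (k.map Cell.bit, ans)) fun f _ => by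
    rw [ren_pair, ren_map_bit]).bind
    (Equi.pure (g := fun p : List Cell × List Cell => decide (topOf p.2 = .one)) fun f p => by
      rw [NoQubits.ren_eq]
      exact congrArg (fun s => decide (s = Top.one)) (topOf_ren f p.2).symm)

theorem equi_adversary : Equi fun X => A.exec sec X [] :=
  (A.equi_exec sec).comp (g := fun X => (X, [])) fun _ _ => rfl

theorem equi_verStep (k : List Bool) : Equi fun v => verStep W sec v k :=
  ((equi_accept W sec k).comp (g := fun v : Bool × List Cell => (unframe v.2).1) fun f v => by
    show ren f (unframe v.2).1 = (unframe (ren f v.2)).1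
    rw [ren_unframe]).bind
    (Equi.pure (g := fun p : (Bool × List Cell) × Bool => (p.1.1 && p.2, (unframe p.1.2).2))
      fun f p => by
      show (p.1.1 && p.2, ren f (unframe p.1.2).2) = (p.1.1 && p.2, (unframe (ren f p.1.2)).2)
      rw [ren_unframe])

theorem equi_verSteps (l : List (List Bool)) : Equi fun v => l.foldlM (verStep W sec) v :=
  (Equi.foldlM (β := Unit) (f := fun _ v k => verStep W sec v k)
    (fun k => (equi_verStep W sec k).comp (g := Prod.snd) fun _ _ => rfl) l).comp
    (g := fun v => ((), v)) fun _ _ => rfl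

theorem equi_sampleKeys (j : ℕ) : Equi fun _ : Unit => sampleKeys W sec j :=
  (Equi.foldlM (β := Unit) (f := fun _ P _ => do let k ← W.newKey sec; pure (k :: P))
    (fun _ => (equi_newKey W sec).context.bind_noQubits fun k =>
      Equi.pure (g := fun p : Unit × List (List Bool) => k :: p.2) fun f p => by
        rw [NoQubits.ren_eq, show ren f p = p from NoQubits.ren_eq f p]) _).comp
    (g := fun _ : Unit => ((), [])) fun _ _ => rfl

theorem equi_tupleStep (P S : List (List Bool)) : Equi fun a => tupleStep W sec P S a :=
  (equi_newPuzzles W sec P).context.bind ((equi_newPuzzles W sec S).context.bind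
    (Equi.pure (g := fun p : (((List Cell × List Cell) × List (List Cell)) × List (List Cell)) =>
      (p.1.1.1 ++ frame (encode (p.1.2 ++ (unframe p.1.1.2).1 :: p.2)), (unframe p.1.1.2).2))
      fun f p => by
      show (_, _) = (ren f p.1.1.1 ++ frame (encode (ren f p.1.2 ++ (unframe (ren f p.1.1.2)).1 ::
        ren f p.2)), (unframe (ren f p.1.1.2)).2)
      rw [ren_unframe, ren_append, ren_frame, ren_encode, ren_append, ren_cons]))

theorem equi_tupleSteps (t : ℕ) (P S : List (List Bool)) :
    Equi fun a => (List.replicate t ()).foldlM (fun a _ => tupleStep W sec P S a) a :=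
  (Equi.foldlM (β := Unit) (f := fun _ a _ => tupleStep W sec P S a)
    (fun _ => (equi_tupleStep W sec P S).comp (g := Prod.snd) fun _ _ => rfl) _).comp
    (g := fun v => ((), v)) fun _ _ => rfl

theorem equi_attempt (t j : ℕ) (S : List (List Bool)) : Equi fun B => attempt W A sec t j S B :=
  (equi_sampleKeys W sec j).context.bind_noQubits fun P =>
    ((equi_tupleSteps W sec t P S).comp (g := fun B => ([], B)) fun _ _ => rfl).bind
    (((equi_adversary A sec).comp (g := fun p : List Cell × (List Cell × List Cell) => p.2.1)
      fun _ _ => rfl).bind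
    (((equi_verSteps W sec P).comp (g := fun p : (List Cell × (List Cell × List Cell)) × List Cell =>
      (true, p.2)) fun _ _ => rfl).bind
    (Equi.pure (g := fun p : ((List Cell × (List Cell × List Cell)) × List Cell) ×
      (Bool × List Cell) => (p.2.1, p.2.2, p.1.1.2.2)) fun _ _ => rfl)))

theorem equi_realAttempt (t j : ℕ) (S : List (List Bool)) :
    Equi fun a => realAttempt W A sec t j S a := by
  have h : ∀ d : Bool, Equi fun p : List Cell × List Cell => realAttempt W A sec t j S (d, p) := by
    rintro (_ | _)
    · simp only [realAttempt, Bool.false_eq_true, if_false]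
      refine ((equi_attempt W A sec t j S).comp (g := fun p : List Cell × List Cell => p.1)
        fun _ _ => rfl).bind (Equi.pure (g := fun p : (List Cell × List Cell) × (Bool × List Cell ×
        List Cell) => (p.2.1, p.2.2.2, if p.2.1 then (unframe p.2.2.1).1 else p.1.2)) fun f p => ?_)
      rcases p with ⟨p, _ | _, q⟩
      · rfl
      · show (true, ren f q.2, ren f (unframe q.1).1) = (true, ren f q.2, (unframe (ren f q.1)).1)
        rw [ren_unframe]
    · simp only [realAttempt, if_true]
      exact Equi.pure (g := fun p => (true, p)) fun _ _ => rfl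
  exact Equi.noQubits h

theorem equi_realAttempts (N t j : ℕ) (S : List (List Bool)) :
    Equi fun a => (List.replicate N ()).foldlM (fun b _ => realAttempt W A sec t j S b) a :=
  (Equi.foldlM (β := Unit) (f := fun _ a _ => realAttempt W A sec t j S a)
    (fun _ => (equi_realAttempt W A sec t j S).comp (g := Prod.snd) fun _ _ => rfl) _).comp
    (g := fun v => ((), v)) fun _ _ => rfl

end

/-! ## Procedures with the same results -/

section
variable {α β γ δ : Type} [Nom α] [Nom β] [Nom γ]

/-- The two procedures lead to the same states, up to the names of qubits. -/
def Sim (m m' : β → QM α) : Prop :=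
  ∀ (δ : Type) [Nom δ] (φ : δ → α → QMem → ℝ), Inv (fun p : δ × α => φ p.1 p.2) →
    ∀ μ, μ.Good → ∀ d b, Bdd μ.next d → Bdd μ.next b → wp (m b) (φ d) μ = wp (m' b) (φ d) μ

theorem Sim.trans {m₁ m₂ m₃ : β → QM α} (h : Sim m₁ m₂) (h' : Sim m₂ m₃) : Sim m₁ m₃ :=
  fun δ _ φ hφ μ hμ d b hd hb => (h δ φ hφ μ hμ d b hd hb).trans (h' δ φ hφ μ hμ d b hd hb)

theorem Sim.comp {m m' : β → QM α} (h : Sim m m') {g : γ → β} (hg : Eqv g) :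
    Sim (fun c => m (g c)) fun c => m' (g c) :=
  fun δ _ φ hφ μ hμ d b hd hb => h δ φ hφ μ hμ d (g b) hd (hg.bdd hb)

theorem Sim.bind_right {m : β → QM α} {h h' : β → α → QM γ} (hm : Equi m)
    (hh : Sim (fun p : β × α => h p.1 p.2) fun p => h' p.1 p.2) :
    Sim (fun b => m b >>= h b) fun b => m b >>= h' b := fun δ _ φ hφ μ hμ d b hd hb => by
  rw [wp_bind, wp_bind]
  exact wp_congr hm hμ hb fun a ν hν hN ha =>
    hh δ φ hφ ν hν d (b, a) (hd.mono hN) ((hb.mono hN).pair ha)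

/-- The input `b` is used again by `h`, after `m`. It is added to the bystander data `d`, and for
this reason `Sim` allows such data of an arbitrary type. -/
theorem Sim.bind_left {m m' : β → QM α} {h : β → α → QM γ}
    (hh : Equi fun p : β × α => h p.1 p.2) (hm : Sim m m') :
    Sim (fun b => m b >>= h b) fun b => m' b >>= h b := fun δ _ φ hφ μ hμ d b hd hb => by
  rw [wp_bind, wp_bind]
  refine hm (δ × β) (fun p a => wp (h p.2 a) (φ p.1)) ?_ μ hμ (d, b) b (hd.pair hb) hb
  exact Inv.wp (h := fun p : (δ × β) × α => h p.1.2 p.2) (φ := fun p => φ p.1.1)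
    (hh.comp (g := fun p : (δ × β) × α => (p.1.2, p.2)) fun _ _ => rfl)
    (hφ.comp (g := fun p : ((δ × β) × α) × γ => (p.1.1.1, p.2)) fun _ _ => rfl)

theorem Sim.comm {g : QM α} (hg : Equi fun _ : Unit => g) {m : β → QM γ} (hm : Equi m)
    {ε : Type} [Nom ε] {h : β → α → γ → QM ε}
    (hh : Equi fun p : β × α × γ => h p.1 p.2.1 p.2.2) :
    Sim (fun b => g >>= fun a => m b >>= fun c => h b a c)
      fun b => m b >>= fun c => g >>= fun a => h b a c := fun δ _ φ hφ μ hμ d b hd hb => by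
  have e : ∀ {α β : Type} (m : QM α) (h : α → QM β) (φ : β → QMem → ℝ),
      wp (m >>= h) φ = wp m (fun a => wp (h a) φ) := fun m h φ => funext fun μ => wp_bind m h φ μ
  simp only [e]
  refine wp_comm (b := (d, b)) (β := δ × β) hg (m := fun p => m p.2)
    (φ := fun p a c => wp (h p.2 a c) (φ p.1)) (hm.comp (g := Prod.snd) fun _ _ => rfl) ?_ hμ
    (hd.pair hb)
  exact Inv.wp (h := fun p : (δ × β) × α × γ => h p.1.2 p.2.1 p.2.2) (φ := fun p => φ p.1.1)
    (hh.comp (g := fun p : (δ × β) × α × γ => (p.1.2, p.2)) fun _ _ => rfl)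
    (hφ.comp (g := fun p : ((δ × β) × α × γ) × ε => (p.1.1.1, p.2)) fun _ _ => rfl)

end

/-! ## Puzzles are generated when they are needed -/

section
variable (W : WeaklyVerifiablePuzzle) (A : QPTAlg) (sec : ℕ)

noncomputable def addTuple (ks : List (List Bool)) (X : List Cell) : QM (List Cell) := do
  let p ← ks.mapM (W.newPuzzle sec)
  pure (X ++ frame (encode p))

/-- The input of the adversary. -/
noncomputable def addTuples (t : ℕ) (ks : List (List Bool)) (X : List Cell) : QM (List Cell) :=
  (List.replicate t ()).foldlM (fun X _ => addTuple W sec ks X) X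

/-- Run the adversary on puzzles for the keys `ks`, and verify its first answers with the keys `P`. -/
noncomputable def trial (t : ℕ) (ks P : List (List Bool)) : QM (Bool × List Cell) := do
  let X ← addTuples W sec t ks []
  let ans ← A.exec sec X []
  P.foldlM (verStep W sec) (true, ans)

theorem equi_addTuple (ks : List (List Bool)) : Equi fun X => addTuple W sec ks X :=
  (equi_newPuzzles W sec ks).context.bind (Equi.pure
    (g := fun p : List Cell × List (List Cell) => p.1 ++ frame (encode p.2)) fun f p => by
    show _ = ren f p.1 ++ frame (encode (ren f p.2))
    rw [ren_append, ren_frame, ren_encode])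

theorem equi_addTuples (t : ℕ) (ks : List (List Bool)) : Equi fun X => addTuples W sec t ks X :=
  (Equi.foldlM (β := Unit) (f := fun _ a _ => addTuple W sec ks a)
    (fun _ => (equi_addTuple W sec ks).comp (g := Prod.snd) fun _ _ => rfl) _).comp
    (g := fun v => ((), v)) fun _ _ => rfl

theorem equi_trial (t : ℕ) (ks P : List (List Bool)) : Equi fun _ : Unit => trial W A sec t ks P :=
  ((equi_addTuples W sec t ks).comp (g := fun _ : Unit => []) fun _ _ => rfl).bind
    (((equi_adversary A sec).comp (g := fun p : Unit × List Cell => p.2) fun _ _ => rfl).bind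
    ((equi_verSteps W sec P).comp (g := fun p : (Unit × List Cell) × List Cell => (true, p.2))
      fun _ _ => rfl))

theorem unframe_encode_cons (w : List Cell) (ws : List (List Cell)) :
    unframe (encode (w :: ws)) = (w, encode ws) := by
  rw [show encode (w :: ws) = frame w ++ encode ws from rfl, unframe_frame]

/-- The given puzzle was generated before those for `P`. Once its generation is commuted past them,
the puzzles appear in the order of the list `P ++ k :: S`. -/
theorem tupleStep_sim (P S : List (List Bool)) (k : List Bool) :
    Sim (fun b : List Cell × List Cell =>
        W.newPuzzle sec k >>= fun q => tupleStep W sec P S (b.1, frame q ++ b.2))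
      fun b => (fun X => (X, b.2)) <$> addTuple W sec (P ++ k :: S) b.1 := by
  have h1 : ∀ b : List Cell × List Cell, (fun X => (X, b.2)) <$> addTuple W sec (P ++ k :: S) b.1 =
      P.mapM (W.newPuzzle sec) >>= fun p₁ => W.newPuzzle sec k >>= fun q =>
        S.mapM (W.newPuzzle sec) >>= fun p₂ => pure (b.1 ++ frame (encode (p₁ ++ q :: p₂)), b.2) := by
    intro b
    simp only [addTuple, List.mapM_append, List.mapM_cons, map_bind, bind_assoc, pure_bind, map_pure]
  have h2 : ∀ b : List Cell × List Cell, (W.newPuzzle sec k >>= fun q =>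
        tupleStep W sec P S (b.1, frame q ++ b.2)) =
      W.newPuzzle sec k >>= fun q => P.mapM (W.newPuzzle sec) >>= fun p₁ =>
        S.mapM (W.newPuzzle sec) >>= fun p₂ => pure (b.1 ++ frame (encode (p₁ ++ q :: p₂)), b.2) := by
    intro b
    simp only [tupleStep, unframe_frame]
  simp only [h1, h2]
  refine Sim.comm (equi_newPuzzle W sec k) (equi_newPuzzles W sec P).context ?_
  refine (equi_newPuzzles W sec S).context.bind (Equi.pure
    (g := fun p : ((List Cell × List Cell) × List Cell × List (List Cell)) × List (List Cell) =>
      (p.1.1.1 ++ frame (encode (p.1.2.2 ++ p.1.2.1 :: p.2)), p.1.1.2)) fun f p => ?_)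
  show (_, _) = (ren f p.1.1.1 ++ frame (encode (ren f p.1.2.2 ++ ren f p.1.2.1 :: ren f p.2)),
    ren f p.1.1.2)
  rw [ren_append, ren_frame, ren_encode, ren_append, ren_cons]

/-- Induction on `t`. All given puzzles exist from the start but are used one per tuple, so the
generation of those not yet needed has to be moved behind the completion of the first tuple. -/
theorem tupleSteps_sim (P S : List (List Bool)) (k : List Bool) (t : ℕ) :
    Sim (fun X : List Cell => (List.replicate t k).mapM (W.newPuzzle sec) >>= fun ps =>
        (List.replicate t ()).foldlM (fun a _ => tupleStep W sec P S a) (X, encode ps))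
      fun X => (fun X => (X, [])) <$> addTuples W sec t (P ++ k :: S) X := by
  induction t with
  | zero =>
    intro δ _ φ _ μ _ d b _ _
    simp only [List.replicate_zero, List.mapM_nil, List.foldlM_nil, addTuples, pure_bind, map_pure]
    rfl
  | succ t ih =>
    have hq := equi_newPuzzle W sec k
    have hps := equi_newPuzzles W sec (List.replicate t k)
    have h1 : ∀ X : List Cell, ((List.replicate (t + 1) k).mapM (W.newPuzzle sec) >>= fun ps =>
        (List.replicate (t + 1) ()).foldlM (fun a _ => tupleStep W sec P S a) (X, encode ps)) =
      W.newPuzzle sec k >>= fun q => (List.replicate t k).mapM (W.newPuzzle sec) >>= fun ps =>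
        (P.mapM (W.newPuzzle sec) >>= fun p₁ => S.mapM (W.newPuzzle sec) >>= fun p₂ =>
          pure (p₁ ++ q :: p₂)) >>= fun p => (List.replicate t ()).foldlM
            (fun a _ => tupleStep W sec P S a) (X ++ frame (encode p), encode ps) := by
      intro X
      simp only [List.replicate_succ, List.mapM_cons, List.foldlM_cons, bind_assoc, pure_bind,
        tupleStep, unframe_encode_cons]
    have hmid : Equi fun b : List Cell × List Cell => P.mapM (W.newPuzzle sec) >>= fun p₁ =>
        S.mapM (W.newPuzzle sec) >>= fun p₂ => pure (p₁ ++ b.2 :: p₂) :=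
      (equi_newPuzzles W sec P).context.bind ((equi_newPuzzles W sec S).context.bind (Equi.pure
        (g := fun p : ((List Cell × List Cell) × List (List Cell)) × List (List Cell) =>
          p.1.2 ++ p.1.1.2 :: p.2) fun f p => by
        show _ = ren f p.1.2 ++ ren f p.1.1.2 :: ren f p.2
        rw [ren_append, ren_cons]))
    have hrest : Equi fun p : (List Cell × List Cell) × List (List Cell) × List (List Cell) =>
        (List.replicate t ()).foldlM (fun a _ => tupleStep W sec P S a)
          (p.1.1 ++ frame (encode p.2.2), encode p.2.1) :=
      (equi_tupleSteps W sec t P S).comp (g := fun p : (List Cell × List Cell) ×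
        List (List Cell) × List (List Cell) => (p.1.1 ++ frame (encode p.2.2), encode p.2.1))
        fun f p => by
        show (_, _) = (ren f p.1.1 ++ frame (encode (ren f p.2.2)), encode (ren f p.2.1))
        rw [ren_append, ren_frame, ren_encode, ren_encode]
    simp only [h1]
    -- The `t` later puzzles are exchanged with the puzzles for `P` and `S` of the first tuple.
    have hcomm := Sim.comm hps hmid (h := fun (b : List Cell × List Cell) ps p =>
      (List.replicate t ()).foldlM (fun a _ => tupleStep W sec P S a)
        (b.1 ++ frame (encode p), encode ps)) hrest
    refine Sim.trans (Sim.bind_right (hq.context (β := List Cell)) (h := fun X q =>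
      (List.replicate t k).mapM (W.newPuzzle sec) >>= fun ps =>
        (P.mapM (W.newPuzzle sec) >>= fun p₁ => S.mapM (W.newPuzzle sec) >>= fun p₂ =>
          pure (p₁ ++ q :: p₂)) >>= fun p => (List.replicate t ()).foldlM
            (fun a _ => tupleStep W sec P S a) (X ++ frame (encode p), encode ps))
      (h' := fun X q => (P.mapM (W.newPuzzle sec) >>= fun p₁ =>
        S.mapM (W.newPuzzle sec) >>= fun p₂ => pure (p₁ ++ q :: p₂)) >>= fun p =>
          (List.replicate t k).mapM (W.newPuzzle sec) >>= fun ps => (List.replicate t ()).foldlM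
            (fun a _ => tupleStep W sec P S a) (X ++ frame (encode p), encode ps)) hcomm) ?_
    -- Now the induction hypothesis applies, with the first tuple as the initial segment of the
    -- input.
    have hstep : Sim (fun p : (List Cell × List Cell) × List (List Cell) =>
        (List.replicate t k).mapM (W.newPuzzle sec) >>= fun ps => (List.replicate t ()).foldlM
          (fun a _ => tupleStep W sec P S a) (p.1.1 ++ frame (encode p.2), encode ps))
        fun p => (fun X => (X, [])) <$> addTuples W sec t (P ++ k :: S)
          (p.1.1 ++ frame (encode p.2)) :=
      ih.comp (g := fun p : (List Cell × List Cell) × List (List Cell) =>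
        p.1.1 ++ frame (encode p.2)) fun f p => by
        show _ = ren f p.1.1 ++ frame (encode (ren f p.2))
        rw [ren_append, ren_frame, ren_encode]
    have hstep' := Sim.bind_right hmid (h := fun (b : List Cell × List Cell) p =>
      (List.replicate t k).mapM (W.newPuzzle sec) >>= fun ps => (List.replicate t ()).foldlM
        (fun a _ => tupleStep W sec P S a) (b.1 ++ frame (encode p), encode ps))
      (h' := fun b p => (fun X => (X, ([] : List Cell))) <$> addTuples W sec t (P ++ k :: S)
        (b.1 ++ frame (encode p))) hstep
    refine Sim.trans (Sim.bind_right (hq.context (β := List Cell)) (h := fun X q =>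
      (P.mapM (W.newPuzzle sec) >>= fun p₁ =>
        S.mapM (W.newPuzzle sec) >>= fun p₂ => pure (p₁ ++ q :: p₂)) >>= fun p =>
          (List.replicate t k).mapM (W.newPuzzle sec) >>= fun ps => (List.replicate t ()).foldlM
            (fun a _ => tupleStep W sec P S a) (X ++ frame (encode p), encode ps))
      (h' := fun X q => (P.mapM (W.newPuzzle sec) >>= fun p₁ =>
        S.mapM (W.newPuzzle sec) >>= fun p₂ => pure (p₁ ++ q :: p₂)) >>= fun p =>
          (fun X => (X, ([] : List Cell))) <$> addTuples W sec t (P ++ k :: S)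
            (X ++ frame (encode p))) hstep') ?_
    have h3 : ∀ X : List Cell, (W.newPuzzle sec k >>= fun q => (P.mapM (W.newPuzzle sec) >>= fun p₁ =>
          S.mapM (W.newPuzzle sec) >>= fun p₂ => pure (p₁ ++ q :: p₂)) >>= fun p =>
          (fun X => (X, [])) <$> addTuples W sec t (P ++ k :: S) (X ++ frame (encode p))) =
        (W.newPuzzle sec k >>= fun q => tupleStep W sec P S (X, frame q ++ [])) >>= fun a =>
          (fun X => (X, ([] : List Cell))) <$> addTuples W sec t (P ++ k :: S) a.1 := by
      intro X
      simp only [tupleStep, unframe_frame, bind_assoc, pure_bind]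
    have h4 : ∀ X : List Cell, (fun X => (X, [])) <$> addTuples W sec (t + 1) (P ++ k :: S) X =
        ((fun X => (X, [])) <$> addTuple W sec (P ++ k :: S) X) >>= fun a : List Cell × List Cell =>
          (fun X => (X, ([] : List Cell))) <$> addTuples W sec t (P ++ k :: S) a.1 := by
      intro X
      simp only [addTuples, List.replicate_succ, List.foldlM_cons, map_bind, bind_map_left]
    simp only [h3, h4]
    refine Sim.bind_left (h := fun _ a => (fun X => (X, ([] : List Cell))) <$>
      addTuples W sec t (P ++ k :: S) a.1) ?_ ((tupleStep_sim W sec P S k).comp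
        (g := fun X : List Cell => (X, [])) fun _ _ => rfl)
    simp only [map_eq_pure_bind]
    exact ((equi_addTuples W sec t (P ++ k :: S)).comp
      (g := fun p : List Cell × (List Cell × List Cell) => p.2.1) fun _ _ => rfl).bind
      (Equi.pure (g := fun p : (List Cell × (List Cell × List Cell)) × List Cell =>
        (p.2, ([] : List Cell))) fun _ _ => rfl)

end
open Nom (ren)

/-! ## Expectations of classical results -/

theorem Equi.map {α β γ : Type} [Nom α] [Nom β] [Nom γ] {m : β → QM α} (hm : Equi m) {g : α → γ}
    (hg : Eqv g) : Equi fun b => g <$> m b := by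
  simp only [map_eq_pure_bind]
  exact hm.bind (Equi.pure (g := fun p : β × α => g p.2) fun f p => hg f p.2)

theorem All.bind_congr {α β : Type} {m : QM α} {P : α → Prop} (hm : All m P) {h h' : α → QM β}
    (hh : ∀ a, P a → h a = h' a) : m >>= h = m >>= h' := by
  funext μ
  rw [QM.bind_apply, QM.bind_apply]
  exact List.flatMap_congr fun r hr => by rw [hh _ (hm μ r hr)]

/-- Procedures without inputs. -/
abbrev Closed {α : Type} [Nom α] (m : QM α) : Prop := Equi fun _ : Unit => m

/-- The expectation of a function of the result. -/
noncomputable def ex {α : Type} (m : QM α) (g : α → ℝ) : ℝ :=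
  wp m (fun a μ => g a * μ.weight) .vacuum

/-- The indicator function of `true`. -/
def ind (b : Bool) : ℝ := if b then 1 else 0

section
variable {α β : Type}

theorem prob_eq_ex (m : QM Bool) : prob m = ex m ind := by
  rw [prob_eq_wp, ex]
  congr 1
  funext b μ
  cases b <;> simp [ind]

theorem ex_pure (a : α) (g : α → ℝ) : ex (pure a) g = g a := by
  rw [ex, wp_pure, weight_vacuum, mul_one]

theorem ex_map (m : QM α) (h : α → β) (g : β → ℝ) : ex (h <$> m) g = ex m fun a => g (h a) :=
  wp_map m h _ _

theorem ex_mono {m : QM α} {g g' : α → ℝ} (h : ∀ a, g a ≤ g' a) : ex m g ≤ ex m g' :=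
  wp_mono fun a ν => mul_le_mul_of_nonneg_right (h a) (weight_nonneg ν)

theorem ex_add (m : QM α) (g g' : α → ℝ) : ex m (fun a => g a + g' a) = ex m g + ex m g' := by
  simp only [ex, add_mul]
  exact wp_add _ _ _ _

theorem ex_const_mul (m : QM α) (c : ℝ) (g : α → ℝ) : ex m (fun a => c * g a) = c * ex m g := by
  simp only [ex, mul_assoc]
  exact wp_const_mul _ _ _ _

theorem ex_const {m : QM α} (hm : TP m) (c : ℝ) : ex m (fun _ => c) = c := by
  rw [ex, wp_const_mul, hm, weight_vacuum, mul_one]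

theorem ex_nonneg {m : QM α} {g : α → ℝ} (h : ∀ a, 0 ≤ g a) : 0 ≤ ex m g := by
  have := ex_mono (m := m) (g := fun _ => 0 * 0) (g' := g) (by simpa using h)
  rw [ex_const_mul, zero_mul] at this
  exact this

theorem ex_sub (m : QM α) (g g' : α → ℝ) : ex m (fun a => g a - g' a) = ex m g - ex m g' := by
  have h1 := ex_add m g fun a => (-1) * g' a
  rw [ex_const_mul] at h1
  rw [sub_eq_add_neg, ← neg_one_mul, ← h1]
  congr 1
  funext a
  ring

/-- Expectations of independent results can be taken in any order. -/
theorem ex_comm (m : QM α) (m' : QM β) (g : α → β → ℝ) :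
    ex m (fun a => ex m' (g a)) = ex m' fun b => ex m fun a => g a b := by
  have h := Multiset.sum_map_sum_map (m .vacuum : Multiset (α × QMem))
    (m' .vacuum : Multiset (β × QMem)) (f := fun r s => g r.1 s.1 * s.2.weight * r.2.weight)
  simp only [Multiset.map_coe, Multiset.sum_coe] at h
  simp only [ex, wp, ← List.sum_map_mul_right]
  rw [h]
  simp only [mul_assoc, mul_comm, mul_left_comm]

theorem ex_bool {m : QM Bool} (hm : TP m) (g : Bool → ℝ) :
    ex m g = ex m ind * g true + (1 - ex m ind) * g false := by
  have h : ∀ b, g b = (g true - g false) * ind b + g false := by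
    intro b
    cases b <;> simp [ind]
  rw [show g = fun b => (g true - g false) * ind b + g false from funext h, ex_add, ex_const_mul,
    ex_const hm]
  simp [ind]
  ring

theorem ind_nonneg (b : Bool) : 0 ≤ ind b := by cases b <;> simp [ind]

theorem ind_le_one (b : Bool) : ind b ≤ 1 := by cases b <;> simp [ind]

theorem ex_ind_le_one {m : QM Bool} (hm : TP m) : ex m ind ≤ 1 :=
  (ex_mono ind_le_one).trans_eq (ex_const hm 1)

theorem inv_classical [NoQubits α] [Nom β] (g : α → ℝ) :
    Inv fun (p : β × α) (μ : QMem) => g p.2 * μ.weight :=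
  Inv.weight (g := fun p : β × α => g p.2) fun f p => by
    rw [show (ren f p).2 = p.2 from NoQubits.ren_eq f p.2]

/-- A procedure without inputs behaves in any memory as in the empty one. This is what independence
from everything done before amounts to. -/
theorem Closed.wp_eq [NoQubits α] {m : QM α} (hm : Closed m) (g : α → ℝ) {μ : QMem} (hμ : μ.Good) :
    wp m (fun a ν => g a * ν.weight) μ = ex m g * μ.weight :=
  (Inv.wp hm (φ := fun _ a ν => g a * ν.weight) (inv_classical g)).closed hμ
    (a := ()) (Bdd.of_noQubits _ _)

/-- The second procedure starts in whatever memory the first one leaves, yet its expectation is the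
one from the empty memory. From here on, classical results can be treated by ordinary probability.
-/
theorem Closed.ex_bind [NoQubits α] [NoQubits β] {m : QM α} (hm : Closed m) {h : α → QM β}
    (hh : ∀ a, Closed (h a)) (g : β → ℝ) : ex (m >>= h) g = ex m fun a => ex (h a) g := by
  rw [ex, wp_bind]
  exact wp_congr (b := ()) hm good_vacuum (Bdd.of_noQubits _ _) fun a ν hν _ _ => (hh a).wp_eq g hν

theorem Closed.bind [NoQubits α] [Nom β] {m : QM α} (hm : Closed m) {h : α → QM β}
    (hh : ∀ a, Closed (h a)) : Closed (m >>= h) := Equi.bind_noQubits hm hh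

theorem Sim.ex_eq [NoQubits α] {m m' : QM α} (h : Sim (fun _ : Unit => m) fun _ => m') (g : α → ℝ) :
    ex m g = ex m' g :=
  h Unit (fun _ a ν => g a * ν.weight) (inv_classical g) _ good_vacuum () ()
    (Bdd.of_noQubits _ _) (Bdd.of_noQubits _ _)

theorem Sim.bind_noQubits {γ : Type} [NoQubits α] [Nom β] [Nom γ] {m : QM α} (hm : Closed m)
    {h h' : α → γ → QM β} (hh : ∀ a, Sim (h a) (h' a)) :
    Sim (fun c : γ => m >>= fun a => h a c) fun c => m >>= fun a => h' a c :=
  fun ε _ φ hφ μ hμ d c hd hc => by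
    rw [wp_bind, wp_bind]
    exact wp_congr (b := ()) hm hμ (Bdd.of_noQubits _ _) fun a ν hν hN _ =>
      hh a ε φ hφ ν hν d c (hd.mono hN) (hc.mono hN)

end

/-! ## Attempts as trials -/

section
variable (W : WeaklyVerifiablePuzzle) (A : QPTAlg) (sec : ℕ)

theorem tp_newKey : TP (W.newKey sec) := (W.CheckGen.tp_exec _ _ _).bind fun _ => TP.pure _

theorem tp_newPuzzles (ks : List (List Bool)) : TP (ks.mapM (W.newPuzzle sec)) :=
  TP.mapM (fun _ => W.PuzzleGen.tp_exec _ _ _) _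

theorem tp_accept (w : List Cell) (k : List Bool) : TP (W.accept sec w k) :=
  (W.Ver.tp_exec _ _ _).bind fun _ => TP.pure _

theorem tp_verStep (v : Bool × List Cell) (k : List Bool) : TP (verStep W sec v k) :=
  (tp_accept W sec _ _).bind fun _ => TP.pure _

theorem tp_sampleKeys (j : ℕ) : TP (sampleKeys W sec j) :=
  TP.foldlM (fun _ _ => (tp_newKey W sec).bind fun _ => TP.pure _) _ _

theorem tp_trial (t : ℕ) (ks P : List (List Bool)) : TP (trial W A sec t ks P) :=
  (TP.foldlM (fun _ _ => (tp_newPuzzles W sec ks).bind fun _ => TP.pure _) _ _).bind fun _ =>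
    (A.tp_exec _ _ _).bind fun _ => TP.foldlM (fun _ _ => tp_verStep W sec _ _) _ _

/-- `t` given puzzles are as good as `t` new ones. -/
theorem attempt_sim (t j : ℕ) (S : List (List Bool)) (k : List Bool) :
    Sim (fun _ : Unit => (List.replicate t k).mapM (W.newPuzzle sec) >>= fun ps =>
        (fun r => (r.1, r.2.1)) <$> attempt W A sec t j S (encode ps))
      fun _ => sampleKeys W sec j >>= fun P => trial W A sec t (P ++ k :: S) P := by
  have hrest : ∀ P : List (List Bool), Equi fun a : List Cell × List Cell =>
      A.exec sec a.1 [] >>= fun ans => P.foldlM (verStep W sec) (true, ans) := fun P =>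
    ((equi_adversary A sec).comp (g := fun p : List Cell × List Cell => p.1) fun _ _ => rfl).bind
      ((equi_verSteps W sec P).comp (g := fun p : (List Cell × List Cell) × List Cell => (true, p.2))
        fun _ _ => rfl)
  have h1 : ∀ ps, (fun r => (r.1, r.2.1)) <$> attempt W A sec t j S (encode ps) =
      sampleKeys W sec j >>= fun P => (List.replicate t ()).foldlM
        (fun a _ => tupleStep W sec P S a) ([], encode ps) >>= fun a =>
          A.exec sec a.1 [] >>= fun ans => P.foldlM (verStep W sec) (true, ans) := by
    intro ps
    simp only [attempt, map_bind, map_pure, Prod.mk.eta, bind_pure]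
  simp only [h1]
  have hcomm := Sim.comm (β := Unit) (equi_newPuzzles W sec (List.replicate t k))
    (equi_sampleKeys W sec j) (h := fun _ ps P => (List.replicate t ()).foldlM
        (fun a _ => tupleStep W sec P S a) ([], encode ps) >>= fun a =>
          A.exec sec a.1 [] >>= fun ans => P.foldlM (verStep W sec) (true, ans)) (by
      refine (Equi.noQubits (δ := List (List Bool)) (h := fun P (ps : List (List Cell)) =>
        (List.replicate t ()).foldlM (fun a _ => tupleStep W sec P S a) ([], encode ps) >>= fun a =>
          A.exec sec a.1 [] >>= fun ans => P.foldlM (verStep W sec) (true, ans)) fun P => ?_).comp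
        (g := fun p : Unit × List (List Cell) × List (List Bool) => (p.2.2, p.2.1)) fun _ _ => rfl
      exact ((equi_tupleSteps W sec t P S).comp (g := fun ps => ([], encode ps)) fun f ps => by
        rw [ren_pair, ren_encode, ren_nil]).bind
        ((hrest P).comp (g := fun p : List (List Cell) × List Cell × List Cell => p.2) fun _ _ => rfl))
  refine hcomm.trans (Sim.bind_noQubits (equi_sampleKeys W sec j) fun P => ?_)
  have h2 : trial W A sec t (P ++ k :: S) P =
      ((fun X => (X, ([] : List Cell))) <$> addTuples W sec t (P ++ k :: S) []) >>= fun a =>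
        A.exec sec a.1 [] >>= fun ans => P.foldlM (verStep W sec) (true, ans) := by
    simp only [trial, bind_map_left]
  have h3 : ((List.replicate t k).mapM (W.newPuzzle sec) >>= fun ps => (List.replicate t ()).foldlM
        (fun a _ => tupleStep W sec P S a) ([], encode ps) >>= fun a =>
          A.exec sec a.1 [] >>= fun ans => P.foldlM (verStep W sec) (true, ans)) =
      ((List.replicate t k).mapM (W.newPuzzle sec) >>= fun ps => (List.replicate t ()).foldlM
        (fun a _ => tupleStep W sec P S a) ([], encode ps)) >>= fun a =>
          A.exec sec a.1 [] >>= fun ans => P.foldlM (verStep W sec) (true, ans) :=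
    (bind_assoc _ _ _).symm
  rw [h2, h3]
  refine Sim.bind_left (h := fun (_ : Unit) (a : List Cell × List Cell) =>
      A.exec sec a.1 [] >>= fun ans => P.foldlM (verStep W sec) (true, ans))
    ((hrest P).comp (g := fun p : Unit × List Cell × List Cell => p.2) fun _ _ => rfl) ?_
  exact (tupleSteps_sim W sec P S k t).comp (g := fun _ : Unit => []) fun _ _ => rfl

theorem tupleSteps_append (P S : List (List Bool)) (Y : List Cell) : ∀ (ps : List (List Cell))
    (X : List Cell), (List.replicate ps.length ()).foldlM (fun a _ => tupleStep W sec P S a)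
      (X, encode ps ++ Y) = (fun a => (a.1, Y)) <$> (List.replicate ps.length ()).foldlM
        (fun a _ => tupleStep W sec P S a) (X, encode ps)
  | [], X => by simp [encode]
  | p :: ps, X => by
    have h1 : encode (p :: ps) = frame p ++ encode ps := rfl
    have h2 : ∀ Y, tupleStep W sec P S (X, frame p ++ Y) = P.mapM (W.newPuzzle sec) >>= fun p₁ =>
        S.mapM (W.newPuzzle sec) >>= fun p₂ => pure (X ++ frame (encode (p₁ ++ p :: p₂)), Y) := by
      intro Y
      simp only [tupleStep, unframe_frame]
    simp only [List.length_cons, List.replicate_succ, List.foldlM_cons, h1, List.append_assoc, h2,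
      bind_assoc, pure_bind, map_bind, tupleSteps_append P S Y ps]

/-- An attempt uses up the first `t` puzzles. -/
theorem attempt_append {t : ℕ} (j : ℕ) (S : List (List Bool)) {ps : List (List Cell)}
    (hps : ps.length = t) (Y : List Cell) : attempt W A sec t j S (encode ps ++ Y) =
      (fun r => (r.1, r.2.1, Y)) <$> attempt W A sec t j S (encode ps) := by
  subst hps
  simp only [attempt, tupleSteps_append W sec _ S Y ps, bind_map_left, map_bind, map_pure]

theorem all_newPuzzles (ks : List (List Bool)) :
    All (ks.mapM (W.newPuzzle sec)) fun ps => ps.length = ks.length :=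
  (All.mapM (P := fun _ => True) (Q := fun _ => True) (fun _ _ => All.trivial _) ks
    fun _ _ => True.intro).mono fun _ h => h.1

end
open Nom (ren)

/-! ## Success probabilities -/

theorem TP.map {α β : Type} {m : QM α} (hm : TP m) (g : α → β) : TP (g <$> m) := by
  rw [map_eq_pure_bind]
  exact hm.bind fun _ => TP.pure _

theorem Eqv.classical {α β : Type} [NoQubits α] [NoQubits β] {g : α → β} : Eqv g := fun f a => by
  rw [NoQubits.ren_eq, NoQubits.ren_eq]

theorem wp_bind_fun {α β : Type} (m : QM α) (h : α → QM β) (φ : β → QMem → ℝ) :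
    wp (m >>= h) φ = wp m fun a => wp (h a) φ := funext fun μ => wp_bind m h φ μ

theorem wp_pure_fun {α : Type} (a : α) (φ : α → QMem → ℝ) : wp (pure a : QM α) φ = φ a :=
  funext fun μ => wp_pure a φ μ

theorem Closed.pure {α : Type} [NoQubits α] (a : α) : Closed (pure a : QM α) :=
  Equi.pure (g := fun _ => a) .const

theorem Closed.foldlM {α ι : Type} [NoQubits α] {f : α → ι → QM α} (hf : ∀ a i, Closed (f a i)) :
    ∀ (l : List ι) (a : α), Closed (l.foldlM f a)
  | [], a => by rw [List.foldlM_nil]; exact Closed.pure a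
  | i :: l, a => by rw [List.foldlM_cons]; exact (hf a i).bind (Closed.foldlM hf l)

/-- The expected number of attempts, out of at most `N`, with success probability `x` each. -/
noncomputable def attempts (N : ℕ) (x : ℝ) : ℝ := ∑ l ∈ Finset.range N, (1 - x) ^ l

theorem attempts_succ (N : ℕ) (x : ℝ) : attempts (N + 1) x = 1 + (1 - x) * attempts N x := by
  rw [attempts, Finset.sum_range_succ', attempts, Finset.mul_sum, pow_zero, add_comm]
  simp only [pow_succ']

section
variable (W : WeaklyVerifiablePuzzle) (A : QPTAlg) (sec t : ℕ)

/-- The probability that the adversary, on puzzles for the keys `P ++ S`, solves those for `P`. -/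
noncomputable def solveProb (P S : List (List Bool)) : ℝ :=
  ex (Prod.fst <$> trial W A sec t (P ++ S) P) ind

/-- The average over `j` keys. -/
noncomputable def avgProb (j : ℕ) (S : List (List Bool)) : ℝ :=
  ex (sampleKeys W sec j) fun P => solveProb W A sec t P S

/-- The average over `j` keys, with the key `k` next. -/
noncomputable def nextProb (j : ℕ) (k : List Bool) (S : List (List Bool)) : ℝ :=
  ex (sampleKeys W sec j) fun P => solveProb W A sec t (P ++ [k]) S

theorem closed_verdict (ks P : List (List Bool)) : Closed (Prod.fst <$> trial W A sec t ks P) :=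
  (equi_trial W A sec t ks P).map (g := Prod.fst) fun _ _ => rfl

theorem trial_snoc (P S : List (List Bool)) (k : List Bool) :
    trial W A sec t ((P ++ [k]) ++ S) (P ++ [k]) =
      trial W A sec t (P ++ k :: S) P >>= fun v => verStep W sec v k := by
  simp only [trial, List.append_assoc, List.singleton_append, List.foldlM_append, List.foldlM_cons,
    List.foldlM_nil, bind_assoc, bind_pure]

theorem solveProb_nonneg (P S : List (List Bool)) : 0 ≤ solveProb W A sec t P S := ex_nonneg ind_nonneg

/-- The two sides run the same trial; the left one verifies one more answer. This can only lower the
verdict, and verification preserves the total weight. -/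
theorem solveProb_snoc_le (P S : List (List Bool)) (k : List Bool) :
    solveProb W A sec t (P ++ [k]) S ≤ solveProb W A sec t P (k :: S) := by
  simp only [solveProb, trial_snoc, ex_map]
  rw [ex, wp_bind]
  refine wp_mono fun v μ => ?_
  have h : wp (verStep W sec v k) (fun v' ν => ind v'.1 * ν.weight) μ ≤
      wp (verStep W sec v k) (fun _ ν => ind v.1 * ν.weight) μ := by
    simp only [verStep, wp_bind_fun, wp_pure_fun]
    refine wp_mono fun d ν => mul_le_mul_of_nonneg_right ?_ (weight_nonneg ν)
    rcases v with ⟨_ | _, w⟩ <;> cases d <;> simp [ind]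
  refine h.trans_eq ?_
  rw [wp_const_mul, tp_verStep]

theorem avgProb_zero (S : List (List Bool)) : avgProb W A sec t 0 S = 1 := by
  simp only [avgProb, sampleKeys, List.replicate_zero, List.foldlM_nil, ex_pure, solveProb]
  have h : Prod.fst <$> trial W A sec t ([] ++ S) [] = (addTuples W sec t S [] >>= fun X =>
      A.exec sec X []) >>= fun _ => pure true := by
    simp only [trial, List.nil_append, List.foldlM_nil, map_bind, map_pure, bind_assoc]
  rw [h, ex, wp_bind]
  simp only [wp_pure_fun]
  show ex _ (fun _ => ind true) = 1
  rw [ex_const]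
  · rfl
  · exact (TP.foldlM (fun _ _ => (tp_newPuzzles W sec S).bind fun _ => TP.pure _) _ _).bind
      fun _ => A.tp_exec _ _ _

theorem avgProb_le_one (j : ℕ) (S : List (List Bool)) : avgProb W A sec t j S ≤ 1 :=
  (ex_mono fun _ => ex_ind_le_one ((tp_trial _ _ _ _ _ _).map _)).trans_eq (ex_const (tp_sampleKeys _ _ _) 1)

theorem nextProb_nonneg (j : ℕ) (k : List Bool) (S : List (List Bool)) :
    0 ≤ nextProb W A sec t j k S := ex_nonneg fun _ => solveProb_nonneg ..

theorem nextProb_le (j : ℕ) (k : List Bool) (S : List (List Bool)) :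
    nextProb W A sec t j k S ≤ avgProb W A sec t j (k :: S) := ex_mono fun _ => solveProb_snoc_le ..

/-- New keys are put in front, so the key drawn first ends up last, next to the list `S` that
follows. -/
theorem sampleKeys_succ (j : ℕ) : sampleKeys W sec (j + 1) =
    W.newKey sec >>= fun k => (fun P => P ++ [k]) <$> sampleKeys W sec j := by
  have h : ∀ j P, (List.replicate j ()).foldlM (fun P _ => W.newKey sec >>= fun k => pure (k :: P)) P =
      (fun P' => P' ++ P) <$> sampleKeys W sec j := by
    intro j P
    induction j with
    | zero => simp [sampleKeys]
    | succ j ih =>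
      have e : ∀ P', (List.replicate (j + 1) ()).foldlM
          (fun P _ => W.newKey sec >>= fun k => pure (k :: P)) P' = (List.replicate j ()).foldlM
            (fun P _ => W.newKey sec >>= fun k => pure (k :: P)) P' >>= fun P =>
              W.newKey sec >>= fun k => pure (k :: P) := by
        intro P'
        rw [List.replicate_succ', List.foldlM_append]
        simp only [List.foldlM_cons, List.foldlM_nil, bind_pure]
      simp only [sampleKeys, e, map_bind, map_pure] at ih ⊢
      rw [ih, bind_map_left]
      rfl
  rw [sampleKeys, List.replicate_succ, List.foldlM_cons]
  simp only [bind_assoc, pure_bind, h]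

theorem ex_nextProb (j : ℕ) (S : List (List Bool)) :
    ex (W.newKey sec) (fun k => nextProb W A sec t j k S) = avgProb W A sec t (j + 1) S := by
  rw [avgProb, sampleKeys_succ, Closed.ex_bind (equi_newKey W sec)
    fun k => (equi_sampleKeys W sec j).map (g := fun P => P ++ [k]) .classical]
  · simp only [ex_map]
    rfl

/-- An attempt on puzzles for a known key. -/
noncomputable def guess (j : ℕ) (S : List (List Bool)) (k : List Bool) : QM Bool := do
  let ps ← (List.replicate t k).mapM (W.newPuzzle sec)
  let r ← attempt W A sec t j S (encode ps)
  Prod.fst <$> verStep W sec (r.1, r.2.1) k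

theorem guess_sim (j : ℕ) (S : List (List Bool)) (k : List Bool) :
    Sim (fun _ : Unit => guess W A sec t j S k) fun _ => sampleKeys W sec j >>= fun P =>
      Prod.fst <$> trial W A sec t ((P ++ [k]) ++ S) (P ++ [k]) := by
  have h := Sim.bind_left (h := fun (_ : Unit) v => Prod.fst <$> verStep W sec v k)
    (((equi_verStep W sec k).comp (g := fun p : Unit × Bool × List Cell => p.2) fun _ _ => rfl).map
      (g := Prod.fst) fun _ _ => rfl) (attempt_sim W A sec t j S k)
  simp only [bind_assoc, bind_map_left] at h
  simp only [trial_snoc, map_bind]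
  exact h

theorem tp_attempt (j : ℕ) (S : List (List Bool)) (B : List Cell) : TP (attempt W A sec t j S B) :=
  (tp_sampleKeys _ _ _).bind fun _ => (TP.foldlM (fun _ _ => (tp_newPuzzles _ _ _).bind fun _ =>
    (tp_newPuzzles _ _ _).bind fun _ => TP.pure _) _ _).bind fun _ => (A.tp_exec _ _ _).bind fun _ =>
      (TP.foldlM (fun _ _ => tp_verStep _ _ _ _) _ _).bind fun _ => TP.pure _

theorem tp_guess (j : ℕ) (S : List (List Bool)) (k : List Bool) : TP (guess W A sec t j S k) :=
  (tp_newPuzzles _ _ _).bind fun _ => (tp_attempt _ _ _ _ _ _ _).bind fun _ => (tp_verStep _ _ _ _).map _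

theorem closed_guess (j : ℕ) (S : List (List Bool)) (k : List Bool) :
    Closed (guess W A sec t j S k) :=
  (equi_newPuzzles W sec _).bind
    (((equi_attempt W A sec t j S).comp (g := fun p : Unit × List (List Cell) => encode p.2)
      fun f p => ren_encode f p.2).bind
    (((equi_verStep W sec k).comp (g := fun p : (Unit × List (List Cell)) × Bool × List Cell ×
      List Cell => (p.2.1, p.2.2.1)) fun _ _ => rfl).map (g := Prod.fst) fun _ _ => rfl))

theorem ex_guess (j : ℕ) (S : List (List Bool)) (k : List Bool) :
    ex (guess W A sec t j S k) ind = nextProb W A sec t j k S := by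
  rw [(guess_sim W A sec t j S k).ex_eq, Closed.ex_bind (equi_sampleKeys W sec j)
    fun P => closed_verdict W A sec t _ _]
  rfl

/-! ## Extending the list of keys -/

theorem selfBlock_eq (k : List Bool) :
    selfBlock W sec t k = encode <$> (List.replicate t k).mapM (W.newPuzzle sec) := by
  have h : ∀ t B, (List.replicate t ()).foldlM (fun B _ => [k].mapM (W.newPuzzle sec) >>= fun p =>
      pure (B ++ encode p)) B =
        (fun ps => B ++ encode ps) <$> (List.replicate t k).mapM (W.newPuzzle sec) := by
    intro t
    induction t with
    | zero => intro B; simp [encode]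
    | succ t ih =>
      intro B
      simp only [List.replicate_succ, List.foldlM_cons, List.mapM_cons, List.mapM_nil, bind_assoc,
        pure_bind, map_bind, map_pure] at ih ⊢
      simp only [ih, map_eq_pure_bind, List.append_assoc, ← encode_append, List.singleton_append]
  exact (h t []).trans (by simp)

theorem selfAttempt_false (j : ℕ) (S : List (List Bool)) : selfAttempt W A sec t j (false, S) =
    W.newKey sec >>= fun k => (fun d => if d then (true, k :: S) else (false, S)) <$>
      guess W A sec t j S k := by
  simp only [selfAttempt, selfBlock_eq, guess, Bool.false_eq_true, if_false, List.foldlM_cons,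
    List.foldlM_nil, bind_pure, map_eq_pure_bind, bind_assoc, pure_bind]

theorem closed_selfAttempt (j : ℕ) (s : Bool × List (List Bool)) :
    Closed (selfAttempt W A sec t j s) := by
  rcases s with ⟨_ | _, S⟩
  · rw [selfAttempt_false]
    exact (equi_newKey W sec).bind_noQubits fun k => (closed_guess W A sec t j S k).map .classical
  · exact Closed.pure _

theorem closed_selfAttempts (N j : ℕ) (s : Bool × List (List Bool)) :
    Closed ((List.replicate N ()).foldlM (fun s _ => selfAttempt W A sec t j s) s) :=
  .foldlM (fun s _ => closed_selfAttempt W A sec t j s) _ _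

/-- Distinguish by the first round. It keeps the key `k` with probability `nextProb`. On average
over `k` it fails with probability one minus `avgProb` for `j + 1` keys, and then the remaining
rounds start from the same state. -/
theorem ex_selfAttempts_succ (N j : ℕ) (S : List (List Bool)) (g : Bool × List (List Bool) → ℝ) :
    ex ((List.replicate (N + 1) ()).foldlM (fun s _ => selfAttempt W A sec t j s) (false, S)) g =
      ex (W.newKey sec) (fun k => nextProb W A sec t j k S * g (true, k :: S)) +
      (1 - avgProb W A sec t (j + 1) S) *
        ex ((List.replicate N ()).foldlM (fun s _ => selfAttempt W A sec t j s) (false, S)) g := by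
  have h : ∀ N S', (List.replicate N ()).foldlM (fun s _ => selfAttempt W A sec t j s) (true, S') =
      (pure (true, S') : QM _) := by
    intro N S'
    induction N with
    | zero => rfl
    | succ N ih =>
      rw [List.replicate_succ, List.foldlM_cons, show selfAttempt W A sec t j (true, S') =
        pure (true, S') from rfl, pure_bind, ih]
  rw [List.replicate_succ, List.foldlM_cons, Closed.ex_bind (closed_selfAttempt W A sec t j _)
    (closed_selfAttempts W A sec t N j), selfAttempt_false, Closed.ex_bind (equi_newKey W sec)
    fun k => (closed_guess W A sec t j S k).map .classical]
  simp only [ex_map]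
  rw [← ex_nextProb, ← ex_const (tp_newKey W sec) 1, ← ex_sub, mul_comm, ← ex_const_mul, ← ex_add]
  congr 1
  funext k
  rw [ex_bool (tp_guess _ _ _ _ _ _ _), ex_guess]
  simp only [if_true, Bool.false_eq_true, if_false, h, ex_pure]
  ring

/-- Solving the recursion produces the geometric sum `attempts`. The branch in which no key is found
contributes a nonnegative amount and is dropped. -/
theorem le_ex_phase (N j : ℕ) (S : List (List Bool)) {g : List (List Bool) → ℝ} (hg : ∀ S, 0 ≤ g S) :
    attempts N (avgProb W A sec t (j + 1) S) *
      ex (W.newKey sec) (fun k => nextProb W A sec t j k S * g (k :: S)) ≤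
      ex (phase W A sec N t j S) g := by
  have h : phase W A sec N t j S = Prod.snd <$> (List.replicate N ()).foldlM
      (fun s _ => selfAttempt W A sec t j s) (false, S) := by
    rw [phase, map_eq_pure_bind]
  rw [h, ex_map]
  induction N with
  | zero =>
    rw [attempts, Finset.sum_range_zero, zero_mul]
    exact ex_nonneg fun s => hg s.2
  | succ N ih =>
    rw [ex_selfAttempts_succ, attempts_succ, add_mul, one_mul, mul_assoc]
    have := avgProb_le_one W A sec t (j + 1) S
    have hx := mul_le_mul_of_nonneg_left (ih rfl) (sub_nonneg.2 this)
    exact add_le_add_right hx _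

end
open Nom (ren)

section
variable (W : WeaklyVerifiablePuzzle) (A : QPTAlg) (sec t : ℕ)

/-! ## The given puzzles -/

/-- Solve given puzzles for the key `k`, in `N` attempts. -/
noncomputable def realAttempts (j : ℕ) (S : List (List Bool)) (k : List Bool) (N : ℕ)
    (ps : List (List Cell)) : QM Bool :=
  (List.replicate N ()).foldlM (fun b _ => realAttempt W A sec t j S b) (false, encode ps, []) >>=
    fun b => W.accept sec b.2.2 k

noncomputable def challenge (j : ℕ) (S : List (List Bool)) (k : List Bool) (N : ℕ) : QM Bool :=
  (List.replicate (t * N) k).mapM (W.newPuzzle sec) >>= realAttempts W A sec t j S k N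

/-- What remains to be done after an attempt with the result `v`. -/
noncomputable def afterAttempt (j : ℕ) (S : List (List Bool)) (k : List Bool) (N : ℕ)
    (v : Bool × List Cell) (qs : List (List Cell)) : QM Bool :=
  if v.1 then W.accept sec (unframe v.2).1 k else realAttempts W A sec t j S k N qs

theorem equi_realAttempts' (j : ℕ) (S : List (List Bool)) (k : List Bool) (N : ℕ) :
    Equi (realAttempts W A sec t j S k N) :=
  ((equi_realAttempts W A sec N t j S).comp (g := fun ps => (false, encode ps, []))
    fun f ps => by rw [ren_pair, ren_pair, ren_encode]; rfl).bind
    ((equi_accept W sec k).comp (g := fun p : List (List Cell) × Bool × List Cell × List Cell =>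
      p.2.2.2) fun _ _ => rfl)

theorem closed_challenge (j : ℕ) (S : List (List Bool)) (k : List Bool) (N : ℕ) :
    Closed (challenge W A sec t j S k N) :=
  (equi_newPuzzles W sec _).bind ((equi_realAttempts' W A sec t j S k N).comp
    (g := fun p : Unit × List (List Cell) => p.2) fun _ _ => rfl)

theorem equi_afterAttempt (j : ℕ) (S : List (List Bool)) (k : List Bool) (N : ℕ) :
    Equi fun p : (Bool × List Cell) × List (List Cell) =>
      afterAttempt W A sec t j S k N p.1 p.2 := by
  refine (Equi.noQubits (h := fun d (p : List Cell × List (List Cell)) =>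
    afterAttempt W A sec t j S k N (d, p.1) p.2) fun d => ?_).comp
    (g := fun p : (Bool × List Cell) × List (List Cell) => (p.1.1, p.1.2, p.2)) fun _ _ => rfl
  cases d
  · exact (equi_realAttempts' W A sec t j S k N).comp
      (g := fun p : List Cell × List (List Cell) => p.2) fun _ _ => rfl
  · exact (equi_accept W sec k).comp (g := fun p : List Cell × List (List Cell) => (unframe p.1).1)
      fun f p => by
        show ren f (unframe p.1).1 = (unframe (ren f p.1)).1
        rw [ren_unframe]

theorem challenge_succ (j : ℕ) (S : List (List Bool)) (k : List Bool) (N : ℕ) :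
    challenge W A sec t j S k (N + 1) = (List.replicate t k).mapM (W.newPuzzle sec) >>= fun ps =>
      (List.replicate (t * N) k).mapM (W.newPuzzle sec) >>= fun qs =>
        ((fun r => (r.1, r.2.1)) <$> attempt W A sec t j S (encode ps)) >>= fun v =>
          afterAttempt W A sec t j S k N v qs := by
  have htrue : ∀ N w, (List.replicate N ()).foldlM (fun b _ => realAttempt W A sec t j S b)
      (true, w) = (pure (true, w) : QM _) := by
    intro N w
    induction N with
    | zero => rfl
    | succ N ih =>
      rw [List.replicate_succ, List.foldlM_cons, show realAttempt W A sec t j S (true, w) =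
        pure (true, w) from rfl, pure_bind, ih]
  rw [challenge, mul_add, mul_one, add_comm, List.replicate_add, List.mapM_append]
  simp only [bind_assoc, pure_bind]
  refine (all_newPuzzles W sec _).bind_congr fun ps hps => ?_
  rw [List.length_replicate] at hps
  congr 1
  funext qs
  simp only [realAttempts, List.replicate_succ, List.foldlM_cons]
  rw [show realAttempt W A sec t j S (false, encode (ps ++ qs), []) =
    attempt W A sec t j S (encode (ps ++ qs)) >>= fun r => pure (r.1, r.2.2,
      if r.1 then (unframe r.2.1).1 else []) from rfl, encode_append, attempt_append W A sec j S hps]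
  simp only [bind_map_left, bind_assoc, pure_bind]
  congr 1
  funext r
  rcases r with ⟨_ | _, r⟩
  · rfl
  · simp only [if_true, htrue, pure_bind, afterAttempt]

/-- One round on the given puzzles passes the check and has the right answer for `k` with
probability `nextProb`. It fails the check with probability one minus `avgProb` for `j` keys and the
list `k :: S`. In that case the unused puzzles are as good as new, and the challenge with `N` rounds
begins. -/
theorem ex_challenge_succ (j : ℕ) (S : List (List Bool)) (k : List Bool) (N : ℕ) :
    ex (challenge W A sec t j S k (N + 1)) ind = nextProb W A sec t j k S +
      (1 - avgProb W A sec t j (k :: S)) * ex (challenge W A sec t j S k N) ind := by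
  have hqs := equi_newPuzzles W sec (List.replicate (t * N) k)
  have hatt : Equi fun p : Unit × List (List Cell) =>
      (fun r => (r.1, r.2.1)) <$> attempt W A sec t j S (encode p.2) :=
    ((equi_attempt W A sec t j S).comp (g := fun p : Unit × List (List Cell) => encode p.2)
      fun f p => ren_encode f p.2).map (g := fun r => (r.1, r.2.1)) fun _ _ => rfl
  have haft := equi_afterAttempt W A sec t j S k N
  have h1 : Sim (fun _ : Unit => challenge W A sec t j S k (N + 1)) fun _ =>
      sampleKeys W sec j >>= fun P => trial W A sec t (P ++ k :: S) P >>= fun v =>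
        (List.replicate (t * N) k).mapM (W.newPuzzle sec) >>= fun qs =>
          afterAttempt W A sec t j S k N v qs := by
    simp only [challenge_succ]
    refine (Sim.bind_right (equi_newPuzzles W sec _) (h' := fun _ ps =>
        ((fun r => (r.1, r.2.1)) <$> attempt W A sec t j S (encode ps)) >>= fun v =>
          (List.replicate (t * N) k).mapM (W.newPuzzle sec) >>= fun qs =>
            afterAttempt W A sec t j S k N v qs) (Sim.comm hqs hatt
      (h := fun (_ : Unit × List (List Cell)) qs v => afterAttempt W A sec t j S k N v qs)
      (haft.comp (g := fun p : (Unit × List (List Cell)) × List (List Cell) × Bool × List Cell =>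
        (p.2.2, p.2.1)) fun _ _ => rfl))).trans ?_
    have := Sim.bind_left (h := fun (_ : Unit) v =>
      (List.replicate (t * N) k).mapM (W.newPuzzle sec) >>= fun qs =>
        afterAttempt W A sec t j S k N v qs)
      (hqs.context.bind (haft.comp (g := fun p : (Unit × Bool × List Cell) × List (List Cell) =>
        (p.1.2, p.2)) fun _ _ => rfl)) (attempt_sim W A sec t j S k)
    simp only [bind_assoc] at this
    exact this
  -- One term is the event that all `j + 1` answers are right; the other one is nonzero only if the
  -- check of the first `j` answers has failed.
  have h2 : ∀ v : Bool × List Cell, ∀ μ : QMem, μ.Good → Bdd μ.next v →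
      wp ((List.replicate (t * N) k).mapM (W.newPuzzle sec) >>= fun qs =>
          afterAttempt W A sec t j S k N v qs) (fun d ν => ind d * ν.weight) μ =
        wp (Prod.fst <$> verStep W sec v k) (fun d ν => ind d * ν.weight) μ +
          ex (challenge W A sec t j S k N) ind * ((1 - ind v.1) * μ.weight) := by
    rintro ⟨_ | _, w⟩ μ hμ hv
    · have h3 : (Prod.fst <$> verStep W sec (false, w) k) = W.accept sec (unframe w).1 k >>= fun _ =>
          pure false := by
        simp only [verStep, map_bind, map_pure, Bool.false_and]
      have h4 : wp (Prod.fst <$> verStep W sec (false, w) k) (fun d ν => ind d * ν.weight) μ = 0 := by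
        rw [h3, wp_bind]
        simp only [wp_pure_fun]
        rw [wp_const_mul]
        simp [ind]
      rw [h4, zero_add]
      have := (closed_challenge W A sec t j S k N).wp_eq ind hμ
      simpa [ind, afterAttempt, challenge] using this
    · have h3 : (Prod.fst <$> verStep W sec (true, w) k) = W.accept sec (unframe w).1 k := by
        simp only [verStep, map_bind, map_pure, Bool.true_and, bind_pure]
      rw [h3]
      -- After a success the unused puzzles are never touched. Their generation is moved behind the
      -- verification and then vanishes by trace preservation.
      have h4 := Sim.comm hqs ((equi_accept W sec k).comp (g := fun w => (unframe w).1) fun f w => by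
          dsimp only; rw [ren_unframe]) (h := fun (_ : List Cell) (_ : List (List Cell)) (d : Bool) =>
            (pure d : QM Bool)) (Equi.pure (g := fun p : List Cell × List (List Cell) × Bool => p.2.2)
              fun _ _ => rfl) Unit (fun _ d ν => ind d * ν.weight) (inv_classical ind) μ hμ () w
          (Bdd.of_noQubits _ _) hv.snd
      simp only [bind_pure] at h4
      rw [show (fun qs => afterAttempt W A sec t j S k N (true, w) qs) = fun _ =>
        W.accept sec (unframe w).1 k from rfl, h4, wp_bind]
      have h5 : ∀ d : Bool, wp ((List.replicate (t * N) k).mapM (W.newPuzzle sec) >>= fun _ =>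
          (pure d : QM Bool)) (fun d ν => ind d * ν.weight) = fun ν => ind d * ν.weight := by
        intro d
        funext ν
        rw [wp_bind]
        simp only [wp_pure_fun]
        rw [wp_const_mul, tp_newPuzzles]
      simp only [h5]
      simp [ind]
  have h3 : ∀ P, ex (trial W A sec t (P ++ k :: S) P >>= fun v =>
      (List.replicate (t * N) k).mapM (W.newPuzzle sec) >>= fun qs =>
        afterAttempt W A sec t j S k N v qs) ind = solveProb W A sec t (P ++ [k]) S +
      ex (challenge W A sec t j S k N) ind * (1 - solveProb W A sec t P (k :: S)) := by
    intro P
    have h4 : solveProb W A sec t (P ++ [k]) S = wp (trial W A sec t (P ++ k :: S) P)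
        (fun v => wp (Prod.fst <$> verStep W sec v k) fun d ν => ind d * ν.weight) .vacuum := by
      rw [solveProb, trial_snoc, map_bind, ex, wp_bind]
    have h5 : 1 - solveProb W A sec t P (k :: S) = wp (trial W A sec t (P ++ k :: S) P)
        (fun v μ => (1 - ind v.1) * μ.weight) .vacuum := by
      have h6 : TP (trial W A sec t (P ++ k :: S) P) := tp_trial _ _ _ _ _ _
      rw [solveProb, ex_map]
      conv_lhs => rw [← ex_const h6 1]
      rw [← ex_sub]
      rfl
    rw [h4, h5, ← wp_const_mul, ← wp_add, ex, wp_bind]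
    exact wp_congr (b := ()) (equi_trial W A sec t _ P) good_vacuum (Bdd.of_noQubits _ _)
      fun v μ hμ _ hv => h2 v μ hμ hv
  have h4 : ∀ P, Closed (trial W A sec t (P ++ k :: S) P >>= fun v =>
      (List.replicate (t * N) k).mapM (W.newPuzzle sec) >>= fun qs =>
        afterAttempt W A sec t j S k N v qs) := fun P =>
    (equi_trial W A sec t _ P).bind (hqs.context.bind
      (haft.comp (g := fun p : (Unit × Bool × List Cell) × List (List Cell) => (p.1.2, p.2))
        fun _ _ => rfl))
  rw [h1.ex_eq, Closed.ex_bind (equi_sampleKeys W sec j) h4]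
  have hS : TP (sampleKeys W sec j) := tp_sampleKeys _ _ _
  simp only [h3]
  rw [ex_add, ex_const_mul, ex_sub, ex_const hS, mul_comm]
  rfl

/-- This is merely an inequality because, if all rounds fail, the empty answer may still be
accepted. -/
theorem le_ex_challenge (j : ℕ) (S : List (List Bool)) (k : List Bool) (N : ℕ) :
    nextProb W A sec t j k S * attempts N (avgProb W A sec t j (k :: S)) ≤
      ex (challenge W A sec t j S k N) ind := by
  induction N with
  | zero =>
    rw [attempts, Finset.sum_range_zero, mul_zero]
    exact ex_nonneg ind_nonneg
  | succ N ih =>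
    rw [ex_challenge_succ, attempts_succ, mul_add, mul_one, mul_left_comm]
    exact add_le_add_right (mul_le_mul_of_nonneg_left ih (sub_nonneg.2 (avgProb_le_one ..))) _

end
open Nom (ren)

/-! ## Random positions -/

section
variable (sec : ℕ)

theorem ex_coin (g : Bool → ℝ) : ex (coin sec) g = (g false + g true) / 2 := by
  have hw : ∀ (N : ℕ) ψ, (QMem.mk N ψ).weight = nsq ψ := fun _ _ => rfl
  have hs : ‖((Real.sqrt 2 : ℂ))⁻¹‖ ^ 2 = 1 / 2 := by
    rw [norm_inv, Complex.norm_real, Real.norm_of_nonneg (Real.sqrt_nonneg 2), inv_pow,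
      Real.sq_sqrt zero_le_two, one_div]
  have h0 : hadamard 0 (Finsupp.single ∅ 1) = (Real.sqrt 2 : ℂ)⁻¹ •
      (Finsupp.single ∅ 1 + Finsupp.single {0} 1) := by
    simp [hadamard]
  have h1 : project 0 false (hadamard 0 (Finsupp.single ∅ 1)) =
      Finsupp.single ∅ ((Real.sqrt 2 : ℂ)⁻¹) := by
    rw [h0, project, Finsupp.filter_smul, Finsupp.filter_add, Finsupp.filter_single_of_pos _ (by simp),
      Finsupp.filter_single_of_neg _ (by simp)]
    simp
  have h2 : project 0 true (hadamard 0 (Finsupp.single ∅ 1)) =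
      Finsupp.single {0} ((Real.sqrt 2 : ℂ)⁻¹) := by
    rw [h0, project, Finsupp.filter_smul, Finsupp.filter_add, Finsupp.filter_single_of_neg _ (by simp),
      Finsupp.filter_single_of_pos _ (by simp)]
    simp
  rw [coin, ex, wp_bind]
  simp only [wp_pure_fun]
  simp only [wp, coinAlg_exec, QMem.vacuum, List.map_cons, List.map_nil, List.sum_cons, List.sum_nil,
    hw, h1, h2, nsq_single, hs, topOf]
  simp
  ring

theorem closed_coin : Closed (coin sec) :=
  ((coinAlg.equi_exec sec).comp (g := fun _ : Unit => ([], [])) fun _ _ => rfl).bind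
    (Equi.pure (g := fun p : Unit × List Cell => decide (topOf p.2 = .one)) fun f p => by
      rw [NoQubits.ren_eq]
      exact congrArg (fun s => decide (s = Top.one)) (topOf_ren f p.2).symm)

theorem closed_sampleIndex (n' m : ℕ) : Closed (sampleIndex sec n' m) :=
  .foldlM (fun _ _ => (closed_coin sec).bind fun _ => Closed.pure _) _ _

/-- Reducing after every toss has the same effect as reducing the `m`-digit number once at the end.
For the induction the starting value is arbitrary and `g` is composed with one further reduction;
the latter is redundant, as `0` and the value after the last toss are already reduced. -/
theorem ex_sampleIndex (n' m : ℕ) (g : ℕ → ℝ) :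
    ex (sampleIndex sec n' m) g = (∑ y ∈ Finset.range (2 ^ m), g (y % (n' + 1))) / 2 ^ m := by
  have h : ∀ m x, ex ((List.replicate m ()).foldlM (fun x _ => coin sec >>= fun c =>
      pure ((2 * x + c.toNat) % (n' + 1))) x) (fun x => g (x % (n' + 1))) =
      (∑ y ∈ Finset.range (2 ^ m), g ((2 ^ m * x + y) % (n' + 1))) / 2 ^ m := by
    intro m
    induction m with
    | zero => intro x; simp [ex_pure]
    | succ m ih =>
      intro x
      have hc : ∀ x' : ℕ, Closed ((List.replicate m ()).foldlM (fun x _ => coin sec >>= fun c =>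
        pure ((2 * x + c.toNat) % (n' + 1))) x') := fun x' =>
        .foldlM (fun _ _ => (closed_coin sec).bind fun _ => Closed.pure _) _ _
      rw [List.replicate_succ, List.foldlM_cons, bind_assoc, Closed.ex_bind (closed_coin sec)
        fun c => by simp only [pure_bind]; exact hc _]
      simp only [pure_bind, ih, ex_coin]
      have e : ∀ c y : ℕ, g ((2 ^ m * ((2 * x + c) % (n' + 1)) + y) % (n' + 1)) =
          g ((2 ^ (m + 1) * x + (2 ^ m * c + y)) % (n' + 1)) := by
        intro c y
        congr 1
        rw [Nat.add_mod, Nat.mul_mod, Nat.mod_mod, ← Nat.mul_mod, ← Nat.add_mod]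
        congr 1
        ring
      simp only [e, pow_succ 2 m, mul_two, Finset.sum_range_add, Bool.toNat_false, Bool.toNat_true,
        mul_zero, mul_one, zero_add]
      field_simp
      ring
  have h0 := h m 0
  simp only [mul_zero, zero_add] at h0
  rw [← h0, sampleIndex]
  cases m with
  | zero => simp [ex_pure]
  | succ m =>
    rw [List.replicate_succ', List.foldlM_append]
    simp only [List.foldlM_cons, List.foldlM_nil, bind_pure]
    rw [Closed.ex_bind, Closed.ex_bind]
    · congr 1
      funext x
      rw [Closed.ex_bind (closed_coin sec) fun c => Closed.pure _,
        Closed.ex_bind (closed_coin sec) fun c => Closed.pure _]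
      simp only [ex_pure, Nat.mod_mod]
    all_goals first
      | exact .foldlM (fun _ _ => (closed_coin sec).bind fun _ => Closed.pure _) _ _
      | exact fun _ => (closed_coin sec).bind fun _ => Closed.pure _

theorem sum_range_mod (n : ℕ) (g : ℕ → ℝ) (Q : ℕ) :
    ∑ y ∈ Finset.range (Q * n), g (y % n) = Q * ∑ x ∈ Finset.range n, g x := by
  induction Q with
  | zero => simp
  | succ Q ih =>
    rw [Nat.succ_mul, Finset.sum_range_add, ih, Nat.cast_succ, add_mul, one_mul]
    congr 1
    refine Finset.sum_congr rfl fun x hx => ?_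
    rw [mul_comm, Nat.mul_add_mod, Nat.mod_eq_of_lt (Finset.mem_range.1 hx)]

/-- Each residue is hit at least `M / (n' + 1)` times, rounded down. Rounding loses less than one
hit, a relative loss of at most `(n' + 1) / M`, which is at most `1 / (2 q)`. -/
theorem le_ex_sampleIndex (n' q : ℕ) (hq : 0 < q) {g : ℕ → ℝ} (hg : ∀ x, 0 ≤ g x) :
    (1 - 1 / (2 * q)) / (n' + 1) * ∑ x ∈ Finset.range (n' + 1), g x ≤
      ex (sampleIndex sec n' (2 * (n' + 1) * q)) g := by
  obtain ⟨M, hM⟩ : ∃ M, M = 2 ^ (2 * (n' + 1) * q) := ⟨_, rfl⟩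
  -- A power of two exceeds its exponent, so as many tosses as the required size of `M` are more
  -- than enough.
  have hM' : 2 * (n' + 1) * q ≤ M := hM ▸ (Nat.lt_two_pow_self).le
  have hMpos : (0 : ℝ) < M := by rw [hM]; positivity
  rw [ex_sampleIndex, ← hM, show (2 : ℝ) ^ (2 * (n' + 1) * q) = M by rw [hM]; norm_num,
    le_div_iff₀ hMpos]
  have h1 : ((M / (n' + 1) : ℕ) : ℝ) * ∑ x ∈ Finset.range (n' + 1), g x ≤
      ∑ y ∈ Finset.range M, g (y % (n' + 1)) := by
    rw [← sum_range_mod]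
    exact Finset.sum_le_sum_of_subset_of_nonneg
      (Finset.range_subset_range.2 (Nat.div_mul_le_self _ _)) fun _ _ _ => hg _
  refine le_trans ?_ h1
  rw [mul_right_comm]
  refine mul_le_mul_of_nonneg_right ?_ (Finset.sum_nonneg fun x _ => hg x)
  have h2 : M < (M / (n' + 1) + 1) * (n' + 1) := by
    have := Nat.lt_div_mul_add (a := M) (b := n' + 1) (by omega)
    rw [add_mul, one_mul]
    exact this
  have h3 : (M : ℝ) < ((M / (n' + 1) : ℕ) + 1) * (n' + 1) := by exact_mod_cast h2
  have h4 : (2 : ℝ) * (n' + 1) * q ≤ M := by exact_mod_cast hM'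
  have hq' : (0 : ℝ) < q := by exact_mod_cast hq
  have hn : (0 : ℝ) < (n' : ℝ) + 1 := by positivity
  rw [div_mul_eq_mul_div, div_le_iff₀ hn]
  have h5 : (n' : ℝ) + 1 ≤ 1 / (2 * q) * M := by
    rw [div_mul_eq_mul_div, le_div_iff₀ (by positivity)]
    linarith
  linarith

end

section
variable (W : WeaklyVerifiablePuzzle) (A : QPTAlg) (sec t N : ℕ)

/-! ## The success probability of the reduction -/

/-- A lower bound for the probability that the reduction succeeds, when it has the keys `S`. -/
noncomputable def finalProb (j : ℕ) (S : List (List Bool)) : ℝ :=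
  ex (W.newKey sec) fun k =>
    nextProb W A sec t j k S * attempts N (avgProb W A sec t j (k :: S))

/-- The same, when `d` more keys have to be found first. -/
noncomputable def pathProb : ℕ → ℕ → List (List Bool) → ℝ
  | 0, j, S => finalProb W A sec t N j S
  | d + 1, j, S => attempts N (avgProb W A sec t (j + 1) S) * ex (W.newKey sec) fun k =>
      nextProb W A sec t j k S * pathProb d (j - 1) (k :: S)

theorem attempts_nonneg (N : ℕ) {x : ℝ} (hx : x ≤ 1) : 0 ≤ attempts N x :=
  Finset.sum_nonneg fun _ _ => pow_nonneg (sub_nonneg.2 hx) _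

theorem finalProb_nonneg (j : ℕ) (S : List (List Bool)) : 0 ≤ finalProb W A sec t N j S :=
  ex_nonneg fun _ => mul_nonneg (nextProb_nonneg ..) (attempts_nonneg _ (avgProb_le_one ..))

theorem closed_phase (j : ℕ) (S : List (List Bool)) : Closed (phase W A sec N t j S) :=
  (closed_selfAttempts W A sec t N j _).bind fun _ => Closed.pure _

theorem closed_phases (v : ℕ) (a : ℕ × List (List Bool)) : Closed (phases W A sec N t v a) :=
  .foldlM (fun _ _ => (closed_phase W A sec t N _ _).bind fun _ => Closed.pure _) _ _

theorem le_ex_phases (d j : ℕ) (S : List (List Bool)) : pathProb W A sec t N d j S ≤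
    ex (phases W A sec N t d (j, S)) fun a => finalProb W A sec t N a.1 a.2 := by
  induction d generalizing j S with
  | zero =>
    rw [phases, List.replicate_zero, List.foldlM_nil, ex_pure]
    rfl
  | succ d ih =>
    have h : phases W A sec N t (d + 1) (j, S) = phase W A sec N t j S >>= fun S' =>
        phases W A sec N t d (j - 1, S') := by
      simp only [phases, List.replicate_succ, List.foldlM_cons, bind_assoc, pure_bind]
    rw [h, Closed.ex_bind (closed_phase W A sec t N j S) fun S' => closed_phases W A sec t N d _]
    refine le_trans ?_ (le_ex_phase W A sec t N j S fun S' => ex_nonneg fun a => finalProb_nonneg ..)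
    exact mul_le_mul_of_nonneg_left (ex_mono fun k =>
      mul_le_mul_of_nonneg_left (ih ..) (nextProb_nonneg ..)) (attempts_nonneg _ (avgProb_le_one ..))

/-- The choice of the position and the phases do not look at the given puzzles, so they can be moved
in front of the generation of these. For each outcome of this preparation there remains a challenge
with a fresh key. -/
theorem le_successProb {A' : QPTAlg} (n' q : ℕ) (hq : 0 < q)
    (hA' : ∀ X, A'.exec sec X [] = solve W A sec n' N t (2 * (n' + 1) * q) X) :
    (1 - 1 / (2 * q)) / (n' + 1) * ∑ d ∈ Finset.range (n' + 1), pathProb W A sec t N d n' [] ≤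
      W.system.successProb A' (t * N) sec := by
  let prep : QM (ℕ × List (List Bool)) := sampleIndex sec n' (2 * (n' + 1) * q) >>= fun x =>
    phases W A sec N t (n' - x) (n', [])
  have hprep : Closed prep :=
    (closed_sampleIndex sec n' _).bind fun x => closed_phases W A sec t N _ _
  have h1 : W.system.successProb A' (t * N) sec = prob (W.newKey sec >>= fun k =>
      (List.replicate (t * N) k).mapM (W.newPuzzle sec) >>= fun ps => prep >>= fun a =>
        realAttempts W A sec t a.1 a.2 k N ps) := by
    show prob (W.newKey sec >>= fun k => (List.replicate (t * N) k).mapM (W.newPuzzle sec) >>=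
      fun ps => A'.exec sec (encode ps) [] >>= fun ans => W.accept sec ans k) = _
    simp only [hA', solve, prep, bind_assoc, realAttempts, pure_bind]
  have h2 : ∀ k, Sim (fun _ : Unit => (List.replicate (t * N) k).mapM (W.newPuzzle sec) >>= fun ps =>
      prep >>= fun a => realAttempts W A sec t a.1 a.2 k N ps) fun _ => prep >>= fun a =>
        challenge W A sec t a.1 a.2 k N := fun k =>
    Sim.comm (β := Unit) (equi_newPuzzles W sec _) hprep
      (h := fun _ ps a => realAttempts W A sec t a.1 a.2 k N ps)
      ((Equi.noQubits (h := fun (a : ℕ × List (List Bool)) ps => realAttempts W A sec t a.1 a.2 k N ps)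
        fun a => equi_realAttempts' W A sec t a.1 a.2 k N).comp
        (g := fun p : Unit × List (List Cell) × ℕ × List (List Bool) => (p.2.2, p.2.1))
        fun _ _ => rfl)
  have h3 : ∀ k, Closed ((List.replicate (t * N) k).mapM (W.newPuzzle sec) >>= fun ps =>
      prep >>= fun a => realAttempts W A sec t a.1 a.2 k N ps) := fun k =>
    (equi_newPuzzles W sec _).bind (hprep.context.bind ((Equi.noQubits
      (h := fun (a : ℕ × List (List Bool)) ps => realAttempts W A sec t a.1 a.2 k N ps)
        fun a => equi_realAttempts' W A sec t a.1 a.2 k N).comp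
        (g := fun p : (Unit × List (List Cell)) × ℕ × List (List Bool) => (p.2, p.1.2))
        fun _ _ => rfl))
  rw [h1, prob_eq_ex, Closed.ex_bind (equi_newKey W sec) h3]
  simp only [(h2 _).ex_eq, Closed.ex_bind hprep fun a => closed_challenge W A sec t a.1 a.2 _ N]
  -- The key is independent of the preparation, so the two expectations can be exchanged. Reversing
  -- the sum matches the index `x` with `d = n' - x` phases.
  rw [ex_comm, Closed.ex_bind (closed_sampleIndex sec n' _) fun x => closed_phases W A sec t N _ _,
    ← Finset.sum_range_reflect]
  refine le_trans ?_ (le_ex_sampleIndex sec n' q hq fun x => ex_nonneg fun a =>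
    ex_nonneg fun k => ex_nonneg ind_nonneg)
  refine mul_le_mul_of_nonneg_left (Finset.sum_le_sum fun x _ => ?_) ?_
  · rw [show n' + 1 - 1 - x = n' - x from rfl]
    refine (le_ex_phases W A sec t N (n' - x) n' []).trans (ex_mono fun a => ex_mono fun k =>
      le_ex_challenge ..)
  · have : (1 : ℝ) ≤ q := by exact_mod_cast hq
    have : 1 / (2 * (q : ℝ)) ≤ 1 := by
      rw [div_le_one (by positivity)]
      linarith
    have : (0 : ℝ) ≤ 1 - 1 / (2 * q) := by linarith
    positivity

end
open Nom (ren)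

/-! ## The core inequality -/

theorem mul_attempts (N : ℕ) (x : ℝ) : x * attempts N x = 1 - (1 - x) ^ N := by
  have := mul_neg_geom_sum (1 - x) N
  rw [sub_sub_cancel] at this
  exact this

theorem mul_attempts_le {N : ℕ} {x : ℝ} (hx : x ≤ 1) : x * attempts N x ≤ 1 := by
  rw [mul_attempts]
  exact sub_le_self _ (pow_nonneg (sub_nonneg.2 hx) _)

/-- The power is at most each of the `N` terms of `attempts N x`, so `N * (1 - x) ^ N` is at most
their sum, and `mul_attempts_le` applies. -/
theorem mul_pow_le {N : ℕ} (hN : 0 < N) {x : ℝ} (h0 : 0 ≤ x) (h1 : x ≤ 1) :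
    x * (1 - x) ^ N ≤ 1 / N := by
  rw [le_div_iff₀ (by exact_mod_cast hN)]
  refine le_trans ?_ (mul_attempts_le (N := N) h1)
  rw [mul_assoc]
  refine mul_le_mul_of_nonneg_left ?_ h0
  rw [mul_comm, attempts, ← nsmul_eq_mul, ← Finset.card_range N, ← Finset.sum_const,
    Finset.card_range]
  exact Finset.sum_le_sum fun l hl =>
    pow_le_pow_of_le_one (sub_nonneg.2 h1) (sub_le_self _ h0) (Finset.mem_range.1 hl).le

theorem attempts_one {N : ℕ} (hN : 0 < N) : attempts N 1 = 1 := by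
  have := mul_attempts N 1
  rwa [one_mul, sub_self, zero_pow hN.ne', sub_zero] at this

/-- For `y = 1` this is `1 + log u ≤ u`, for `y = 0` it is clear, and the left side is affine in
`y`. The factor `y` stands for `attempts * completion`, which would be 1 without truncation. -/
theorem mul_one_add_log_le {y u : ℝ} (hu : 0 < u) (h0 : 0 ≤ y) (h1 : y ≤ 1) :
    y * (1 + Real.log u) ≤ u := by
  have h := Real.log_le_sub_one_of_pos hu
  rcases le_total 0 (1 + Real.log u) with h2 | h2
  · nlinarith
  · nlinarith [mul_nonneg h0 (neg_nonneg.2 h2)]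

section
variable (W : WeaklyVerifiablePuzzle) (A : QPTAlg) (sec t N : ℕ)

/-- The probability that all of `m` keys are found. -/
noncomputable def completion : ℕ → List (List Bool) → ℝ
  | 0, _ => 1
  | m + 1, S => ex (W.newKey sec) fun k => nextProb W A sec t m k S *
      (attempts N (avgProb W A sec t m (k :: S)) * completion m (k :: S))

theorem completion_nonneg (m : ℕ) (S : List (List Bool)) : 0 ≤ completion W A sec t N m S := by
  induction m generalizing S with
  | zero => exact zero_le_one
  | succ m ih =>
    exact ex_nonneg fun _ => mul_nonneg (nextProb_nonneg ..)
      (mul_nonneg (attempts_nonneg _ (avgProb_le_one ..)) (ih _))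

/-- By induction `completion` is at most `avgProb`, since each of its factors `attempts *
completion` is at most 1. -/
theorem attempts_mul_completion_le_one (hN : 0 < N) (m : ℕ) (S : List (List Bool)) :
    attempts N (avgProb W A sec t m S) * completion W A sec t N m S ≤ 1 := by
  induction m generalizing S with
  | zero => rw [avgProb_zero, attempts_one hN, completion, one_mul]
  | succ m ih =>
    have h : completion W A sec t N (m + 1) S ≤ avgProb W A sec t (m + 1) S := by
      rw [← ex_nextProb]
      exact ex_mono fun k => mul_le_of_le_one_right (nextProb_nonneg ..) (ih _)
    refine (mul_le_mul_of_nonneg_left h (attempts_nonneg _ (avgProb_le_one ..))).trans ?_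
    rw [mul_comm]
    exact mul_attempts_le (avgProb_le_one ..)

/-- With unboundedly many attempts, `completion` would equal `avgProb` whenever no division by zero
occurs. By `mul_pow_le`, truncation at `N` costs at most `1 / N` for each key, even where `avgProb`
is tiny. -/
theorem le_completion (hN : 0 < N) (m : ℕ) (S : List (List Bool)) :
    avgProb W A sec t m S - m / N ≤ completion W A sec t N m S := by
  induction m generalizing S with
  | zero => simp [avgProb_zero, completion]
  | succ m ih =>
    have hN' : (0 : ℝ) < N := by exact_mod_cast hN
    rw [← ex_nextProb, completion, ← ex_const (tp_newKey W sec) (((m + 1 : ℕ) : ℝ) / N), ← ex_sub]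
    refine ex_mono fun k => ?_
    have h1 := ih (k :: S)
    have ha := nextProb_nonneg W A sec t m k S
    have hab := nextProb_le W A sec t m k S
    have hb := avgProb_le_one W A sec t m (k :: S)
    have hb0 := ha.trans hab
    have hc := attempts_nonneg N hb
    have h2 := mul_le_mul_of_nonneg_left (mul_le_mul_of_nonneg_left h1 hc) ha
    have h3 := mul_attempts N (avgProb W A sec t m (k :: S))
    have h4 := mul_pow_le hN hb0 hb
    have h5 := mul_attempts_le (N := N) hb
    generalize nextProb W A sec t m k S = a at *
    generalize avgProb W A sec t m (k :: S) = b at *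
    generalize completion W A sec t N m (k :: S) = M at *
    have h6 : a * (1 - b) ^ N ≤ 1 / N :=
      (mul_le_mul_of_nonneg_right hab (pow_nonneg (sub_nonneg.2 hb) _)).trans h4
    have h7 : a * attempts N b ≤ 1 := (mul_le_mul_of_nonneg_right hab hc).trans h5
    have h8 : a * attempts N b * (m / N) ≤ m / N :=
      mul_le_of_le_one_left (by positivity) h7
    have h9 : a * (attempts N b * (b - m / N)) =
        a - a * (1 - b) ^ N - a * attempts N b * (m / N) := by
      rw [mul_sub, mul_comm (attempts N b) b, h3]
      ring
    have h10 : ((m + 1 : ℕ) : ℝ) / N = m / N + 1 / N := by push_cast; ring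
    linarith

/-- The sum of the success probabilities for all positions. -/
noncomputable def totalProb (m : ℕ) (S : List (List Bool)) : ℝ :=
  ∑ d ∈ Finset.range m, pathProb W A sec t N d (m - 1) S

/-- Either the given puzzles are placed here, or one more key is found first and they are placed
further left. -/
theorem totalProb_succ (m : ℕ) (S : List (List Bool)) : totalProb W A sec t N (m + 1) S =
    finalProb W A sec t N m S + attempts N (avgProb W A sec t (m + 1) S) *
      ex (W.newKey sec) fun k => nextProb W A sec t m k S * totalProb W A sec t N m (k :: S) := by
  have h : ∀ l, ex (W.newKey sec) (fun k => nextProb W A sec t m k S *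
      ∑ d ∈ Finset.range l, pathProb W A sec t N d (m - 1) (k :: S)) =
      ∑ d ∈ Finset.range l, ex (W.newKey sec) fun k => nextProb W A sec t m k S *
        pathProb W A sec t N d (m - 1) (k :: S) := by
    intro l
    induction l with
    | zero => simp [ex_const (tp_newKey W sec)]
    | succ l ih => simp only [Finset.sum_range_succ, mul_add, ex_add, ih]
  rw [totalProb, Finset.sum_range_succ', add_comm]
  simp only [totalProb, h]
  rw [Finset.mul_sum]
  rfl

/-- Without truncation the bound reads `δ * (m + 1 + θ - exp θ * δ ^ m / Z)`, where `Z` is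
`avgProb`. Its maximum over `θ`, at `θ = log (Z / δ ^ m)`, is `δ * (m + log (Z / δ ^ m))`. For fixed
`θ` the bound is linear in `attempts` and in `attempts * completion`; averaged with the weights
`nextProb`, these give `finalProb` and the next `completion` exactly. Optimising `θ` after averaging
replaces Jensen's inequality. -/
theorem le_totalProb (hN : 0 < N) {δ : ℝ} (hδ : 0 < δ) (m : ℕ) (S : List (List Bool)) (θ : ℝ) :
    δ * ((m + 1 + θ) * (attempts N (avgProb W A sec t m S) * completion W A sec t N m S) -
      Real.exp θ * δ ^ m * attempts N (avgProb W A sec t m S)) ≤ totalProb W A sec t N m S := by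
  induction m generalizing S θ with
  | zero =>
    rw [avgProb_zero, attempts_one hN]
    simp only [completion, totalProb, Finset.range_zero, Finset.sum_empty]
    have := Real.add_one_le_exp θ
    push_cast
    nlinarith
  | succ m ih =>
    have hs := finalProb_nonneg W A sec t N m S
    have hy1 := attempts_mul_completion_le_one W A sec t N hN (m + 1) S
    have hc := attempts_nonneg N (avgProb_le_one W A sec t (m + 1) S)
    have hy0 := mul_nonneg hc (completion_nonneg W A sec t N (m + 1) S)
    have key : ∀ θ', δ * ((m + 1 + θ') * completion W A sec t N (m + 1) S -
        Real.exp θ' * δ ^ m * finalProb W A sec t N m S) ≤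
        ex (W.newKey sec) fun k => nextProb W A sec t m k S * totalProb W A sec t N m (k :: S) := by
      intro θ'
      rw [completion, finalProb, ← ex_const_mul, ← ex_const_mul, ← ex_sub, ← ex_const_mul]
      refine ex_mono fun k => ?_
      have := mul_le_mul_of_nonneg_left (ih (k :: S) θ') (nextProb_nonneg W A sec t m k S)
      linarith
    have key' := fun θ' => mul_le_mul_of_nonneg_left (key θ') hc
    rw [totalProb_succ]
    generalize finalProb W A sec t N m S = s at *
    generalize attempts N (avgProb W A sec t (m + 1) S) = c at *
    generalize completion W A sec t N (m + 1) S = M at *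
    generalize (ex (W.newKey sec) fun k => nextProb W A sec t m k S *
      totalProb W A sec t N m (k :: S)) = T at *
    push_cast
    rcases hs.eq_or_lt with rfl | hs
    -- If `s = 0` the exponential term of the induction hypothesis vanishes, so `θ` may be raised at
    -- no cost.
    · have h1 := key' (θ + 1)
      have h2 : 0 ≤ δ * (Real.exp θ * δ ^ (m + 1) * c) := by positivity
      linarith
    -- This value turns `exp θ' * s` into `exp θ * δ`, which supplies the additional factor `δ`. The
    -- lost logarithm is made up for by the summand `s`, through `mul_one_add_log_le` with `u = s /
    -- δ`.
    · have h1 := key' (θ - Real.log (s / δ))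
      have h2 : Real.exp (θ - Real.log (s / δ)) * s = Real.exp θ * δ := by
        rw [Real.exp_sub, Real.exp_log (by positivity)]
        field_simp
      have h3 : c * (δ * ((m + 1 + (θ - Real.log (s / δ))) * M -
          Real.exp (θ - Real.log (s / δ)) * δ ^ m * s)) = δ * ((m + 1 + (θ - Real.log (s / δ))) *
          (c * M)) - δ * (Real.exp (θ - Real.log (s / δ)) * s * (δ ^ m * c)) := by ring
      rw [h3, h2] at h1
      have h4 := mul_le_mul_of_nonneg_left
        (mul_one_add_log_le (u := s / δ) (by positivity) hy0 hy1) hδ.le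
      rw [mul_div_cancel₀ _ hδ.ne'] at h4
      have h5 : Real.exp θ * δ ^ (m + 1) * c = Real.exp θ * δ * (δ ^ m * c) := by ring
      rw [h5]
      nlinarith

/-- The value `θ = 0` is the best one when `avgProb` equals `δ ^ n`, the least that is assumed. The
main terms are then `n + 1` and `-1`, and the rest of the proof bounds the truncation error. -/
theorem le_totalProb_of_avgProb {δ : ℝ} (hδ : 0 < δ) {n r q : ℕ} (hn : 0 < n) (hq : 0 < q)
    (hr : 1 ≤ r * δ ^ n) (hZ : δ ^ n ≤ avgProb W A sec t n []) :
    δ * (n * (1 - 1 / (2 * q))) ≤ totalProb W A sec t (8 * n * r * q) n [] := by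
  have hr0 : 0 < r := by
    rcases Nat.eq_zero_or_pos r with rfl | h
    · norm_num at hr
    · exact h
  obtain ⟨N, hN⟩ : ∃ N, N = 8 * n * r * q := ⟨_, rfl⟩
  have hN0 : 0 < N := by rw [hN]; positivity
  rw [← hN]
  refine le_trans (mul_le_mul_of_nonneg_left ?_ hδ.le) (le_totalProb W A sec t N hN0 hδ n [] 0)
  have hb := avgProb_le_one W A sec t n []
  have hM := mul_le_mul_of_nonneg_left (le_completion W A sec t N hN0 n []) (attempts_nonneg N hb)
  have hc := attempts_nonneg N hb
  generalize completion W A sec t N n [] = M at *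
  generalize avgProb W A sec t n [] = Z at *
  have hZ0 : 0 < Z := (pow_pos hδ n).trans_le hZ
  have hrZ : 1 ≤ r * Z := hr.trans (mul_le_mul_of_nonneg_left hZ (Nat.cast_nonneg r))
  have h1 := mul_attempts N Z
  have h2 := mul_attempts_le (N := N) hb
  have h3 := mul_pow_le hN0 hZ0.le hb
  have hNR : (N : ℝ) = 8 * n * r * q := by rw [hN]; push_cast; ring
  have hn' : (1 : ℝ) ≤ n := by exact_mod_cast hn
  have hq' : (1 : ℝ) ≤ q := by exact_mod_cast hq
  have hr' : (1 : ℝ) ≤ r := by exact_mod_cast hr0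
  have hN1 : (0 : ℝ) < N := by exact_mod_cast hN0
  have h4 : attempts N Z ≤ r := by
    calc attempts N Z ≤ r * Z * attempts N Z := le_mul_of_one_le_left hc hrZ
      _ = r * (Z * attempts N Z) := by ring
      _ ≤ r := mul_le_of_le_one_right (by positivity) h2
  have h5 : (1 - Z) ^ N ≤ r / N := by
    have hp : 0 ≤ (1 - Z) ^ N := pow_nonneg (sub_nonneg.2 hb) _
    calc (1 - Z) ^ N ≤ r * Z * (1 - Z) ^ N := le_mul_of_one_le_left hp hrZ
      _ = r * (Z * (1 - Z) ^ N) := by ring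
      _ ≤ r * (1 / N) := mul_le_mul_of_nonneg_left h3 (by positivity)
      _ = r / N := by ring
  have h6 : attempts N Z * (n / N) ≤ r * (n / N) := mul_le_mul_of_nonneg_right h4 (by positivity)
  have h7 : δ ^ n * attempts N Z ≤ 1 := (mul_le_mul_of_nonneg_right hZ hc).trans h2
  have h8 : 1 - (n + 1) * (r / N) ≤ attempts N Z * M := by
    have : attempts N Z * (Z - n / N) = 1 - (1 - Z) ^ N - attempts N Z * (n / N) := by
      rw [mul_sub, mul_comm _ Z, h1]
    have : (n + 1) * ((r : ℝ) / N) = r / N + r * (n / N) := by ring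
    linarith
  -- The error is `(n + 1) ^ 2 * r / N`, and `(n + 1) ^ 2 ≤ 4 * n ^ 2`. This is where the constant 8
  -- in `N = 8 n r q` comes from.
  have h9 : (n + 1) * ((n + 1) * ((r : ℝ) / N)) ≤ n * (1 / (2 * q)) := by
    have : n * (1 / (2 * (q : ℝ))) = 4 * n ^ 2 * (r / N) := by
      rw [hNR]
      field_simp
      ring
    rw [this, ← mul_assoc]
    refine mul_le_mul_of_nonneg_right ?_ (by positivity)
    nlinarith
  have h10 := mul_le_mul_of_nonneg_left h8 (by positivity : (0 : ℝ) ≤ n + 1)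
  rw [Real.exp_zero, add_zero, one_mul]
  linarith

end
open Nom (ren)

/-! ## The parallel repetition -/

section
variable (W : WeaklyVerifiablePuzzle) (A : QPTAlg) (sec t : ℕ)

theorem closed_newKeys (n : ℕ) : Closed ((List.replicate n sec).mapM W.newKey) :=
  .mapM (fun _ => equi_newKey W _) _

/-- The two procedures list the keys in opposite orders. As the keys are independent and identically
distributed, the expectations agree. -/
theorem ex_newKeys (n : ℕ) (g : List (List Bool) → ℝ) :
    ex ((List.replicate n sec).mapM W.newKey) g = ex (sampleKeys W sec n) g := by
  induction n generalizing g with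
  | zero => simp [sampleKeys]
  | succ n ih =>
    have h : sampleKeys W sec (n + 1) = sampleKeys W sec n >>= fun P => W.newKey sec >>= fun k =>
        pure (k :: P) := by
      rw [sampleKeys, List.replicate_succ', List.foldlM_append]
      simp only [List.foldlM_cons, List.foldlM_nil, bind_pure]
      rfl
    have h' : (List.replicate (n + 1) sec).mapM W.newKey = W.newKey sec >>= fun k =>
        (fun P => k :: P) <$> (List.replicate n sec).mapM W.newKey := by
      simp only [List.replicate_succ, List.mapM_cons, map_eq_pure_bind]
    rw [h, h', Closed.ex_bind (equi_newKey W sec) fun k => (closed_newKeys W sec n).map .classical,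
      Closed.ex_bind (h := fun P => W.newKey sec >>= fun k => pure (k :: P))
        (equi_sampleKeys W sec n) fun P => Closed.bind (equi_newKey W sec) fun k => Closed.pure _, ← ih]
    simp only [ex_map]
    rw [ex_comm]
    congr 1
    funext P
    rw [Closed.ex_bind (equi_newKey W sec) fun k => Closed.pure _]
    simp only [ex_pure]

theorem addTuples_eq (ks : List (List Bool)) (X : List Cell) : addTuples W sec t ks X =
    (fun ps => X ++ encode ps) <$> (List.replicate t ks).mapM fun ks =>
      ks.mapM (W.newPuzzle sec) >>= fun p => pure (encode p) := by
  induction t generalizing X with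
  | zero => simp [addTuples, encode]
  | succ t ih =>
    have h0 : addTuples W sec (t + 1) ks X = ks.mapM (W.newPuzzle sec) >>= fun p =>
        addTuples W sec t ks (X ++ frame (encode p)) := by
      simp only [addTuples, List.replicate_succ, List.foldlM_cons, addTuple, bind_assoc, pure_bind]
    have h : ∀ (w : List Cell) ws, encode (w :: ws) = frame w ++ encode ws := fun _ _ => rfl
    simp only [h0, ih, List.replicate_succ, List.mapM_cons, map_bind, map_pure, bind_assoc, pure_bind,
      h, List.append_assoc]
    simp only [map_eq_pure_bind]

theorem verSteps_eq (ks : List (List Bool)) (b : Bool) (w : List Cell) :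
    Prod.fst <$> ks.foldlM (verStep W sec) (b, w) = (fun ds : List Bool => b && ds.all id) <$>
      ((decode ks.length w).zip ks).mapM fun r => W.accept sec r.1 r.2 := by
  induction ks generalizing b w with
  | nil => simp [decode]
  | cons k ks ih =>
    simp only [List.foldlM_cons, List.length_cons, decode, List.zip_cons_cons, List.mapM_cons,
      map_bind, verStep, bind_assoc, pure_bind] at ih ⊢
    simp only [ih, map_pure, List.all_cons, id, Bool.and_assoc]
    simp only [map_eq_pure_bind]

/-- The repetition is the case in which no keys are fixed: all `n` keys are fresh and all answers
are verified. The length of the list of keys has to be known, because `decode` reads a prescribed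
number of answers. -/
theorem parallel_successProb (n : ℕ → ℕ) : (W.system.parallel n).successProb A t sec =
    avgProb W A sec t (n sec) [] := by
  have hkeys : All ((List.replicate (n sec) sec).mapM W.newKey) fun ks => ks.length = n sec :=
    (All.mapM (P := fun _ => True) (Q := fun _ => True) (fun _ _ => All.trivial _) _
      fun _ _ => True.intro).mono fun _ h => h.1.trans List.length_replicate
  have h : (W.system.parallel n).successProb A t sec = prob
      ((List.replicate (n sec) sec).mapM W.newKey >>= fun ks => (List.replicate t ks).mapM (fun ks =>
        ks.mapM (W.newPuzzle sec) >>= fun p => pure (encode p)) >>= fun ps =>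
          A.exec sec (encode ps) [] >>= fun ans => ((decode (n sec) ans).zip ks).mapM
            (fun r => W.accept sec r.1 r.2) >>= fun ds => pure (ds.all id)) := rfl
  rw [h, hkeys.bind_congr (h' := fun ks => Prod.fst <$> trial W A sec t (ks ++ []) ks), prob_eq_ex,
    Closed.ex_bind (closed_newKeys W sec _) fun ks => closed_verdict W A sec t _ _, ex_newKeys]
  · rfl
  · intro ks hks
    simp only [List.append_nil, trial, addTuples_eq, map_bind, verSteps_eq, hks, bind_map_left,
      List.nil_append, Bool.true_and]
    simp only [map_eq_pure_bind]

end
end QPuzzle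

theorem mainTheorem2 (W : QPuzzle.WeaklyVerifiablePuzzle) (n q t : Polynomial ℕ) (δ : ℕ → ℝ)
    (hδ : ∀ sec, 0 < δ sec ∧ δ sec < 1) (r : Polynomial ℕ)
    (hr : ∀ sec : ℕ, 1 ≤ ((r.eval sec : ℕ) : ℝ) * δ sec ^ n.eval sec)
    (A : QPuzzle.QPTAlg) :
    ∃ (p : Polynomial ℕ) (A' : QPuzzle.QPTAlg), ∀ sec : ℕ, 0 < n.eval sec → 0 < q.eval sec →
      (W.system.parallel fun s => n.eval s).SolvesAt A (t.eval sec) (δ sec ^ n.eval sec) sec →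
      W.system.SolvesAt A' ((t * p).eval sec)
        (δ sec * (1 - 1 / ((q.eval sec : ℕ) : ℝ))) sec := by
  -- The coin tosses number `2 n q` and the attempts `8 n r q`; each choice costs one factor `1 - 1
  -- / (2 q)`. Every attempt uses `t` copies of the puzzle, whence `p = 8 n r q`.
  obtain ⟨A', hA'⟩ := QPuzzle.exists_solveAlg W A n (2 * n * q) t (8 * n * r * q)
  refine ⟨8 * n * r * q, A', fun sec hn hq hA => ?_⟩
  have e1 : (2 * n * q).eval sec = 2 * n.eval sec * q.eval sec := by simp
  have e2 : (8 * n * r * q).eval sec = 8 * n.eval sec * r.eval sec * q.eval sec := by simp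
  have hA'sec := hA' sec
  rw [QPuzzle.PuzzleSystem.SolvesAt, QPuzzle.parallel_successProb] at hA
  rw [e1, e2] at hA'sec
  rw [QPuzzle.PuzzleSystem.SolvesAt, Polynomial.eval_mul, e2]
  have h1 := QPuzzle.le_totalProb_of_avgProb W A sec (t.eval sec) (hδ sec).1 hn hq (hr sec) hA
  obtain ⟨n', hn'⟩ : ∃ n', n.eval sec = n' + 1 := ⟨n.eval sec - 1, by omega⟩
  rw [hn'] at h1 hA'sec ⊢
  have h2 := QPuzzle.le_successProb W A sec (t.eval sec) _ n' (q.eval sec) hq hA'sec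
  refine le_trans ?_ h2
  have hq' : (1 : ℝ) ≤ ((q.eval sec : ℕ) : ℝ) := by exact_mod_cast hq
  obtain ⟨x, hx⟩ : ∃ x : ℝ, x = 1 / (2 * ((q.eval sec : ℕ) : ℝ)) := ⟨_, rfl⟩
  have hx2 : 1 / ((q.eval sec : ℕ) : ℝ) = 2 * x := by
    rw [hx]
    field_simp
  have hx1 : x ≤ 1 := by
    rw [hx, div_le_one (by positivity)]
    linarith
  rw [← hx] at h1 ⊢
  rw [hx2]
  have hpos : (0 : ℝ) < (n' : ℝ) + 1 := by positivity
  refine le_trans ?_ (mul_le_mul_of_nonneg_left h1 (div_nonneg (sub_nonneg.2 hx1) hpos.le))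
  have h3 : (1 - x) / (n' + 1) * (δ sec * (((n' + 1 : ℕ) : ℝ) * (1 - x))) =
      δ sec * (1 - x) ^ 2 := by
    push_cast
    field_simp
  rw [h3]
  -- With `x = 1 / (2 q)`, the product of the two losses is `(1 - x) ^ 2 ≥ 1 - 2 x = 1 - 1 / q`.
  exact mul_le_mul_of_nonneg_left (by nlinarith [sq_nonneg x]) (hδ sec).1.le
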